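/- Let $D>3$ be an integer, $\beta>0$, and let $S^1=\mathbb R/\beta\mathbb Z$. Write $z=(x,\tau)\in\mathbb R^{D-1}\times S^1$. Let $\mathcal X$ be the set of functions $\phi\in W^{1,2}_{\rm loc}(\mathbb R^{D-1}\times S^1)$ that vanish at spatial infinity: for every $\epsilon>0$ there is a compact $K\subset\mathbb R^{D-1}$ with $|\phi(z)|<\epsilon$ for a.e. $z\notin K\times S^1$. Let $V:\mathbb R\to\mathbb R$ be admissible: $V(0)=0$; $V$ is Borel measurable, lower semicontinuous and somewhere negative; and there are constants $0<A<B<\frac{2D}{D-2}$ and $a,b>0$, possibly different for $s\ge 0$ and $s\le 0$, with $V(s)-a|s|^A+b|s|^B\ge 0$. Assume moreover that $V$ is differentiable and locally Lipschitz (for instance $C^1$). With weak derivatives, put $$\mathcal T[\phi]=\int\tfrac12|\nabla_x\phi|^2,\qquad \mathcal K[\phi]=\int\tfrac12(\partial_\tau\phi)^2,\qquad \mathcal V[\phi]=\int V(\phi),$$ $$S[\phi]=\mathcal T[\phi]+\mathcal K[\phi]+\mathcal V[\phi]\in(-\infty,+\infty],\qquad \mathcal R[\phi]=\frac{\mathcal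 T[\phi]^{(D-1)/(D-3)}}{-\mathcal V[\phi]-\mathcal K[\phi]}.$$ A *saddle point* of $S$ is a weak solution of the Euler–Lagrange equation in $\mathcal X$, that is, a $\phi\in\mathcal X$ with $V'(\phi)\in L^2_{\rm loc}$ and $$\int\big[\partial_\tau\eta\,\partial_\tau\phi+\nabla_x\eta\cdot\nabla_x\phi+\eta\,V'(\phi)\big]=0\qquad\text{for all }\eta\in C_c^\infty(\mathbb R^{D-1}\times S^1).$$ It is non-trivial if it is not a.e. equal to $0$. A *solution of the reduced problem* is a minimizer of $\mathcal R$ among all $\phi\in\mathcal X$ of finite $\mathcal T,\mathcal K,\mathcal V$ with $\mathcal V[\phi]=v$ and $\mathcal K[\phi]<-\mathcal V[\phi]$, for some fixed $v<0$. **Theorem.** Let $\phi$ be a solution of the reduced problem and, for $\lambda>0$, let $\phi_\lambda(x,\tau)=\phi(x/\lambda,\tau)$. There is exactly one $\lambda>0$ for which $\phi_\lambda$ satisfies Derrick's relation $$(D-3)\,\mathcal T[\phi_\lambda]+(D-1)\big(\mathcal V[\phi_\lambda]+\mathcal K[\phi_\lambda]\big)=0 .$$ For this $\lambda$, $\phi_\lambda$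 is a non-trivial saddle point of $S$ with finite action, and $S[\phi_\lambda]\le S[\psi]$ for every non-trivial saddle point $\psi$ of $S$. -/

import Mathlib

open MeasureTheory
open scoped ContDiff

namespace Bounce

/-- Space `ℝⁿ` with the Euclidean norm (in dimension `D` one has `n = D - 1`). -/
abbrev Space (n : ℕ) : Type := EuclideanSpace ℝ (Fin n)

/-- `ℝⁿ × S¹`, with `S¹ = ℝ / βℤ` the circle of circumference `β`. Its `volume` is the product of
Lebesgue measure on `ℝⁿ` and the arc length measure on `S¹` (of total mass `β`). -/
abbrev SpaceTime (n : ℕ) (β : ℝ) : Type := Space n × AddCircle β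

/-- Test functions `C_c^∞(ℝⁿ × S¹)`: compactly supported, and smooth when the circle is unrolled. -/
def IsTest {n : ℕ} {β : ℝ} (η : SpaceTime n β → ℝ) : Prop :=
  ContDiff ℝ ∞ (fun p : Space n × ℝ => η (p.1, (p.2 : AddCircle β))) ∧ HasCompactSupport η

/-- Classical spatial gradient `∇ₓ η`. -/
noncomputable def gradX {n : ℕ} {β : ℝ} (η : SpaceTime n β → ℝ) (z : SpaceTime n β) : Space n :=
  gradient (fun x : Space n => η (x, z.2)) z.1

/-- Classical derivative `∂_τ η` along the circle. -/
noncomputable def dTau {n : ℕ} {β : ℝ} (η : SpaceTime n β → ℝ) (z : SpaceTime n β) : ℝ :=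
  deriv (fun t : ℝ => η (z.1, z.2 + (t : AddCircle β))) 0

/-- Membership in `L²_loc`. -/
def MemL2Loc {n : ℕ} {β : ℝ} [Fact (0 < β)] {F : Type*} [NormedAddCommGroup F]
    (f : SpaceTime n β → F) : Prop :=
  ∀ K : Set (SpaceTime n β), IsCompact K → MemLp f 2 (volume.restrict K)

/-- `g` is a weak spatial gradient of `φ`. -/
def IsWeakGradX {n : ℕ} {β : ℝ} [Fact (0 < β)]
    (φ : SpaceTime n β → ℝ) (g : SpaceTime n β → Space n) : Prop :=
  LocallyIntegrable g ∧
    ∀ η : SpaceTime n β → ℝ, IsTest η → ∫ z, φ z • gradX η z = - ∫ z, η z • g z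

/-- `h` is a weak `τ`-derivative of `φ`. -/
def IsWeakDTau {n : ℕ} {β : ℝ} [Fact (0 < β)]
    (φ : SpaceTime n β → ℝ) (h : SpaceTime n β → ℝ) : Prop :=
  LocallyIntegrable h ∧
    ∀ η : SpaceTime n β → ℝ, IsTest η → ∫ z, φ z * dTau η z = - ∫ z, η z * h z

open Classical in
/-- The weak spatial gradient `∇ₓ φ` (unique almost everywhere; `0` if there is none). -/
noncomputable def weakGradX {n : ℕ} {β : ℝ} [Fact (0 < β)]
    (φ : SpaceTime n β → ℝ) : SpaceTime n β → Space n :=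
  if h : ∃ g, IsWeakGradX φ g then h.choose else 0

open Classical in
/-- The weak derivative `∂_τ φ` (unique almost everywhere; `0` if there is none). -/
noncomputable def weakDTau {n : ℕ} {β : ℝ} [Fact (0 < β)]
    (φ : SpaceTime n β → ℝ) : SpaceTime n β → ℝ :=
  if h : ∃ g, IsWeakDTau φ g then h.choose else 0

/-- `φ ∈ W^{1,2}_loc(ℝⁿ × S¹)`. -/
def IsW12Loc {n : ℕ} {β : ℝ} [Fact (0 < β)] (φ : SpaceTime n β → ℝ) : Prop :=
  MemL2Loc φ ∧ (∃ g, IsWeakGradX φ g ∧ MemL2Loc g) ∧ (∃ h, IsWeakDTau φ h ∧ MemL2Loc h)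

/-- `φ` vanishes at spatial infinity. -/
def VanishesAtInfinity {n : ℕ} {β : ℝ} [Fact (0 < β)] (φ : SpaceTime n β → ℝ) : Prop :=
  ∀ ε : ℝ, 0 < ε → ∃ K : Set (Space n), IsCompact K ∧
    ∀ᵐ z : SpaceTime n β, z.1 ∉ K → |φ z| < ε

/-- The function space on which the action is studied. -/
def IsConfig {n : ℕ} {β : ℝ} [Fact (0 < β)] (φ : SpaceTime n β → ℝ) : Prop :=
  IsW12Loc φ ∧ VanishesAtInfinity φ

/-- `𝒯[φ] = ∫ ½ |∇ₓ φ|²`. -/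
noncomputable def gradientEnergy {n : ℕ} {β : ℝ} [Fact (0 < β)] (φ : SpaceTime n β → ℝ) : ℝ :=
  ∫ z, (1 / 2) * ‖weakGradX φ z‖ ^ 2

/-- `𝒦[φ] = ∫ ½ (∂_τ φ)²`. -/
noncomputable def kineticEnergy {n : ℕ} {β : ℝ} [Fact (0 < β)] (φ : SpaceTime n β → ℝ) : ℝ :=
  ∫ z, (1 / 2) * (weakDTau φ z) ^ 2

/-- `𝒱[φ] = ∫ V(φ)`. -/
noncomputable def potentialEnergy {n : ℕ} {β : ℝ} [Fact (0 < β)] (V : ℝ → ℝ)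
    (φ : SpaceTime n β → ℝ) : ℝ :=
  ∫ z, V (φ z)

/-- `𝒯[φ]`, `𝒦[φ]` and `𝒱[φ]` are all finite (the three integrands are integrable). -/
def FiniteAction {n : ℕ} {β : ℝ} [Fact (0 < β)] (V : ℝ → ℝ) (φ : SpaceTime n β → ℝ) : Prop :=
  Integrable (fun z => ‖weakGradX φ z‖ ^ 2) ∧ Integrable (fun z => (weakDTau φ z) ^ 2) ∧
    Integrable (fun z => V (φ z))

open Classical in
/-- The action `S[φ] = 𝒯[φ] + 𝒦[φ] + 𝒱[φ] ∈ (-∞, +∞]`. For an admissible potential and a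
configuration `φ` the negative part of `V(φ)` is always integrable (it lives where `|φ|` is bounded
below, hence over a compact set, and there it is at most `b |φ|^B` with `B` subcritical); so the
action is `+∞` exactly when one of the three terms is not finite. -/
noncomputable def action {n : ℕ} {β : ℝ} [Fact (0 < β)] (V : ℝ → ℝ)
    (φ : SpaceTime n β → ℝ) : EReal :=
  if FiniteAction V φ then
    ((gradientEnergy φ + kineticEnergy φ + potentialEnergy V φ : ℝ) : EReal)
  else ⊤

/-- Admissible potentials in space-time dimension `D`. The constants of the growth condition may
differ on the two half-lines. -/
structure Admissible (D : ℕ) (V : ℝ → ℝ) : Prop where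
  map_zero : V 0 = 0
  measurable : Measurable V
  lowerSemicontinuous : LowerSemicontinuous V
  exists_neg : ∃ s, V s < 0
  growth_pos : ∃ A B a b : ℝ, 0 < A ∧ A < B ∧ B < 2 * (D : ℝ) / ((D : ℝ) - 2) ∧ 0 < a ∧ 0 < b ∧
    ∀ s : ℝ, 0 ≤ s → 0 ≤ V s - a * |s| ^ A + b * |s| ^ B
  growth_neg : ∃ A B a b : ℝ, 0 < A ∧ A < B ∧ B < 2 * (D : ℝ) / ((D : ℝ) - 2) ∧ 0 < a ∧ 0 < b ∧
    ∀ s : ℝ, s ≤ 0 → 0 ≤ V s - a * |s| ^ A + b * |s| ^ B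

/-- Saddle points of the action, for a differentiable potential: weak solutions of the
Euler-Lagrange equation `-∂_τ² φ - Δₓ φ + V'(φ) = 0` in the function space, where
`V'(φ) ∈ L²_loc`. -/
def IsSaddlePoint {n : ℕ} {β : ℝ} [Fact (0 < β)] (V : ℝ → ℝ) (φ : SpaceTime n β → ℝ) : Prop :=
  IsConfig φ ∧ MemL2Loc (fun z => deriv V (φ z)) ∧
    ∀ η : SpaceTime n β → ℝ, IsTest η →
      ∫ z, (dTau η z * weakDTau φ z + inner ℝ (gradX η z) (weakGradX φ z)
        + η z * deriv V (φ z)) = 0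

/-- The rescaled function `φ_ℓ(x, τ) = φ(x / ℓ, τ)`. -/
noncomputable def rescale {n : ℕ} {β : ℝ} (l : ℝ) (φ : SpaceTime n β → ℝ) : SpaceTime n β → ℝ :=
  fun z => φ (l⁻¹ • z.1, z.2)

/-- Derrick's relation `(D - 3) 𝒯[φ] + (D - 1) (𝒱[φ] + 𝒦[φ]) = 0`. -/
def Derrick {β : ℝ} [Fact (0 < β)] (D : ℕ) (V : ℝ → ℝ) (φ : SpaceTime (D - 1) β → ℝ) : Prop :=
  ((D : ℝ) - 3) * gradientEnergy φ +
    ((D : ℝ) - 1) * (potentialEnergy V φ + kineticEnergy φ) = 0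

/-- `ℛ[φ] = 𝒯[φ]^((D-1)/(D-3)) / (-𝒱[φ] - 𝒦[φ])`. -/
noncomputable def reducedFunctional {β : ℝ} [Fact (0 < β)] (D : ℕ) (V : ℝ → ℝ)
    (φ : SpaceTime (D - 1) β → ℝ) : ℝ :=
  gradientEnergy φ ^ (((D : ℝ) - 1) / ((D : ℝ) - 3)) / (- potentialEnergy V φ - kineticEnergy φ)

/-- The competitors of the reduced problem with potential energy fixed at `v`. (If `𝒯` is infinite,
then so is `ℛ`, and such functions play no role in a minimization.) -/
def IsCompetitor {β : ℝ} [Fact (0 < β)] (D : ℕ) (V : ℝ → ℝ) (v : ℝ)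
    (φ : SpaceTime (D - 1) β → ℝ) : Prop :=
  IsConfig φ ∧ FiniteAction V φ ∧ potentialEnergy V φ = v ∧ kineticEnergy φ < - potentialEnergy V φ

/-- Solutions of the reduced problem: minimizers of `ℛ` at a fixed negative value of `𝒱` under the
constraint `𝒦 < -𝒱`. -/
def IsReducedSolution {β : ℝ} [Fact (0 < β)] (D : ℕ) (V : ℝ → ℝ)
    (φ : SpaceTime (D - 1) β → ℝ) : Prop :=
  ∃ v : ℝ, v < 0 ∧ IsCompetitor D V v φ ∧
    ∀ ψ : SpaceTime (D - 1) β → ℝ, IsCompetitor D V v ψ →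
      reducedFunctional D V φ ≤ reducedFunctional D V ψ

end Bounce

open Bounce

/-! Put n = D - 1 and p = n/(n-2). Under φ ↦ φ(x/l, τ) the gradient energy 𝒯 scales by l^(n-2),
while 𝒦 and 𝒱 scale by l^n. Hence 𝒯^p scales exactly like 𝒦 + 𝒱, the quotient ℛ is scale invariant,
and fixing 𝒱 = v only fixes the scale. With c = -(𝒱 + 𝒦)/𝒯^p evaluated at φ, the functional F = c
𝒯^p + 𝒦 + 𝒱 is therefore nonnegative on all configurations of finite action and vanishes at φ and at
all its rescalings: the constraint has disappeared (`exists_isGroundState`,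
`IsGroundState.rescale`). Here 𝒯[φ] > 0, because a configuration without spatial gradient is
invariant under translations in x and vanishes at infinity.

Derrick's relation fixes l², so the scale exists and is unique (`existsUnique_derrick`). At that
scale it reads 𝒦 + 𝒱 = -𝒯/p; together with F = 0 this gives c p 𝒯^(p-1) = 1, so the first variation
of F is the first variation of S. Differentiating 𝒱 along test functions needs φ bounded, as V is
only locally Lipschitz and has no growth bound from above. Boundedness comes from De Giorgi's
method: comparing φ with min(φ, k), at well chosen levels k with V(k) ≤ 0, bounds the Dirichlet
energy of φ above each level s ≥ 1 by the integral of the critical power of φ there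
(`IsGroundState.energy_superlevel_le`, `exists_upper_bound`, `IsGroundState.exists_bound`). Then
`IsGroundState.isSaddlePoint` gives the Euler–Lagrange equation.

For minimality, a competing saddle point ψ of finite action must itself satisfy Derrick's relation
(`IsSaddlePoint.derrick`). No second derivatives of ψ are available, so the Pohozaev argument tests
the equation with cut-off difference quotients of translations: the quadratic energy leaves a
remainder of one sign, and letting t → 0 from both sides turns two inequalities into the local
conservation law `stress_identity`. The law is integrated against nearly linear fields and summed
over the axes. On solutions of Derrick's relation S = (2/n) 𝒯, and F[ψ] ≥ 0 = F[φ_λ] becomes 𝒯[φ_λ]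
≤ 𝒯[ψ] because p > 1. Saddle points of infinite action need no argument.

The preliminary parts develop weak derivatives on ℝⁿ × S¹ through the covering ℝⁿ × ℝ:
mollification, the chain rule, Stampacchia's truncation and the Sobolev inequality. -/

namespace Bounce

open MeasureTheory Filter Topology Set
open scoped ContDiff ENNReal NNReal

variable {n : ℕ} {β : ℝ}

/-! ### The covering of the cylinder and directional derivatives of test functions -/

/-- The covering map `ℝⁿ × ℝ → ℝⁿ × S¹`. -/
noncomputable def proj : Space n × ℝ →+ SpaceTime n β where
  toFun p := (p.1, (p.2 : AddCircle β))
  map_zero' := rfl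
  map_add' _ _ := rfl

@[simp] lemma proj_fst (p : Space n × ℝ) : (proj p : SpaceTime n β).1 = p.1 := rfl
@[simp] lemma proj_snd (p : Space n × ℝ) : (proj p : SpaceTime n β).2 = (p.2 : AddCircle β) := rfl

/-- Continuity on the cylinder can be tested on lifts, and every point lifts; this allows calculus
to be done upstairs. -/
lemma proj_isOpenQuotientMap : IsOpenQuotientMap (proj : Space n × ℝ → SpaceTime n β) :=
  IsOpenQuotientMap.id.prodMap (QuotientAddGroup.isOpenQuotientMap_mk (N := AddSubgroup.zmultiples β))

lemma continuous_proj : Continuous (proj : Space n × ℝ → SpaceTime n β) :=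
  proj_isOpenQuotientMap.continuous

lemma proj_surjective : Function.Surjective (proj : Space n × ℝ → SpaceTime n β) :=
  proj_isOpenQuotientMap.surjective

/-- The derivative of `η` in the direction `v`. -/
noncomputable def dirDeriv (v : Space n × ℝ) (η : SpaceTime n β → ℝ) (z : SpaceTime n β) : ℝ :=
  deriv (fun t : ℝ => η (z + proj (t • v))) 0

lemma isTest_iff {η : SpaceTime n β → ℝ} :
    IsTest η ↔ ContDiff ℝ ∞ (η ∘ (proj : Space n × ℝ → SpaceTime n β)) ∧ HasCompactSupport η :=
  Iff.rfl

namespace IsTest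

variable {η θ : SpaceTime n β → ℝ}

lemma contDiff (h : IsTest η) : ContDiff ℝ ∞ (η ∘ (proj : Space n × ℝ → SpaceTime n β)) := h.1

lemma continuous (h : IsTest η) : Continuous η :=
  proj_isOpenQuotientMap.isQuotientMap.continuous_iff.2 h.1.continuous

lemma add (h : IsTest η) (h' : IsTest θ) : IsTest (fun z => η z + θ z) :=
  isTest_iff.2 ⟨h.1.add h'.1, h.2.add h'.2⟩

lemma const_mul (c : ℝ) (h : IsTest η) : IsTest (fun z => c * η z) :=
  isTest_iff.2 ⟨contDiff_const.mul h.1, h.2.mul_left⟩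

lemma mul (h : IsTest η) (h' : IsTest θ) : IsTest (fun z => η z * θ z) :=
  isTest_iff.2 ⟨h.1.mul h'.1, h.2.mul_right⟩

lemma comp_add (h : IsTest η) (a : SpaceTime n β) : IsTest (fun z => η (z + a)) := by
  obtain ⟨a, rfl⟩ := proj_surjective a
  refine isTest_iff.2 ⟨?_, h.2.comp_homeomorph (Homeomorph.addRight _)⟩
  have := h.contDiff.comp (contDiff_id.add (contDiff_const (c := a)))
  convert this using 1
  ext p; simp

lemma comp_sub_left (h : IsTest η) (a : SpaceTime n β) : IsTest (fun z => η (a - z)) := by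
  obtain ⟨a, rfl⟩ := proj_surjective a
  refine isTest_iff.2 ⟨?_, h.2.comp_homeomorph (Homeomorph.subLeft _)⟩
  have := h.contDiff.comp ((contDiff_const (c := a)).sub contDiff_id)
  convert this using 1
  ext p; simp

/-- The lift is smooth, and a derivative at time t is a derivative at time 0 from a translated base
point. -/
lemma hasDerivAt (h : IsTest η) (v : Space n × ℝ) (z : SpaceTime n β) (t : ℝ) :
    HasDerivAt (fun s : ℝ => η (z + proj (s • v))) (dirDeriv v η (z + proj (t • v))) t := by
  have hd : Differentiable ℝ (fun s : ℝ => η (z + proj (s • v))) := by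
    obtain ⟨a, rfl⟩ := proj_surjective z
    have h1 : Differentiable ℝ (η ∘ (proj : Space n × ℝ → SpaceTime n β)) :=
      h.1.differentiable (by simp)
    have h2 : (fun s : ℝ => η (proj a + proj (s • v))) =
        (η ∘ (proj : Space n × ℝ → SpaceTime n β)) ∘ fun s : ℝ => a + s • v := by
      ext s; simp
    rw [h2]
    exact h1.comp (f := fun s : ℝ => a + s • v) (by fun_prop)
  have : dirDeriv v η (z + proj (t • v)) = deriv (fun s : ℝ => η (z + proj (s • v))) t := by
    have h2 := deriv_comp_const_add (f := fun s : ℝ => η (z + proj (s • v))) t 0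
    simp only [add_zero] at h2
    rw [← h2, dirDeriv]
    congr 1
    ext s
    rw [add_smul, map_add, ← add_assoc]
  rw [this]
  exact (hd t).hasDerivAt

lemma dirDeriv_proj (h : IsTest η) (v p : Space n × ℝ) :
    dirDeriv v η (proj p) = fderiv ℝ (η ∘ (proj : Space n × ℝ → SpaceTime n β)) p v := by
  have h1 : DifferentiableAt ℝ (η ∘ (proj : Space n × ℝ → SpaceTime n β)) p :=
    h.1.differentiable (by simp) p
  have h2 : HasFDerivAt (η ∘ (proj : Space n × ℝ → SpaceTime n β))
    (fderiv ℝ (η ∘ (proj : Space n × ℝ → SpaceTime n β)) p) (p + (0:ℝ) • v) := by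
      simpa using h1.hasFDerivAt
  have h3 : HasDerivAt (fun t : ℝ => p + t • v) v 0 := by
    simpa using ((hasDerivAt_id (0:ℝ)).smul_const v).const_add p
  have h4 := h2.comp_hasDerivAt (0:ℝ) h3
  have h5 := h.hasDerivAt v (proj p) 0
  rw [zero_smul, map_zero, add_zero] at h5
  refine h5.unique ?_
  convert h4 using 1
  ext t; simp

/-- Upstairs this is the Fréchet derivative applied to a fixed vector, hence smooth; off the closed
support of η the function is locally zero along the line, so the support does not grow. -/
lemma dirDeriv (h : IsTest η) (v : Space n × ℝ) : IsTest (dirDeriv v η) := by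
  refine isTest_iff.2 ⟨?_, ?_⟩
  · have : (Bounce.dirDeriv v η) ∘ (proj : Space n × ℝ → SpaceTime n β) =
      fun p => fderiv ℝ (η ∘ (proj : Space n × ℝ → SpaceTime n β)) p v := by
      ext p; exact h.dirDeriv_proj v p
    rw [this]
    exact (h.contDiff.fderiv_right (m := ∞) (by simp)).clm_apply contDiff_const
  · refine HasCompactSupport.of_support_subset_isCompact h.2 ?_
    intro z hz
    by_contra hz'
    apply hz
    have h0 : ∀ᶠ y in 𝓝 z, η y = 0 := by
      have := (isClosed_tsupport η).isOpen_compl.mem_nhds hz'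
      filter_upwards [this] with y hy
      exact image_eq_zero_of_notMem_tsupport hy
    have hc : ContinuousAt (fun t : ℝ => z + (proj (t • v) : SpaceTime n β)) 0 := by
      have := (continuous_proj (n := n) (β := β))
      fun_prop
    have h1 : ∀ᶠ t : ℝ in 𝓝 0, η (z + proj (t • v)) = 0 := by
      exact hc.eventually (p := fun y => η y = 0) (by simpa using h0)
    have h2 : (fun t : ℝ => η (z + proj (t • v))) =ᶠ[𝓝 0] fun _ => 0 := h1
    rw [Bounce.dirDeriv, h2.deriv_eq]; simp

lemma exists_bound (h : IsTest η) : ∃ C, 0 ≤ C ∧ ∀ z, |η z| ≤ C := by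
  obtain ⟨C, hC⟩ := h.2.exists_bound_of_continuous h.continuous
  exact ⟨C, (norm_nonneg _).trans (hC 0), hC⟩

end IsTest

/-! ### Rules for directional derivatives, and their link with `gradX` and `dTau` -/

section dirDeriv_rules
variable {η θ : SpaceTime n β → ℝ}

lemma dirDeriv_add (h : IsTest η) (h' : IsTest θ) (v : Space n × ℝ) (z : SpaceTime n β) :
    dirDeriv v (fun z => η z + θ z) z = dirDeriv v η z + dirDeriv v θ z := by
  have h1 := h.hasDerivAt v z 0
  have h2 := h'.hasDerivAt v z 0
  rw [dirDeriv, (h1.fun_add h2).deriv]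
  simp

lemma dirDeriv_mul (h : IsTest η) (h' : IsTest θ) (v : Space n × ℝ) (z : SpaceTime n β) :
    dirDeriv v (fun z => η z * θ z) z = dirDeriv v η z * θ z + η z * dirDeriv v θ z := by
  have h1 := h.hasDerivAt v z 0
  have h2 := h'.hasDerivAt v z 0
  rw [dirDeriv, (h1.fun_mul h2).deriv]
  simp

lemma dirDeriv_const_mul (c : ℝ) (h : IsTest η) (v : Space n × ℝ) (z : SpaceTime n β) :
    dirDeriv v (fun z => c * η z) z = c * dirDeriv v η z := by
  have h1 := h.hasDerivAt v z 0
  rw [dirDeriv, (h1.const_mul c).deriv]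
  simp

lemma dirDeriv_comp_add (η : SpaceTime n β → ℝ) (a : SpaceTime n β) (v : Space n × ℝ)
    (z : SpaceTime n β) : dirDeriv v (fun z => η (z + a)) z = dirDeriv v η (z + a) := by
  simp only [dirDeriv, add_right_comm]

lemma dirDeriv_comb (h : IsTest η) (v w : Space n × ℝ) (z : SpaceTime n β) :
    dirDeriv (v + w) η z = dirDeriv v η z + dirDeriv w η z := by
  obtain ⟨p, rfl⟩ := proj_surjective z
  simp [h.dirDeriv_proj]

lemma dirDeriv_smul (h : IsTest η) (c : ℝ) (v : Space n × ℝ) (z : SpaceTime n β) :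
    dirDeriv (c • v) η z = c * dirDeriv v η z := by
  obtain ⟨p, rfl⟩ := proj_surjective z
  simp [h.dirDeriv_proj]

lemma dTau_eq (η : SpaceTime n β → ℝ) (z : SpaceTime n β) : dTau η z = dirDeriv (0, 1) η z := by
  simp only [dTau, dirDeriv]
  congr 1
  ext t
  congr 1
  ext1 <;> simp

lemma inner_gradX (h : IsTest η) (z : SpaceTime n β) (e : Space n) :
    inner ℝ (gradX η z) e = dirDeriv (e, 0) η z := by
  obtain ⟨p, rfl⟩ := proj_surjective z
  have h1 : DifferentiableAt ℝ (η ∘ (proj : Space n × ℝ → SpaceTime n β)) p :=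
    h.1.differentiable (by simp) p
  have h2 := h1.hasFDerivAt.comp p.1 (f := fun x : Space n => (x, p.2))
    ((hasFDerivAt_id p.1).prodMk (hasFDerivAt_const p.2 p.1))
  have h3 : HasFDerivAt (fun x : Space n => η (x, (proj p : SpaceTime n β).2)) _ p.1 := h2
  rw [gradX, gradient, InnerProductSpace.toDual_symm_apply, h.dirDeriv_proj]
  erw [h3.fderiv]
  simp

/-- Lets a single scalar notion of derivative carry the whole weak theory; the two classical
derivatives are recovered as the directions (e, 0) and (0, 1). -/
lemma dirDeriv_eq (h : IsTest η) (z : SpaceTime n β) (v : Space n × ℝ) :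
    dirDeriv v η z = inner ℝ (gradX η z) v.1 + dTau η z * v.2 := by
  have : v = (v.1, 0) + v.2 • ((0 : Space n), (1:ℝ)) := by ext <;> simp
  rw [this, dirDeriv_comb h, dirDeriv_smul h, ← inner_gradX h, ← dTau_eq]
  simp [mul_comm]

lemma gradX_apply (h : IsTest η) (z : SpaceTime n β) (i : Fin n) :
    gradX η z i = dirDeriv (EuclideanSpace.single i 1, 0) η z := by
  rw [← inner_gradX h, EuclideanSpace.inner_single_right]; simp

lemma IsTest.continuous_gradX (h : IsTest η) : Continuous (gradX η) := by
  have : Continuous (fun z i => gradX η z i) := by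
    refine continuous_pi fun i => ?_
    simp only [gradX_apply h]
    exact (h.dirDeriv _).continuous
  exact (PiLp.continuous_toLp 2 (fun _ : Fin n => ℝ)).comp this

lemma IsTest.dTau (h : IsTest η) : IsTest (dTau η) := by
  have := h.dirDeriv (0, 1)
  rwa [show Bounce.dirDeriv (0, 1) η = Bounce.dTau η from funext fun z => (dTau_eq η z).symm] at this

lemma IsTest.hasCompactSupport_gradX (h : IsTest η) : HasCompactSupport (gradX η) := by
  have : ∀ i, HasCompactSupport (fun z => gradX η z i) := fun i => by
    simp only [gradX_apply h]; exact (h.dirDeriv _).2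
  refine HasCompactSupport.of_support_subset_isCompact
    (isCompact_iUnion fun i => this i) (fun z hz => ?_)
  have : ∃ i, gradX η z i ≠ 0 := by
    by_contra! hc
    exact hz (by ext i; simpa using hc i)
  obtain ⟨i, hi⟩ := this
  exact mem_iUnion.2 ⟨i, subset_tsupport _ hi⟩

end dirDeriv_rules

lemma isTest_of_space {a : Space n → ℝ} [Fact (0 < β)] (ha : ContDiff ℝ ∞ a)
    (hc : HasCompactSupport a) : IsTest (fun z : SpaceTime n β => a z.1) := by
  refine ⟨ha.comp contDiff_fst, ?_⟩
  refine HasCompactSupport.of_support_subset_isCompact (hc.prod isCompact_univ) ?_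
  intro z hz
  exact ⟨subset_tsupport _ hz, trivial⟩

/-! ### Haar measure and integrability of test functions -/

section measure
variable [Fact (0 < β)]

instance : (volume : Measure (SpaceTime n β)).IsAddHaarMeasure :=
  inferInstanceAs ((volume : Measure (Space n)).prod (volume : Measure (AddCircle β))).IsAddHaarMeasure

instance : (volume : Measure (Space n × ℝ)).IsAddHaarMeasure :=
  inferInstanceAs ((volume : Measure (Space n)).prod (volume : Measure ℝ)).IsAddHaarMeasure

instance : (volume : Measure (SpaceTime n β)).IsNegInvariant :=
  Measure.IsAddHaarMeasure.isNegInvariant_of_regular _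

lemma IsTest.integrable {η : SpaceTime n β → ℝ} (h : IsTest η) : Integrable η :=
  h.continuous.integrable_of_hasCompactSupport h.2

lemma IsTest.memLp {η : SpaceTime n β → ℝ} (h : IsTest η) (p : ℝ≥0∞) : MemLp η p :=
  h.continuous.memLp_of_hasCompactSupport h.2

lemma IsTest.integrable_mul {η f : SpaceTime n β → ℝ} (h : IsTest η) (hf : LocallyIntegrable f) :
    Integrable (fun z => f z * η z) := by
  have := hf.integrable_smul_right_of_hasCompactSupport h.continuous h.2
  simpa [smul_eq_mul] using this

end measure

variable [Fact (0 < β)]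

/-! ### Mollifiers and cutoffs -/

section mollifier

/-- A function on the circle which is smooth on the line, nonnegative, positive at `0` and supported
near `0`. -/
lemma exists_circle_bump {ε : ℝ} (hε : 0 < ε) : ∃ c : AddCircle β → ℝ,
    ContDiff ℝ ∞ (fun t : ℝ => c (t : AddCircle β)) ∧ (∀ τ, 0 ≤ c τ) ∧ c 0 ≠ 0 ∧
      ∀ τ, c τ ≠ 0 → ‖τ‖ < ε := by
  have hβ : 0 < β := Fact.out
  -- The real part of the basic character is cos(2πt/β): smooth upstairs, with maximum 1 attained
  -- only at 0.
  let f : AddCircle β → ℝ := fun τ => (AddCircle.toCircle τ : ℂ).re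
  have hf : Continuous f :=
    Complex.continuous_re.comp (continuous_subtype_val.comp AddCircle.continuous_toCircle)
  have hfs : ∀ t : ℝ, f (t : AddCircle β) = Real.cos (2 * Real.pi / β * t) := by
    intro t
    simp only [f, AddCircle.toCircle_apply_mk, Circle.coe_exp]
    exact Complex.exp_ofReal_mul_I_re _
  have hf1 : ∀ τ, f τ ≤ 1 := by
    intro τ
    induction τ using QuotientAddGroup.induction_on with
    | H t => rw [hfs]; exact Real.cos_le_one _
  have hf0 : ∀ τ, f τ = 1 → τ = 0 := by
    intro τ hτ
    apply AddCircle.injective_toCircle hβ.ne'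
    rw [AddCircle.toCircle_zero]
    have h1 : ‖(AddCircle.toCircle τ : ℂ)‖ = 1 := Circle.norm_coe _
    have h2 : (AddCircle.toCircle τ : ℂ).re = 1 := hτ
    have h3 : (AddCircle.toCircle τ : ℂ).im = 0 := by
      have := Complex.sq_norm (AddCircle.toCircle τ : ℂ)
      rw [h1, Complex.normSq_apply, h2] at this
      nlinarith
    ext
    apply Complex.ext <;> simp [h2, h3]
  obtain ⟨m, hm1, hm⟩ : ∃ m < 1, ∀ τ, ε ≤ ‖τ‖ → f τ ≤ m := by
    have hK : IsCompact {τ : AddCircle β | ε ≤ ‖τ‖} :=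
      (isClosed_le continuous_const continuous_norm).isCompact
    rcases Set.eq_empty_or_nonempty {τ : AddCircle β | ε ≤ ‖τ‖} with h | h
    · refine ⟨0, one_pos, fun τ hτ => ?_⟩
      have : τ ∈ {τ : AddCircle β | ε ≤ ‖τ‖} := hτ
      rw [h] at this; exact this.elim
    · obtain ⟨τ, hτ, hmax⟩ := hK.exists_isMaxOn h hf.continuousOn
      refine ⟨f τ, lt_of_le_of_ne (hf1 τ) fun h1 => ?_, fun σ hσ => hmax hσ⟩
      have : τ = 0 := hf0 τ h1
      rw [this] at hτ
      simp only [mem_ofPred_eq, norm_zero] at hτ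
      linarith
  -- Away from 0 the cosine stays below some m < 1 by compactness, so cutting smoothly at height m
  -- localises near 0.
  refine ⟨fun τ => Real.smoothTransition (f τ - m), ?_, fun τ => Real.smoothTransition.nonneg _,
    ?_, ?_⟩
  · simp only [hfs]
    exact Real.smoothTransition.contDiff.comp (by fun_prop)
  · have : f 0 = 1 := by
      have := hfs 0
      simpa using this
    exact (Real.smoothTransition.pos_of_pos (by rw [this]; linarith)).ne'
  · intro τ hτ
    by_contra h
    exact hτ (Real.smoothTransition.zero_of_nonpos (by linarith [hm τ (not_lt.1 h)]))

lemma exists_mollifier {ε : ℝ} (hε : 0 < ε) : ∃ ρ : SpaceTime n β → ℝ, IsTest ρ ∧ (∀ z, 0 ≤ ρ z) ∧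
    ∫ z, ρ z = 1 ∧ ∀ z, ρ z ≠ 0 → ‖z‖ < ε := by
  obtain ⟨c, hc, hc0, hc1, hcs⟩ := exists_circle_bump (β := β) hε
  let a : ContDiffBump (0 : Space n) := ⟨ε / 2, ε, by linarith, by linarith⟩
  let ρ : SpaceTime n β → ℝ := fun z => a z.1 * c z.2
  have hρ : IsTest ρ := by
    refine ⟨(a.contDiff.comp contDiff_fst).mul (hc.comp contDiff_snd), ?_⟩
    refine HasCompactSupport.of_support_subset_isCompact (a.hasCompactSupport.prod isCompact_univ) ?_
    intro z hz
    exact ⟨subset_tsupport _ (left_ne_zero_of_mul hz), trivial⟩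
  have hρ0 : ∀ z, 0 ≤ ρ z := fun z => mul_nonneg a.nonneg (hc0 _)
  have hpos : 0 < ∫ z, ρ z := by
    refine hρ.continuous.integral_pos_of_hasCompactSupport_nonneg_nonzero hρ.2 hρ0 (x := 0) ?_
    refine mul_ne_zero ?_ hc1
    have := a.pos_of_mem_ball (x := 0) (by simp [a, hε])
    exact this.ne'
  refine ⟨fun z => (∫ z, ρ z)⁻¹ * ρ z, hρ.const_mul _, fun z => mul_nonneg (by positivity) (hρ0 z),
    ?_, ?_⟩
  · rw [integral_const_mul, inv_mul_cancel₀ hpos.ne']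
  · intro z hz
    have hz := right_ne_zero_of_mul hz
    have h1 : a z.1 ≠ 0 := left_ne_zero_of_mul hz
    have h2 : z.1 ∈ Metric.ball (0 : Space n) ε := by rw [← a.support_eq]; exact h1
    rw [Prod.norm_def]
    exact max_lt (by simpa using h2) (hcs _ (right_ne_zero_of_mul hz))

/-- A test function depending on space only, equal to one on a large ball. -/
lemma exists_cutoff {K : Set (SpaceTime n β)} (hK : IsCompact K) : ∃ χ : SpaceTime n β → ℝ,
    IsTest χ ∧ (∀ z, 0 ≤ χ z) ∧ (∀ z, χ z ≤ 1) ∧ ∀ z ∈ K, χ z = 1 := by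
  obtain ⟨R, hR⟩ := hK.isBounded.exists_norm_le
  let a : ContDiffBump (0 : Space n) := ⟨|R| + 1, |R| + 2, by positivity, by linarith⟩
  refine ⟨fun z => a z.1, isTest_of_space a.contDiff a.hasCompactSupport, fun z => a.nonneg,
    fun z => a.le_one, fun z hz => a.one_of_mem_closedBall ?_⟩
  have h1 : ‖z.1‖ ≤ ‖z‖ := norm_fst_le z
  have h2 := hR z hz
  simp only [Metric.mem_closedBall, dist_zero_right, a]
  linarith [le_abs_self R]

end mollifier

/-! ### Convolution on the cylinder -/

section convolution

/-- Convolution on `ℝⁿ × S¹`. -/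
noncomputable def conv (ρ f : SpaceTime n β → ℝ) (z : SpaceTime n β) : ℝ := ∫ w, f w * ρ (z - w)

lemma measurePreserving_proj :
    MeasurePreserving (proj : Space n × ℝ → SpaceTime n β)
      ((volume : Measure (Space n)).prod ((volume : Measure ℝ).restrict (Ioc 0 (0 + β)))) volume := by
  have := AddCircle.measurePreserving_mk β 0
  exact (MeasurePreserving.id volume).prod this

/-- Upstairs this becomes a convolution against the measure that lives on a single period in τ. The
lifted kernel is periodic and so not compactly supported, but near a given point only a bounded
range of τ is seen, so it may be cut off there. -/
lemma contDiff_conv {ρ f : SpaceTime n β → ℝ} (hρ : IsTest ρ) (hf : LocallyIntegrable f) :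
    ContDiff ℝ ∞ (conv ρ f ∘ (proj : Space n × ℝ → SpaceTime n β)) := by
  set μ : Measure (Space n × ℝ) :=
    (volume : Measure (Space n)).prod ((volume : Measure ℝ).restrict (Ioc 0 (0 + β))) with hμ
  have hmp : MeasurePreserving (proj : Space n × ℝ → SpaceTime n β) μ volume :=
    measurePreserving_proj
  have hfm : LocallyIntegrable (f ∘ (proj : Space n × ℝ → SpaceTime n β)) μ := by
    intro p
    let K : Set (SpaceTime n β) := Metric.closedBall p.1 1 ×ˢ univ
    have hK : IsCompact K := (isCompact_closedBall _ _).prod isCompact_univ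
    have h1 : Integrable (K.indicator f) := by
      rw [integrable_indicator_iff hK.measurableSet]; exact hf.integrableOn_isCompact hK
    have h2 := (hmp.integrable_comp h1.aestronglyMeasurable).2 h1
    have h3 : K.indicator f ∘ (proj : Space n × ℝ → SpaceTime n β) =
        (proj ⁻¹' K).indicator (f ∘ proj) := by
      ext q; rfl
    rw [h3, integrable_indicator_iff (continuous_proj.measurable hK.measurableSet)] at h2
    refine ⟨_, ?_, h2⟩
    have : (proj ⁻¹' K : Set (Space n × ℝ)) = Metric.closedBall p.1 1 ×ˢ univ := by
      ext q; simp [K]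
    rw [this]
    exact prod_mem_nhds (Metric.closedBall_mem_nhds _ one_pos) univ_mem
  have key : ∀ p, conv ρ f (proj p) = ∫ q, f (proj q) * ρ (proj (p - q)) ∂μ := by
    intro p
    have h1 : Integrable (fun w => f w * ρ (proj p - w)) :=
      (hρ.comp_sub_left (proj p)).integrable_mul hf
    rw [conv, ← hmp.map_eq, integral_map hmp.measurable.aemeasurable
      (by rw [hmp.map_eq]; exact h1.aestronglyMeasurable)]
    simp only [map_sub]
  rw [contDiff_iff_contDiffAt]
  intro p₀
  -- For p within 1 of p₀ and q in one period, p - q stays within β + 1 of p₀ in the τ-coordinate,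
  -- where this cutoff equals 1.
  let χ : ContDiffBump (p₀.2 : ℝ) := ⟨β + 2, β + 3, by have : 0 < β := Fact.out; linarith, by linarith⟩
  let r : Space n × ℝ → ℝ := fun q => χ q.2 * ρ (proj q)
  have hr : ContDiff ℝ ∞ r := (χ.contDiff.comp contDiff_snd).mul hρ.contDiff
  have hrc : HasCompactSupport r := by
    have h0 : IsCompact ((Prod.fst '' tsupport ρ) ×ˢ tsupport χ) :=
      (IsCompact.image hρ.2 continuous_fst).prod χ.hasCompactSupport
    refine HasCompactSupport.of_support_subset_isCompact h0 fun q hq => ?_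
    exact ⟨⟨proj q, subset_tsupport _ (right_ne_zero_of_mul hq), rfl⟩,
      subset_tsupport _ (left_ne_zero_of_mul hq)⟩
  have h1 := (hrc.contDiff_convolution_right (ContinuousLinearMap.lsmul ℝ ℝ) hfm
    (n := ⊤) hr).contDiffAt (x := p₀)
  refine h1.congr_of_eventuallyEq ?_
  filter_upwards [Metric.ball_mem_nhds p₀ one_pos] with p hp
  rw [Function.comp_apply, key, convolution_lsmul]
  refine integral_congr_ae ?_
  have h2 : ∀ᵐ q ∂μ, q.2 ∈ Ioc 0 (0 + β) := by
    have : MeasurePreserving Prod.snd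
      (volume.restrict (univ ×ˢ Ioc 0 (0 + β)) : Measure (Space n × ℝ))
      (volume.restrict (univ ×ˢ Ioc 0 (0 + β))|>.map Prod.snd) := ⟨measurable_snd, rfl⟩
    have hμ' : μ = (volume : Measure (Space n × ℝ)).restrict (univ ×ˢ Ioc 0 (0 + β)) := by
      rw [hμ, Measure.volume_eq_prod, ← Measure.prod_restrict, Measure.restrict_univ]
    rw [hμ']
    filter_upwards [ae_restrict_mem (MeasurableSet.univ.prod measurableSet_Ioc)] with q hq
    exact hq.2
  filter_upwards [h2] with q hq
  have h3 : χ (p - q).2 = 1 := by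
    apply χ.one_of_mem_closedBall
    have h4 : |p.2 - p₀.2| < 1 := by
      have := (norm_snd_le (p - p₀)).trans_lt (by simpa [dist_eq_norm] using hp)
      simpa using this
    rw [abs_lt] at h4
    simp only [Metric.mem_closedBall, Real.dist_eq, Prod.snd_sub, χ]
    rw [abs_le]
    obtain ⟨h5, h6⟩ := hq
    constructor <;> linarith
  simp only [Prod.snd_sub] at h3
  simp [r, h3]

lemma isTest_conv {ρ f : SpaceTime n β → ℝ} (hρ : IsTest ρ) (hf : LocallyIntegrable f)
    (hc : HasCompactSupport f) : IsTest (conv ρ f) := by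
  refine ⟨contDiff_conv hρ hf, ?_⟩
  refine HasCompactSupport.of_support_subset_isCompact (IsCompact.add hc hρ.2) fun z hz => ?_
  by_contra hz'
  apply hz
  rw [conv]
  refine integral_eq_zero_of_ae (ae_of_all _ fun w => ?_)
  by_contra hw
  refine hz' ⟨w, subset_tsupport _ (left_ne_zero_of_mul hw), z - w,
    subset_tsupport _ (right_ne_zero_of_mul hw), by simp⟩

/-- All difference is placed on the smooth factor. For times within 1 of t the derivatives are
supported in one compact set K, on which f is integrable, so differentiation under the integral is
dominated. -/
lemma hasDerivAt_integral_translate {η f : SpaceTime n β → ℝ} (hη : IsTest η)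
    (hf : LocallyIntegrable f) (v : Space n × ℝ) (t : ℝ) :
    HasDerivAt (fun s : ℝ => ∫ z, f z * η (z + proj (s • v)))
      (∫ z, f z * dirDeriv v η (z + proj (t • v))) t := by
  obtain ⟨M, hM0, hM⟩ := (hη.dirDeriv v).exists_bound
  have hcont : Continuous fun q : SpaceTime n β × ℝ => q.1 - proj (q.2 • v) := by
    have := continuous_proj (n := n) (β := β)
    fun_prop
  let K : Set (SpaceTime n β) :=
    (fun q : SpaceTime n β × ℝ => q.1 - proj (q.2 • v)) ''
      ((tsupport (dirDeriv v η)) ×ˢ Metric.closedBall t 1)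
  have hK : IsCompact K := (((hη.dirDeriv v).2 : IsCompact _).prod
    (isCompact_closedBall t 1)).image hcont
  have hbi : Integrable (K.indicator fun z => ‖f z‖ * M) := by
    rw [integrable_indicator_iff hK.measurableSet]
    exact (hf.integrableOn_isCompact hK).norm.mul_const M
  refine (hasDerivAt_integral_of_dominated_loc_of_deriv_le (𝕜 := ℝ)
    (F := fun s z => f z * η (z + proj (s • v)))
    (F' := fun s z => f z * dirDeriv v η (z + proj (s • v)))
    (bound := K.indicator fun z => ‖f z‖ * M)
    (Metric.closedBall_mem_nhds t one_pos) ?_ ?_ ?_ ?_ hbi ?_).2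
  · exact Eventually.of_forall fun s => ((hη.comp_add _).integrable_mul hf).aestronglyMeasurable
  · exact (hη.comp_add _).integrable_mul hf
  · exact (((hη.dirDeriv v).comp_add _).integrable_mul hf).aestronglyMeasurable
  · refine ae_of_all _ fun z s hs => ?_
    by_cases hz : z ∈ K
    · rw [indicator_of_mem hz, norm_mul]
      exact mul_le_mul_of_nonneg_left (hM _) (norm_nonneg _)
    · rw [indicator_of_notMem hz, norm_le_zero_iff]
      rw [image_eq_zero_of_notMem_tsupport (f := dirDeriv v η) (fun h => hz ?_), mul_zero]
      exact ⟨(_, s), ⟨h, hs⟩, by simp⟩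
  · exact ae_of_all _ fun z s _ => (hη.hasDerivAt v z s).const_mul _

lemma dirDeriv_conv {ρ f : SpaceTime n β → ℝ} (hρ : IsTest ρ) (hf : LocallyIntegrable f)
    (v : Space n × ℝ) (z : SpaceTime n β) :
    dirDeriv v (conv ρ f) z = - ∫ w, f w * dirDeriv v (fun y => ρ (z - y)) w := by
  have h1 := hasDerivAt_integral_translate (hρ.comp_sub_left z) hf (-v) 0
  have h2 : (fun s : ℝ => conv ρ f (z + proj (s • v))) =
      fun s : ℝ => ∫ w, f w * ρ (z - (w + proj (s • -v))) := by
    ext s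
    refine integral_congr_ae (ae_of_all _ fun w => ?_)
    simp only [smul_neg, map_neg]
    congr 2; abel
  rw [dirDeriv, h2, h1.deriv, ← integral_neg]
  refine integral_congr_ae (ae_of_all _ fun w => ?_)
  simp only [zero_smul, map_zero, add_zero]
  rw [← neg_one_smul ℝ v, dirDeriv_smul (hρ.comp_sub_left z)]
  ring

end convolution

/-! ### Weak directional derivatives and the fundamental lemma -/

section weak

/-- `g` is a weak derivative of `f` in the direction `v`. -/
def IsWeakDir (v : Space n × ℝ) (f g : SpaceTime n β → ℝ) : Prop :=
  ∀ η, IsTest η → ∫ z, f z * dirDeriv v η z = - ∫ z, η z * g z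

/-- The function y ↦ ρ(z - y) is itself a test function, so the weak identity applies to it; the
reflection in y cancels the sign. -/
lemma dirDeriv_conv_of_isWeakDir {ρ f g : SpaceTime n β → ℝ} (hρ : IsTest ρ)
    (hf : LocallyIntegrable f) {v : Space n × ℝ} (hfg : IsWeakDir v f g) (z : SpaceTime n β) :
    dirDeriv v (conv ρ f) z = conv ρ g z := by
  rw [dirDeriv_conv hρ hf, hfg _ (hρ.comp_sub_left z), neg_neg, conv]
  simp only [mul_comm]

/-- The fundamental lemma of the calculus of variations on `ℝⁿ × S¹`. -/
lemma ae_eq_zero_of_forall_test {f : SpaceTime n β → ℝ} (hf : LocallyIntegrable f)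
    (h : ∀ η, IsTest η → ∫ z, f z * η z = 0) : f =ᵐ[volume] 0 := by
  refine ae_eq_zero_of_forall_setIntegral_isCompact_eq_zero' hf fun K hK => ?_
  have hcl := hK.isClosed
  choose ρ hρt hρ0 hρ1 hρs using fun j : ℕ =>
    exists_mollifier (n := n) (β := β) (ε := 1 / ((j : ℝ) + 1)) (by positivity)
  -- The indicator of a 1/(j+1)-thickening, mollified at the same scale, equals 1 on K and vanishes
  -- outside the 2/(j+1)-thickening. These test functions decrease the problem to dominated
  -- convergence towards the indicator of the closed set K.
  let U : ℕ → Set (SpaceTime n β) := fun j => Metric.cthickening (1 / ((j : ℝ) + 1)) K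
  have hUc : ∀ j, IsCompact (U j) := fun j => hK.cthickening
  let I : ℕ → SpaceTime n β → ℝ := fun j => (U j).indicator fun _ => 1
  have hI : ∀ j, Integrable (I j) := fun j => by
    rw [integrable_indicator_iff (hUc j).measurableSet]
    exact integrableOn_const (hUc j).measure_lt_top.ne
  have hIc : ∀ j, HasCompactSupport (I j) := fun j =>
    HasCompactSupport.of_support_subset_isCompact (hUc j) support_indicator_subset
  let e : ℕ → SpaceTime n β → ℝ := fun j => conv (ρ j) (I j)
  have he : ∀ j, IsTest (e j) := fun j => isTest_conv (hρt j) (hI j).locallyIntegrable (hIc j)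
  have hρI : ∀ j z, ∫ w, ρ j (z - w) = 1 := fun j z => by
    rw [integral_sub_left_eq_self (ρ j) volume z, hρ1]
  have he1 : ∀ j, ∀ z ∈ K, e j z = 1 := by
    intro j z hz
    rw [← hρI j z]
    refine integral_congr_ae (ae_of_all _ fun w => ?_)
    by_cases hw : ρ j (z - w) = 0
    · simp [hw]
    · have : w ∈ U j := by
        refine Metric.mem_cthickening_of_dist_le w z _ K hz ?_
        rw [dist_comm, dist_eq_norm]; exact (hρs j _ hw).le
      simp [I, this]
  have he2 : ∀ (j : ℕ) z, z ∉ Metric.cthickening (2 / ((j : ℝ) + 1)) K → e j z = 0 := by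
    intro j z hz
    refine integral_eq_zero_of_ae (ae_of_all _ fun w => ?_)
    by_contra hw
    have h1 := hρs j _ (right_ne_zero_of_mul hw)
    have h2 : w ∈ U j := by
      by_contra h; exact left_ne_zero_of_mul hw (by simp [I, h])
    apply hz
    simp only [U, hK.cthickening_eq_biUnion_closedBall (δ := 1 / ((j : ℝ) + 1)) (by positivity),
      mem_iUnion, exists_prop, Metric.mem_closedBall] at h2
    obtain ⟨y, hy, h3⟩ := h2
    refine Metric.mem_cthickening_of_dist_le z y _ K hy ?_
    calc dist z y ≤ dist z w + dist w y := dist_triangle _ _ _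
      _ ≤ 1 / ((j : ℝ) + 1) + 1 / ((j : ℝ) + 1) := by
        rw [dist_eq_norm z w]; exact add_le_add h1.le h3
      _ = _ := by ring
  have he3 : ∀ j z, |e j z| ≤ 1 := by
    intro j z
    have h0 : 0 ≤ e j z := integral_nonneg fun w =>
      mul_nonneg (indicator_nonneg (fun _ _ => zero_le_one) _) (hρ0 j _)
    rw [abs_of_nonneg h0, ← hρI j z]
    refine integral_mono_of_nonneg (ae_of_all _ fun w =>
      mul_nonneg (indicator_nonneg (fun _ _ => zero_le_one) _) (hρ0 j _))
      ((hρt j).comp_sub_left z).integrable (ae_of_all _ fun w => ?_)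
    have : I j w ≤ 1 := indicator_le_self' (fun _ _ => zero_le_one) w
    simpa using mul_le_mul_of_nonneg_right this (hρ0 j (z - w))
  have hlim : Tendsto (fun j => ∫ z, f z * e j z) atTop (𝓝 (∫ z in K, f z)) := by
    rw [← integral_indicator hK.measurableSet]
    let K2 := Metric.cthickening 2 K
    have hK2 : IsCompact K2 := hK.cthickening
    refine tendsto_integral_of_dominated_convergence (K2.indicator fun z => ‖f z‖)
      (fun j => ((he j).integrable_mul hf).aestronglyMeasurable) ?_ ?_ ?_
    · rw [integrable_indicator_iff hK2.measurableSet]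
      exact (hf.integrableOn_isCompact hK2).norm
    · intro j
      refine ae_of_all _ fun z => ?_
      by_cases hz : z ∈ K2
      · rw [indicator_of_mem hz, norm_mul]
        exact mul_le_of_le_one_right (norm_nonneg _) (he3 j z)
      · rw [he2 j z fun h => hz (Metric.cthickening_mono ?_ K h)]
        · simp [hz]
        · rw [div_le_iff₀ (by positivity)]
          have : (0:ℝ) ≤ j := by positivity
          linarith
    · refine ae_of_all _ fun z => ?_
      by_cases hz : z ∈ K
      · simp [he1 _ z hz, hz]
      · rw [indicator_of_notMem hz]
        have h1 : ∃ δ > 0, z ∉ Metric.cthickening δ K := by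
          by_contra! hcon
          apply hz
          rw [← hcl.closure_eq, Metric.closure_eq_iInter_cthickening]
          simpa using hcon
        obtain ⟨δ, hδ, hzδ⟩ := h1
        refine tendsto_const_nhds.congr' ?_
        have h2 : Tendsto (fun j : ℕ => 2 * (1 / ((j : ℝ) + 1))) atTop (𝓝 (2 * 0)) :=
          tendsto_one_div_add_atTop_nhds_zero_nat.const_mul 2
        rw [mul_zero] at h2
        filter_upwards [h2.eventually_lt_const hδ] with j hj
        rw [he2 j z fun h => hzδ (Metric.cthickening_mono ?_ K h), mul_zero]
        rw [div_eq_mul_one_div]; exact hj.le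
  simp only [h _ (he _)] at hlim
  exact (tendsto_nhds_unique hlim tendsto_const_nhds)

end weak

/-- The `L²` norm as a real number. -/
noncomputable def l2 (f : SpaceTime n β → ℝ) : ℝ := (eLpNorm f 2 volume).toReal

/-! ### The L² norm, duality with test functions, continuity of translations -/

section l2
variable {f g : SpaceTime n β → ℝ}

lemma l2_nonneg (f : SpaceTime n β → ℝ) : 0 ≤ l2 f := ENNReal.toReal_nonneg

lemma l2_eq_norm_toLp (hf : MemLp f 2) : l2 f = ‖hf.toLp f‖ := by
  rw [l2, Lp.norm_toLp]

lemma l2_congr (h : f =ᵐ[volume] g) : l2 f = l2 g := by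
  rw [l2, l2, eLpNorm_congr_ae h]

lemma l2_add_le (hf : MemLp f 2) (hg : MemLp g 2) : l2 (fun z => f z + g z) ≤ l2 f + l2 g := by
  rw [l2_eq_norm_toLp hf, l2_eq_norm_toLp hg]
  change l2 (f + g) ≤ _
  rw [l2_eq_norm_toLp (hf.add hg), MemLp.toLp_add]
  exact norm_add_le _ _

lemma l2_const_mul (c : ℝ) (f : SpaceTime n β → ℝ) : l2 (fun z => c * f z) = |c| * l2 f := by
  rw [l2, l2, show (fun z => c * f z) = c • f from rfl, eLpNorm_const_smul]
  simp

lemma inner_toLp (hf : MemLp f 2) (hg : MemLp g 2) :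
    inner ℝ (hf.toLp f) (hg.toLp g) = ∫ z, f z * g z := by
  rw [L2.inner_def]
  refine integral_congr_ae ?_
  filter_upwards [hf.coeFn_toLp, hg.coeFn_toLp] with z h1 h2
  rw [h1, h2]; simp [mul_comm]

lemma abs_integral_mul_le (hf : MemLp f 2) (hg : MemLp g 2) :
    |∫ z, f z * g z| ≤ l2 f * l2 g := by
  rw [← inner_toLp hf hg, l2_eq_norm_toLp hf, l2_eq_norm_toLp hg]
  exact abs_real_inner_le_norm _ _

lemma l2_sq (hf : MemLp f 2) : l2 f ^ 2 = ∫ z, f z ^ 2 := by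
  rw [l2_eq_norm_toLp hf, ← real_inner_self_eq_norm_sq, inner_toLp]
  simp only [sq]

lemma memLp_comp_add {F : Type*} [NormedAddCommGroup F] {f : SpaceTime n β → F} {p : ℝ≥0∞}
    (hf : MemLp f p) (a : SpaceTime n β) : MemLp (fun z => f (z + a)) p :=
  hf.comp_measurePreserving (measurePreserving_add_right volume a)

/-- By the fundamental lemma nothing in L² is orthogonal to all test functions, so they are dense.
The bound is a closed condition on the second factor, hence holds for f paired with itself. -/
lemma l2_le_of_forall_test (hf : MemLp f 2) {C : ℝ}
    (h : ∀ η, IsTest η → |∫ z, f z * η z| ≤ C * l2 η) : l2 f ≤ C := by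
  -- A negative C would force a mollifier to have zero norm, against its integral being 1.
  have hC : 0 ≤ C := by
    obtain ⟨ρ, hρ, -, hρ1, -⟩ := exists_mollifier (n := n) (β := β) one_pos
    by_contra hC
    push Not at hC
    have h1 := (abs_nonneg _).trans (h ρ hρ)
    have h2 : l2 ρ = 0 := by
      have := l2_nonneg ρ
      nlinarith
    have h3 : ρ =ᵐ[volume] 0 := by
      rw [l2, ENNReal.toReal_eq_zero_iff, or_iff_left (hρ.memLp 2).2.ne,
        eLpNorm_eq_zero_iff (hρ.memLp 2).1 (by norm_num)] at h2
      exact h2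
    rw [integral_congr_ae h3] at hρ1
    simp at hρ1
  let K : Submodule ℝ (Lp ℝ 2 (volume : Measure (SpaceTime n β))) :=
    { carrier := {x | ∃ η, ∃ hη : IsTest η, x = (hη.memLp 2).toLp η}
      add_mem' := by
        rintro _ _ ⟨η, hη, rfl⟩ ⟨θ, hθ, rfl⟩
        exact ⟨_, hη.add hθ, (MemLp.toLp_add _ _).symm⟩
      zero_mem' := by
        refine ⟨fun _ => 0, ⟨contDiff_const, HasCompactSupport.zero⟩, ?_⟩
        exact (MemLp.toLp_zero _).symm
      smul_mem' := by
        rintro c _ ⟨η, hη, rfl⟩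
        exact ⟨_, hη.const_mul c, (MemLp.toLp_const_smul c _).symm⟩ }
  have hK : Kᗮ = ⊥ := by
    rw [Submodule.eq_bot_iff]
    intro x hx
    have hxm := Lp.memLp x
    have : (x : SpaceTime n β → ℝ) =ᵐ[volume] 0 := by
      refine ae_eq_zero_of_forall_test (hxm.locallyIntegrable (by norm_num)) fun η hη => ?_
      have h1 := (Submodule.mem_orthogonal K x).1 hx _ ⟨η, hη, rfl⟩
      rw [← Lp.toLp_coeFn x hxm, inner_toLp] at h1
      simpa [mul_comm] using h1
    exact Lp.eq_zero_iff_ae_eq_zero.2 this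
  rw [← Submodule.topologicalClosure_eq_top_iff] at hK
  have hcl : IsClosed {k : Lp ℝ 2 (volume : Measure (SpaceTime n β)) |
      |inner ℝ (hf.toLp f) k| ≤ C * ‖k‖} :=
    isClosed_le (by fun_prop) (by fun_prop)
  have hsub : (K : Set (Lp ℝ 2 (volume : Measure (SpaceTime n β)))) ⊆
      {k | |inner ℝ (hf.toLp f) k| ≤ C * ‖k‖} := by
    rintro _ ⟨η, hη, rfl⟩
    rw [mem_ofPred_eq, inner_toLp, ← l2_eq_norm_toLp]
    exact h η hη
  have h1 : hf.toLp f ∈ K.topologicalClosure := hK ▸ Submodule.mem_top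
  have h2 : |inner ℝ (hf.toLp f) (hf.toLp f)| ≤ C * ‖hf.toLp f‖ :=
    closure_minimal hsub hcl h1
  rw [real_inner_self_eq_norm_sq, ← l2_eq_norm_toLp, abs_of_nonneg (sq_nonneg _)] at h2
  rcases (l2_nonneg f).eq_or_lt with h0 | h0
  · rwa [← h0]
  · nlinarith

lemma tendsto_l2_translate (hf : MemLp f 2) :
    Tendsto (fun a => l2 (fun z => f (z + a) - f z)) (𝓝 0) (𝓝 0) := by
  let g : SpaceTime n β → C(SpaceTime n β, SpaceTime n β) := fun a => ⟨fun z => z + a, by fun_prop⟩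
  have hg : Continuous g := ContinuousMap.continuous_of_continuous_uncurry _
    (continuous_snd.add continuous_fst)
  have h1 := Continuous.compMeasurePreservingLp (f := fun _ => hf.toLp f) continuous_const hg
    (fun a => measurePreserving_add_right volume a) (by norm_num : (2 : ℝ≥0∞) ≠ ⊤)
  have h2 := ((h1.sub (continuous_const (y := hf.toLp f))).norm).tendsto 0
  have h3 : ∀ a, ‖Lp.compMeasurePreserving (g a) (measurePreserving_add_right volume a)
      (hf.toLp f) - hf.toLp f‖ = l2 (fun z => f (z + a) - f z) := by
    intro a
    change _ = l2 ((fun z => f (z + a)) - f)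
    rw [l2_eq_norm_toLp ((memLp_comp_add hf a).sub hf), MemLp.toLp_sub,
      Lp.toLp_compMeasurePreserving]
    rfl
  simp only [Pi.sub_apply, h3] at h2
  convert h2 using 2
  simp [l2]

end l2

/-! ### Difference quotients and mollification in L² -/

section weak
variable {f g : SpaceTime n β → ℝ} {v : Space n × ℝ}

lemma integral_comp_add_mul (f η : SpaceTime n β → ℝ) (a : SpaceTime n β) :
    ∫ z, f (z + a) * η z = ∫ z, f z * η (z + -a) := by
  rw [← integral_add_right_eq_self (fun z => f z * η (z + -a)) a]
  simp

/-- Moving the translation onto η makes the pairing smooth in s; the weak identity for the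
translated test function moves the derivative back to f. -/
lemma hasDerivAt_integral_of_isWeakDir (hf : LocallyIntegrable f) (hfg : IsWeakDir v f g)
    {η : SpaceTime n β → ℝ} (hη : IsTest η) (t : ℝ) :
    HasDerivAt (fun s : ℝ => ∫ z, f (z + proj (s • v)) * η z)
      (∫ z, g (z + proj (t • v)) * η z) t := by
  have h1 := hasDerivAt_integral_translate hη hf (-v) t
  have h2 : (fun s : ℝ => ∫ z, f (z + proj (s • v)) * η z) =
      fun s : ℝ => ∫ z, f z * η (z + proj (s • -v)) := by
    ext s
    rw [integral_comp_add_mul, smul_neg, map_neg]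
  rw [h2]
  convert h1 using 1
  rw [integral_comp_add_mul]
  have h3 := hfg _ (hη.comp_add (-proj (t • v)))
  simp only [dirDeriv_comp_add] at h3
  rw [smul_neg, map_neg]
  simp only [mul_comm (g _)]
  rw [← neg_eq_iff_eq_neg] at h3
  rw [← h3, ← integral_neg]
  refine integral_congr_ae (ae_of_all _ fun z => ?_)
  simp only
  rw [← neg_one_smul ℝ v, dirDeriv_smul hη]
  ring

/-- Difference quotients of a function with a weak derivative converge in `L²`. -/
lemma l2_diffQuot_le (hf : MemLp f 2) (hg : MemLp g 2) (hfg : IsWeakDir v f g) {ε : ℝ}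
    (hε : 0 < ε) : ∃ δ > 0, ∀ t : ℝ, |t| < δ →
      l2 (fun z => f (z + proj (t • v)) - f z - t * g z) ≤ ε * |t| := by
  have hfl := hf.locallyIntegrable (by norm_num)
  have hgl := hg.locallyIntegrable (by norm_num)
  have hc : Tendsto (fun t : ℝ => (proj (t • v) : SpaceTime n β)) (𝓝 0) (𝓝 0) := by
    have h1 : Continuous (fun t : ℝ => (proj (t • v) : SpaceTime n β)) := by
      have := continuous_proj (n := n) (β := β)
      fun_prop
    simpa using h1.tendsto 0
  have h1 := ((tendsto_l2_translate hg).comp hc).eventually_lt_const hε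
  obtain ⟨δ, hδ, hball⟩ := Metric.eventually_nhds_iff_ball.1 h1
  refine ⟨δ, hδ, fun t ht => ?_⟩
  have hmt := memLp_comp_add hf (proj (t • v) : SpaceTime n β)
  -- By duality it suffices to bound pairings. The pairing, as a function H of the time, has
  -- derivative ∫ (g(· + sv) - g) η, which is small since translations are L²-continuous; the mean
  -- value inequality concludes.
  refine l2_le_of_forall_test ((hmt.sub hf).sub (hg.const_mul t)) fun η hη => ?_
  have hηm := hη.memLp 2
  let H : ℝ → ℝ := fun s => (∫ z, f (z + proj (s • v)) * η z) - s * ∫ z, g z * η z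
  have hH : ∀ s, HasDerivAt H ((∫ z, g (z + proj (s • v)) * η z) - ∫ z, g z * η z) s := fun s => by
    have := (hasDerivAt_integral_of_isWeakDir hfl hfg hη s).fun_sub
      ((hasDerivAt_id' s).mul_const (∫ z, g z * η z))
    rwa [one_mul] at this
  have hI : ∀ {k : SpaceTime n β → ℝ}, MemLp k 2 → Integrable (fun z => k z * η z) := fun hk =>
    hk.integrable_mul hηm
  have hb : ∀ s ∈ Metric.ball (0:ℝ) δ,
      ‖(∫ z, g (z + proj (s • v)) * η z) - ∫ z, g z * η z‖ ≤ ε * l2 η := by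
    intro s hs
    have hms := memLp_comp_add hg (proj (s • v) : SpaceTime n β)
    rw [← integral_sub (hI hms) (hI hg), Real.norm_eq_abs]
    simp only [← sub_mul]
    exact (abs_integral_mul_le (hms.sub hg) hηm).trans
      (mul_le_mul_of_nonneg_right (hball s hs).le (l2_nonneg _))
  have h2 := (convex_ball (0:ℝ) δ).norm_image_sub_le_of_norm_hasDerivWithin_le
    (fun s _ => (hH s).hasDerivWithinAt) hb (Metric.mem_ball_self hδ)
    (y := t) (by simpa using ht)
  have h3 : H t - H 0 = ∫ z, (f (z + proj (t • v)) - f z - t * g z) * η z := by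
    simp only [H, zero_smul, map_zero, add_zero, zero_mul, sub_zero]
    have h4 : Integrable fun z => f (z + proj (t • v)) * η z - f z * η z := (hI hmt).sub (hI hf)
    rw [← integral_const_mul, sub_right_comm, ← integral_sub (hI hmt) (hI hf), ← integral_sub
      h4 ((hI hg).const_mul t)]
    congr 1; ext z; ring
  rw [h3, sub_zero, Real.norm_eq_abs, Real.norm_eq_abs] at h2
  calc _ ≤ ε * l2 η * |t| := h2
    _ = _ := by ring

lemma integral_conv_mul {ρ η : SpaceTime n β → ℝ} (hρ : IsTest ρ) (hf : Integrable f)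
    (hη : IsTest η) : ∫ z, conv ρ f z * η z = ∫ w, ρ w * ∫ z, f (z - w) * η z := by
  have h1 : ∀ z, conv ρ f z = ∫ w, f (z - w) * ρ w := fun z => by
    rw [conv, ← integral_sub_left_eq_self _ volume z]
    simp
  have hint : Integrable (Function.uncurry fun z w => f (z - w) * ρ w * η z)
      ((volume : Measure (SpaceTime n β)).prod volume) := by
    have h2 := Integrable.convolution_integrand (ContinuousLinearMap.mul ℝ ℝ)
      (μ := (volume : Measure (SpaceTime n β))) (ν := volume) hρ.integrable hf
    obtain ⟨C, -, hC⟩ := hη.exists_bound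
    have h3 := h2.mul_bdd (c := C) (g := fun p : SpaceTime n β × SpaceTime n β => η p.1)
      (hη.continuous.comp continuous_fst).aestronglyMeasurable (ae_of_all _ fun p => hC p.1)
    refine h3.congr (ae_of_all _ fun p => ?_)
    simp [Function.uncurry, mul_comm]
  simp only [h1, ← integral_mul_const]
  rw [integral_integral_swap hint]
  refine integral_congr_ae (ae_of_all _ fun w => ?_)
  simp only
  rw [← integral_const_mul]
  congr 1; ext z; ring

/-- Mollifications converge in `L²`. -/
lemma l2_conv_sub_le (hf : MemLp f 2) (hc : HasCompactSupport f) {ε : ℝ} (hε : 0 < ε) :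
    ∃ δ > 0, ∀ ρ : SpaceTime n β → ℝ, IsTest ρ → (∀ z, 0 ≤ ρ z) → ∫ z, ρ z = 1 →
      (∀ z, ρ z ≠ 0 → ‖z‖ < δ) → l2 (fun z => conv ρ f z - f z) ≤ ε := by
  have hfl := hf.locallyIntegrable (by norm_num)
  have hfi : Integrable f := by
    rw [← integrableOn_iff_integrable_of_support_subset (subset_tsupport f)]
    exact hfl.integrableOn_isCompact hc
  have h1 := (tendsto_l2_translate hf).eventually_lt_const hε
  obtain ⟨δ, hδ, hball⟩ := Metric.eventually_nhds_iff_ball.1 h1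
  refine ⟨δ, hδ, fun ρ hρ hρ0 hρ1 hρs => ?_⟩
  have hcm := (isTest_conv hρ hfl hc).memLp 2
  refine l2_le_of_forall_test (hcm.sub hf) fun η hη => ?_
  have hηm := hη.memLp 2
  have hI : ∀ {k : SpaceTime n β → ℝ}, MemLp k 2 → Integrable (fun z => k z * η z) := fun hk =>
    hk.integrable_mul hηm
  -- The inner pairing is a convolution with the reflected η; its continuity is needed to integrate
  -- it against ρ.
  have hcont : Continuous fun w => ∫ z, f (z - w) * η z := by
    have h2 : (fun w => ∫ z, f (z - w) * η z) = conv (fun w => η (-w)) f ∘ Neg.neg := by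
      ext w
      simp only [Function.comp, conv]
      rw [← integral_add_right_eq_self _ w]
      congr 1; ext z; congr 2 <;> abel_nf
    have h3 : IsTest (fun w => η (-w)) := by simpa using hη.comp_sub_left 0
    have h4 := contDiff_conv h3 hfl
    have h5 := proj_isOpenQuotientMap.isQuotientMap.continuous_iff.2 h4.continuous
    rw [h2]
    exact h5.comp continuous_neg
  -- Since ρ has integral 1, the error is a ρ-average of translation errors, each at most ε on the
  -- support of ρ.
  have h2 : ∫ z, (conv ρ f z - f z) * η z =
      ∫ w, ρ w * ∫ z, (f (z - w) - f z) * η z := by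
    simp only [sub_mul]
    rw [integral_sub (hI hcm) (hI hf), integral_conv_mul hρ hfi hη,
      ← one_mul (∫ z, f z * η z), ← hρ1, ← integral_mul_const, ← integral_sub]
    · congr 1; ext w
      have hmw := memLp_comp_add hf (-w)
      simp only [← sub_eq_add_neg] at hmw
      rw [integral_sub (hI hmw) (hI hf)]
      ring
    · exact (hρ.continuous.mul hcont).integrable_of_hasCompactSupport hρ.2.mul_right
    · exact hρ.integrable.mul_const _
  change |∫ z, (conv ρ f z - f z) * η z| ≤ _
  rw [h2]
  calc |∫ w, ρ w * ∫ z, (f (z - w) - f z) * η z|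
      ≤ ∫ w, ρ w * (ε * l2 η) := by
        rw [← Real.norm_eq_abs]
        refine norm_integral_le_of_norm_le (hρ.integrable.mul_const _) (ae_of_all _ fun w => ?_)
        rw [norm_mul, Real.norm_of_nonneg (hρ0 w)]
        by_cases hw : ρ w = 0
        · simp [hw]
        refine mul_le_mul_of_nonneg_left ?_ (hρ0 w)
        have hmw := memLp_comp_add hf (-w)
        have h3 := abs_integral_mul_le (hmw.sub hf) hηm
        have h4 := hball (-w) (by simpa using hρs w hw)
        simp only [← sub_eq_add_neg] at h3 h4
        exact h3.trans (mul_le_mul_of_nonneg_right h4.le (l2_nonneg _))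
    _ = ε * l2 η := by rw [integral_mul_const, hρ1, one_mul]

end weak

/-! ### Locally square integrable functions -/

section MemL2Loc
variable {F : Type*} [NormedAddCommGroup F] {f f' : SpaceTime n β → F}

lemma _root_.MeasureTheory.MemLp.memL2Loc (hf : MemLp f 2) : MemL2Loc f := fun _ _ => hf.restrict _

lemma MemL2Loc.locallyIntegrable (hf : MemL2Loc f) : LocallyIntegrable f := by
  rw [locallyIntegrable_iff]
  intro K hK
  have : IsFiniteMeasure ((volume : Measure (SpaceTime n β)).restrict K) :=
    ⟨by rw [Measure.restrict_apply_univ]; exact hK.measure_lt_top⟩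
  exact (hf K hK).integrable (by norm_num)

lemma MemL2Loc.aestronglyMeasurable (hf : MemL2Loc f) : AEStronglyMeasurable f :=
  hf.locallyIntegrable.aestronglyMeasurable

lemma MemL2Loc.add (hf : MemL2Loc f) (hf' : MemL2Loc f') : MemL2Loc (fun z => f z + f' z) :=
  fun K hK => (hf K hK).add (hf' K hK)

lemma MemL2Loc.congr (hf : MemL2Loc f) (h : f =ᵐ[volume] f') : MemL2Loc f' :=
  fun K hK => (memLp_congr_ae (ae_restrict_of_ae h)).1 (hf K hK)

lemma MemL2Loc.of_le_mul {F' : Type*} [NormedAddCommGroup F'] {g : SpaceTime n β → F'}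
    (hf : MemL2Loc f) (hg : AEStronglyMeasurable g) {C : ℝ} (h : ∀ᵐ z, ‖g z‖ ≤ C * ‖f z‖) :
    MemL2Loc g :=
  fun K hK => (hf K hK).of_le_mul hg.restrict (ae_restrict_of_ae h)

lemma Continuous.memL2Loc (hf : Continuous f) : MemL2Loc f := by
  intro K hK
  obtain ⟨C, hC⟩ := hK.exists_bound_of_continuousOn hf.continuousOn
  have : IsFiniteMeasure ((volume : Measure (SpaceTime n β)).restrict K) :=
    ⟨by rw [Measure.restrict_apply_univ]; exact hK.measure_lt_top⟩
  refine MemLp.of_bound (hf.continuousOn.aestronglyMeasurable_of_isCompact hK hK.measurableSet) C ?_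
  exact ae_restrict_of_forall_mem hK.measurableSet hC

lemma MemL2Loc.bdd_mul [NormedSpace ℝ F] (hf : MemL2Loc f) {m : SpaceTime n β → ℝ}
    (hm : AEStronglyMeasurable m) {C : ℝ} (hC : ∀ z, |m z| ≤ C) :
    MemL2Loc (fun z => m z • f z) := by
  refine hf.of_le_mul (hm.smul hf.aestronglyMeasurable) (C := C) (ae_of_all _ fun z => ?_)
  rw [norm_smul]
  exact mul_le_mul_of_nonneg_right (hC z) (norm_nonneg _)

lemma MemL2Loc.comp_add (hf : MemL2Loc f) (a : SpaceTime n β) : MemL2Loc (fun z => f (z + a)) := by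
  intro K hK
  have h1 := hf _ (hK.image (Homeomorph.addRight a).continuous)
  refine h1.comp_measurePreserving (f := fun z => z + a) ?_
  have h2 := (measurePreserving_add_right (volume : Measure (SpaceTime n β)) a).restrict_preimage_emb
    (Homeomorph.addRight a).measurableEmbedding ((Homeomorph.addRight a) '' K)
  convert h2 using 2
  exact ((Homeomorph.addRight a).injective.preimage_image K).symm

lemma MemL2Loc.test_smul [NormedSpace ℝ F] (hf : MemL2Loc f) {η : SpaceTime n β → ℝ}
    (hη : IsTest η) : MemLp (fun z => η z • f z) 2 := by
  obtain ⟨C, -, hC⟩ := hη.exists_bound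
  have h1 : MemLp ((tsupport η).indicator f) 2 :=
    (memLp_indicator_iff_restrict hη.2.isCompact.measurableSet).2 (hf _ hη.2)
  refine h1.of_le_mul (hη.continuous.aestronglyMeasurable.smul hf.aestronglyMeasurable)
    (c := C) (ae_of_all _ fun z => ?_)
  by_cases hz : z ∈ tsupport η
  · rw [indicator_of_mem hz, norm_smul]
    exact mul_le_mul_of_nonneg_right (hC z) (norm_nonneg _)
  · simp [image_eq_zero_of_notMem_tsupport hz, hz]

lemma MemL2Loc.test_mul {f : SpaceTime n β → ℝ} (hf : MemL2Loc f) {η : SpaceTime n β → ℝ}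
    (hη : IsTest η) : MemLp (fun z => η z * f z) 2 := hf.test_smul hη

lemma MemL2Loc.mul {f g : SpaceTime n β → ℝ} (hf : MemL2Loc f) (hg : MemL2Loc g) :
    LocallyIntegrable (fun z => f z * g z) := by
  rw [locallyIntegrable_iff]
  exact fun K hK => (hf K hK).integrable_mul (hg K hK)

lemma IsTest.memL2Loc {η : SpaceTime n β → ℝ} (hη : IsTest η) : MemL2Loc η :=
  (hη.memLp 2).memL2Loc

lemma IsTest.memL2Loc_gradX {η : SpaceTime n β → ℝ} (hη : IsTest η) : MemL2Loc (gradX η) :=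
  Continuous.memL2Loc hη.continuous_gradX

lemma IsTest.integrable_test_mul {η f : SpaceTime n β → ℝ} (h : IsTest η)
    (hf : LocallyIntegrable f) : Integrable (fun z => η z * f z) := by
  simpa only [mul_comm] using h.integrable_mul hf

end MemL2Loc

/-! ### Algebra of weak derivatives and the chain rule -/

section weakDir
variable {f f' g g' : SpaceTime n β → ℝ} {v w : Space n × ℝ}

lemma IsWeakDir.ae_unique (hg : LocallyIntegrable g) (hg' : LocallyIntegrable g')
    (h : IsWeakDir v f g) (h' : IsWeakDir v f g') : g =ᵐ[volume] g' := by
  have := ae_eq_zero_of_forall_test (hg.sub hg') fun η hη => by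
    have h1 := (h η hη).symm.trans (h' η hη)
    simp only [Pi.sub_apply, sub_mul]
    rw [integral_sub (hη.integrable_mul hg) (hη.integrable_mul hg')]
    simp only [mul_comm _ (η _)]
    linarith
  filter_upwards [this] with z hz
  exact sub_eq_zero.1 hz

lemma IsWeakDir.congr (h : IsWeakDir v f g) (hf : f =ᵐ[volume] f') (hg : g =ᵐ[volume] g') :
    IsWeakDir v f' g' := by
  intro η hη
  have h1 : ∫ z, f z * dirDeriv v η z = ∫ z, f' z * dirDeriv v η z :=
    integral_congr_ae (hf.mul (EventuallyEq.refl _ (dirDeriv v η)))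
  have h2 : ∫ z, η z * g z = ∫ z, η z * g' z :=
    integral_congr_ae ((EventuallyEq.refl _ η).mul hg)
  rw [← h1, ← h2]
  exact h η hη

lemma IsWeakDir.comb (hf : LocallyIntegrable f) (hg : LocallyIntegrable g)
    (hg' : LocallyIntegrable g') (h : IsWeakDir v f g) (h' : IsWeakDir w f g') :
    IsWeakDir (v + w) f (fun z => g z + g' z) := by
  intro η hη
  simp only [dirDeriv_comb hη, mul_add]
  rw [integral_add ((hη.dirDeriv v).integrable_mul hf) ((hη.dirDeriv w).integrable_mul hf),
    integral_add (hη.integrable_test_mul hg) (hη.integrable_test_mul hg'), h η hη, h' η hη]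
  ring

lemma IsWeakDir.smul_dir (c : ℝ) (h : IsWeakDir v f g) :
    IsWeakDir (c • v) f (fun z => c * g z) := by
  intro η hη
  simp only [dirDeriv_smul hη, mul_left_comm _ c]
  rw [integral_const_mul, integral_const_mul, h η hη, mul_neg]

lemma IsWeakDir.add (hf : LocallyIntegrable f) (hf' : LocallyIntegrable f')
    (hg : LocallyIntegrable g) (hg' : LocallyIntegrable g') (h : IsWeakDir v f g)
    (h' : IsWeakDir v f' g') : IsWeakDir v (fun z => f z + f' z) (fun z => g z + g' z) := by
  intro η hη
  simp only [add_mul, mul_add]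
  rw [integral_add ((hη.dirDeriv v).integrable_mul hf) ((hη.dirDeriv v).integrable_mul hf'),
    integral_add (hη.integrable_test_mul hg) (hη.integrable_test_mul hg'), h η hη, h' η hη]
  ring

lemma IsWeakDir.const_mul (c : ℝ) (h : IsWeakDir v f g) :
    IsWeakDir v (fun z => c * f z) (fun z => c * g z) := by
  intro η hη
  simp only [mul_assoc, mul_left_comm _ c]
  rw [integral_const_mul, integral_const_mul, h η hη, mul_neg]

lemma IsWeakDir.comp_add (h : IsWeakDir v f g) (a : SpaceTime n β) :
    IsWeakDir v (fun z => f (z + a)) (fun z => g (z + a)) := by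
  intro η hη
  have h1 := h _ (hη.comp_add (-a))
  simp only [dirDeriv_comp_add] at h1
  rw [integral_comp_add_mul, h1]
  simp only [mul_comm (η _)]
  rw [integral_comp_add_mul]

/-- A product of test functions is a test function; the weak identity applied to it, with the
classical product rule, is the weak product rule. -/
lemma IsWeakDir.test_mul (hf : LocallyIntegrable f) (hg : LocallyIntegrable g)
    {η : SpaceTime n β → ℝ} (hη : IsTest η) (h : IsWeakDir v f g) :
    IsWeakDir v (fun z => η z * f z) (fun z => η z * g z + f z * dirDeriv v η z) := by
  intro θ hθ
  have h1 := h _ (hη.mul hθ)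
  simp only [dirDeriv_mul hη hθ, mul_add] at h1 ⊢
  rw [integral_add (((hη.dirDeriv v).mul hθ).integrable_mul hf)
    ((hη.mul (hθ.dirDeriv v)).integrable_mul hf)] at h1
  have i1 : Integrable fun z => θ z * (η z * g z) := by
    simpa only [mul_assoc] using (hθ.mul hη).integrable_test_mul hg
  have i2 : Integrable fun z => θ z * (f z * dirDeriv v η z) := by
    refine (((hη.dirDeriv v).mul hθ).integrable_mul hf).congr (ae_of_all _ fun z => ?_)
    simp only; ring
  rw [integral_add i1 i2]
  have e1 : ∫ z, f z * (dirDeriv v η z * θ z) = ∫ z, θ z * (f z * dirDeriv v η z) := by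
    congr 1; ext z; ring
  have e2 : ∫ z, f z * (η z * dirDeriv v θ z) = ∫ z, η z * f z * dirDeriv v θ z := by
    congr 1; ext z; ring
  have e3 : ∫ z, η z * θ z * g z = ∫ z, θ z * (η z * g z) := by
    congr 1; ext z; ring
  rw [e1, e2, e3] at h1
  linarith

lemma integral_dirDeriv {η : SpaceTime n β → ℝ} (hη : IsTest η) (v : Space n × ℝ) :
    ∫ z, dirDeriv v η z = 0 := by
  have h1 := hasDerivAt_integral_translate hη (f := fun _ => 1) (locallyIntegrable_const 1) v 0
  simp only [one_mul, zero_smul, map_zero, add_zero, integral_add_right_eq_self η] at h1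
  exact h1.unique (hasDerivAt_const _ _)

lemma IsTest.isWeakDir {η : SpaceTime n β → ℝ} (hη : IsTest η) (v : Space n × ℝ) :
    IsWeakDir v η (Bounce.dirDeriv v η) := by
  intro θ hθ
  have h1 := integral_dirDeriv (hη.mul hθ) v
  simp only [dirDeriv_mul hη hθ] at h1
  rw [integral_add ((hη.dirDeriv v).mul hθ).integrable (hη.mul (hθ.dirDeriv v)).integrable] at h1
  simp only [mul_comm (θ _)]
  linarith

/-- For G differentiable but not C¹ the divided difference need not be jointly continuous on the
diagonal, so measurability is obtained from the explicit case distinction. -/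
lemma measurable_dslope {G : ℝ → ℝ} (hG : Continuous G) :
    Measurable fun p : ℝ × ℝ => dslope G p.1 p.2 := by
  have h : (fun p : ℝ × ℝ => dslope G p.1 p.2) =
      fun p => if p.2 = p.1 then deriv G p.1 else (p.2 - p.1)⁻¹ * (G p.2 - G p.1) := by
    ext p
    split_ifs with hp
    · rw [hp, dslope_same]
    · rw [dslope_of_ne _ hp, slope_def_field, div_eq_inv_mul]
  rw [h]
  refine Measurable.ite (measurableSet_eq_fun measurable_snd measurable_fst)
    ((measurable_deriv G).comp measurable_fst) ?_
  have := hG.measurable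
  fun_prop

lemma abs_dslope_le {G : ℝ → ℝ} {L : ℝ≥0} (hL : LipschitzWith L G) (a b : ℝ) :
    |dslope G a b| ≤ L := by
  by_cases h : b = a
  · rw [h, dslope_same]; exact norm_deriv_le_of_lipschitz hL
  · rw [dslope_of_ne _ h, slope_def_field, abs_div]
    rw [div_le_iff₀ (abs_pos.2 (sub_ne_zero.2 h))]
    exact hL.dist_le_mul b a

lemma MemL2Loc.lipschitz_comp (hf : MemL2Loc f) {G : ℝ → ℝ} {L : ℝ≥0} (hL : LipschitzWith L G) :
    MemL2Loc (fun z => G (f z)) := by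
  have h1 : MemL2Loc (fun z => G (f z) - G 0) := by
    refine hf.of_le_mul (C := L) ((hL.continuous.comp_aestronglyMeasurable
      hf.aestronglyMeasurable).sub aestronglyMeasurable_const) (ae_of_all _ fun z => ?_)
    simpa [dist_eq_norm] using hL.dist_le_mul (f z) 0
  simpa using h1.add (Continuous.memL2Loc (continuous_const (y := G 0)))

lemma eLpNorm_eq_ofReal_l2 (hf : MemLp f 2) : eLpNorm f 2 volume = ENNReal.ofReal (l2 f) := by
  rw [l2, ENNReal.ofReal_toReal hf.2.ne]

lemma exists_subseq_tendsto_ae {u : ℕ → SpaceTime n β → ℝ} (hu : ∀ k, MemLp (u k) 2)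
    (hf : MemLp f 2) (h : Tendsto (fun k => l2 (fun z => u k z - f z)) atTop (𝓝 0)) :
    ∃ ns : ℕ → ℕ, StrictMono ns ∧ ∀ᵐ z, Tendsto (fun k => u (ns k) z) atTop (𝓝 (f z)) := by
  refine TendstoInMeasure.exists_seq_tendsto_ae (tendstoInMeasure_of_tendsto_eLpNorm
    (p := 2) (by norm_num) (fun k => (hu k).1) hf.1 ?_)
  have h1 : ∀ k, eLpNorm (u k - f) 2 volume = ENNReal.ofReal (l2 (fun z => u k z - f z)) :=
    fun k => eLpNorm_eq_ofReal_l2 ((hu k).sub hf)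
  simp only [h1]
  simpa using ENNReal.tendsto_ofReal h

/-- The chain rule for weak derivatives. -/
lemma IsWeakDir.comp (hf : MemL2Loc f) (hg : MemL2Loc g) (h : IsWeakDir v f g) {G : ℝ → ℝ}
    {L : ℝ≥0} (hG : Differentiable ℝ G) (hL : LipschitzWith L G) :
    IsWeakDir v (fun z => G (f z)) (fun z => deriv G (f z) * g z) := by
  intro η hη
  have hcont : Continuous fun t : ℝ => (proj (t • v) : SpaceTime n β) := by
    have := continuous_proj (n := n) (β := β)
    fun_prop
  have hK : IsCompact (Metric.cthickening 1 (tsupport η)) := IsCompact.cthickening hη.2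
  obtain ⟨χ, hχ, -, -, hχ1⟩ := exists_cutoff hK
  -- Localisation turns the L²_loc data into L² data without changing them near the support of η,
  -- including after translations of size at most 1.
  set F : SpaceTime n β → ℝ := fun z => χ z * f z with hF
  set Γ : SpaceTime n β → ℝ := fun z => χ z * g z + f z * dirDeriv v χ z with hΓ
  have hFm : MemLp F 2 := hf.test_mul hχ
  have hΓm : MemLp Γ 2 := by
    refine (hg.test_mul hχ).add ?_
    simpa only [mul_comm] using hf.test_mul (hχ.dirDeriv v)
  have hFΓ : IsWeakDir v F Γ := h.test_mul hf.locallyIntegrable hg.locallyIntegrable hχ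
  have hFf : ∀ z ∈ Metric.cthickening 1 (tsupport η), F z = f z := fun z hz => by
    simp [hF, hχ1 z hz]
  have hsub : tsupport η ⊆ Metric.cthickening 1 (tsupport η) := Metric.self_subset_cthickening _
  have hΓg : ∀ z ∈ tsupport η, Γ z = g z := fun z hz => by
    have h1 : ∀ᶠ y in 𝓝 z, χ y = 1 := by
      filter_upwards [Metric.closedBall_mem_nhds z one_pos] with y hy
      exact hχ1 y (Metric.mem_cthickening_of_dist_le y z _ _ hz hy)
    have h2 : (fun t : ℝ => χ (z + proj (t • v))) =ᶠ[𝓝 0] fun _ => 1 := by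
      have hc : Tendsto (fun t : ℝ => z + (proj (t • v) : SpaceTime n β)) (𝓝 0) (𝓝 z) := by
        simpa using (hcont.const_add z).tendsto 0
      exact hc.eventually h1
    have h3 : dirDeriv v χ z = 0 := by
      rw [dirDeriv, h2.deriv_eq]; simp
    simp [hΓ, h3, hχ1 z (hsub hz)]
  -- the sequence of translations
  set t : ℕ → ℝ := fun k => 1 / ((k : ℝ) + 1) with ht
  have ht0 : ∀ k, 0 < t k := fun k => by positivity
  have htl : Tendsto t atTop (𝓝 0) := tendsto_one_div_add_atTop_nhds_zero_nat
  have htl' : Tendsto (fun k => (proj ((-t k) • v) : SpaceTime n β)) atTop (𝓝 0) := by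
    have := (hcont.tendsto 0).comp (by simpa using htl.neg : Tendsto (fun k => - t k) atTop (𝓝 0))
    rwa [zero_smul, map_zero] at this
  obtain ⟨ns, hns, hae⟩ := exists_subseq_tendsto_ae
    (fun k => memLp_comp_add hFm (proj ((-t k) • v) : SpaceTime n β)) hFm
    ((tendsto_l2_translate hFm).comp htl')
  set s : ℕ → ℝ := fun k => t (ns k) with hs
  have hs0 : ∀ k, 0 < s k := fun k => ht0 _
  have hsl : Tendsto s atTop (𝓝 0) := htl.comp hns.tendsto_atTop
  have hsl' : Tendsto (fun k => (proj ((-s k) • v) : SpaceTime n β)) atTop (𝓝 0) :=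
    htl'.comp hns.tendsto_atTop
  set q : ℕ → SpaceTime n β → ℝ := fun k z => (s k)⁻¹ * (F (z + proj ((-s k) • v)) - F z) with hq
  -- The divided difference of G between the two values of F. It is bounded by L and, along the
  -- chosen subsequence where the translates converge a.e., it tends to G'(F); only
  -- differentiability of G is needed.
  set m : ℕ → SpaceTime n β → ℝ := fun k z => dslope G (F z) (F (z + proj ((-s k) • v))) with hm
  have hqm : ∀ k, MemLp (q k) 2 := fun k => ((memLp_comp_add hFm _).sub hFm).const_mul _
  have hmm : ∀ k, AEStronglyMeasurable (m k) := fun k =>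
    ((measurable_dslope hG.continuous).comp_aemeasurable
      (hFm.1.aemeasurable.prodMk (memLp_comp_add hFm _).1.aemeasurable)).aestronglyMeasurable
  have hmb : ∀ k z, ‖m k z‖ ≤ L := fun k z => abs_dslope_le hL _ _
  have hdm : AEStronglyMeasurable (fun z => deriv G (F z)) :=
    ((measurable_deriv G).comp_aemeasurable hFm.1.aemeasurable).aestronglyMeasurable
  have hdb : ∀ z, ‖deriv G (F z)‖ ≤ L := fun z => norm_deriv_le_of_lipschitz hL
  -- the difference quotients of `G ∘ f`
  have hGf : LocallyIntegrable (fun z => G (f z)) := (hf.lipschitz_comp hL).locallyIntegrable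
  -- The slope of the pairing, with the translation moved from η to G ∘ f, factors as the divided
  -- difference m times the difference quotient q.
  have hlim1 : Tendsto (fun k => ∫ z, m k z * q k z * η z) atTop
      (𝓝 (∫ z, G (f z) * dirDeriv v η z)) := by
    have h1 := hasDerivAt_integral_translate hη hGf v 0
    simp only [zero_smul, map_zero, add_zero] at h1
    rw [hasDerivAt_iff_tendsto_slope] at h1
    have h2 : Tendsto s atTop (𝓝[≠] 0) :=
      tendsto_nhdsWithin_iff.2 ⟨hsl, Eventually.of_forall fun k => (hs0 k).ne'⟩
    refine (h1.comp h2).congr' ?_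
    have h3 : ∀ᶠ k in atTop, ‖(proj ((-s k) • v) : SpaceTime n β)‖ < 1 := by
      have := hsl'.norm
      rw [norm_zero] at this
      exact this.eventually_lt_const one_pos
    filter_upwards [h3] with k hk
    have hmG : Integrable fun z => G (f (z + proj ((-s k) • v))) * η z :=
      hη.integrable_mul ((hf.comp_add _).lipschitz_comp hL).locallyIntegrable
    rw [Function.comp, slope_def_field, sub_zero]
    have h4 : ∫ z, G (f z) * η (z + proj (s k • v)) =
        ∫ z, G (f (z + proj ((-s k) • v))) * η z := by
      rw [integral_comp_add_mul (fun z => G (f z)) η]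
      simp
    simp only [zero_smul, map_zero, add_zero]
    rw [h4, ← integral_sub hmG (hη.integrable_mul hGf), div_eq_inv_mul, ← integral_const_mul]
    congr 1; ext z
    by_cases hz : z ∈ tsupport η
    · have e1 := hFf z (hsub hz)
      have e2 : F (z + proj ((-s k) • v)) = f (z + proj ((-s k) • v)) := by
        refine hFf _ (Metric.mem_cthickening_of_dist_le _ z _ _ hz ?_)
        rw [dist_eq_norm]; simpa using hk.le
      have e3 : (F (z + proj ((-s k) • v)) - F z) * m k z =
          G (F (z + proj ((-s k) • v))) - G (F z) := by
        have := sub_smul_dslope G (F z) (F (z + proj ((-s k) • v)))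
        simpa [hm] using this
      rw [← e1, ← e2, ← sub_mul, ← e3]
      simp only [hq]; ring
    · simp [image_eq_zero_of_notMem_tsupport hz]
  -- The translations are by -s while the division is by s, so q tends to -Γ strongly in L². With m
  -- bounded, q may be replaced by -Γ, after which dominated convergence handles m.
  have hlim2 : Tendsto (fun k => ∫ z, m k z * q k z * η z) atTop
      (𝓝 (∫ z, deriv G (F z) * (-Γ z) * η z)) := by
    have i1 : ∀ {k : SpaceTime n β → ℝ}, MemLp k 2 → ∀ {a : SpaceTime n β → ℝ},
        AEStronglyMeasurable a → (∀ z, ‖a z‖ ≤ L) → Integrable fun z => a z * k z * η z := by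
      intro k hk a ha hab
      have := (hk.integrable_mul (hη.memLp 2)).bdd_mul ha (ae_of_all _ hab)
      simpa only [Pi.mul_apply, mul_assoc] using this
    have hA : Tendsto (fun k => ∫ z, m k z * (q k z + Γ z) * η z) atTop (𝓝 0) := by
      have h1 : Tendsto (fun k => l2 (fun z => q k z + Γ z) * (L * l2 η)) atTop (𝓝 0) := by
        rw [← zero_mul (L * l2 η)]
        refine Tendsto.mul_const _ ?_
        rw [Metric.tendsto_atTop]
        intro ε hε
        obtain ⟨δ, hδ, hδ'⟩ := l2_diffQuot_le hFm hΓm hFΓ (half_pos hε)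
        have := (hsl.eventually_lt_const hδ)
        obtain ⟨N, hN⟩ := eventually_atTop.1 this
        refine ⟨N, fun k hk => ?_⟩
        have h2 := hδ' (-s k) (by rw [abs_neg, abs_of_pos (hs0 k)]; exact hN k hk)
        have h3 : (fun z => q k z + Γ z) = fun z =>
            (s k)⁻¹ * (F (z + proj ((-s k) • v)) - F z - (-s k) * Γ z) := by
          ext z; simp only [hq]; field_simp [(hs0 k).ne']; ring
        rw [h3, l2_const_mul, Real.dist_eq, sub_zero, abs_of_nonneg
          (mul_nonneg (abs_nonneg _) (l2_nonneg _)), abs_of_pos (inv_pos.2 (hs0 k))]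
        rw [abs_neg, abs_of_pos (hs0 k)] at h2
        calc _ ≤ (s k)⁻¹ * (ε / 2 * s k) :=
              mul_le_mul_of_nonneg_left h2 (inv_pos.2 (hs0 k)).le
          _ = ε / 2 := by field_simp [(hs0 k).ne']
          _ < ε := half_lt_self hε
      refine squeeze_zero_norm (fun k => ?_) h1
      have hqΓ : MemLp (fun z => q k z + Γ z) 2 := (hqm k).add hΓm
      have h2 : MemLp (fun z => m k z * η z) 2 := by
        refine (hη.memLp 2).of_le_mul (c := L) ((hmm k).mul hη.continuous.aestronglyMeasurable)
          (ae_of_all _ fun z => ?_)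
        rw [norm_mul]
        exact mul_le_mul_of_nonneg_right (hmb k z) (norm_nonneg _)
      have h3 : l2 (fun z => m k z * η z) ≤ L * l2 η := by
        have h4 : eLpNorm (fun z => m k z * η z) 2 volume ≤ ENNReal.ofReal L * eLpNorm η 2 volume := by
          refine eLpNorm_le_mul_eLpNorm_of_ae_le_mul (ae_of_all _ fun z => ?_) 2
          rw [norm_mul]
          exact mul_le_mul_of_nonneg_right (hmb k z) (norm_nonneg _)
        have := ENNReal.toReal_mono (ENNReal.mul_ne_top ENNReal.ofReal_ne_top (hη.memLp 2).2.ne) h4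
        simpa [l2, ENNReal.toReal_mul] using this
      have h5 := abs_integral_mul_le hqΓ h2
      rw [Real.norm_eq_abs]
      calc _ = |∫ z, (q k z + Γ z) * (m k z * η z)| := by
            congr 2; ext z; ring
        _ ≤ _ := h5.trans (mul_le_mul_of_nonneg_left h3 (l2_nonneg _))
    have hB : Tendsto (fun k => ∫ z, m k z * (-Γ z) * η z) atTop
        (𝓝 (∫ z, deriv G (F z) * (-Γ z) * η z)) := by
      refine tendsto_integral_of_dominated_convergence (fun z => L * ‖Γ z * η z‖)
        (fun k => (i1 hΓm.neg (hmm k) (hmb k)).aestronglyMeasurable)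
        ((hΓm.integrable_mul (hη.memLp 2)).norm.const_mul _) (fun k => ae_of_all _ fun z => ?_) ?_
      · rw [norm_mul, norm_mul, norm_neg, mul_assoc, ← norm_mul]
        exact mul_le_mul_of_nonneg_right (hmb k z) (norm_nonneg _)
      · filter_upwards [hae] with z hz
        refine Tendsto.mul_const _ (Tendsto.mul_const _ ?_)
        have hc := (continuousAt_dslope_same.2 (hG (F z))).tendsto
        rw [dslope_same] at hc
        exact hc.comp hz
    have := hA.add hB
    rw [zero_add] at this
    refine this.congr fun k => ?_
    rw [← integral_add]
    · congr 1; ext z; ring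
    · exact i1 ((hqm k).add hΓm) (hmm k) (hmb k)
    · exact i1 hΓm.neg (hmm k) (hmb k)
  rw [tendsto_nhds_unique hlim1 hlim2, ← integral_neg]
  congr 1; ext z
  by_cases hz : z ∈ tsupport η
  · rw [hΓg z hz, hFf z (hsub hz)]; ring
  · simp [image_eq_zero_of_notMem_tsupport hz]

end weakDir

/-! ### The weak derivative of the positive part -/

section truncation

/-- A smooth approximation of the positive part, with derivative tending to the indicator function
of `(0, ∞)`. -/
noncomputable def smoothPos (d s : ℝ) : ℝ := ((s - d) + √((s - d) ^ 2 + d ^ 4)) / 2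

lemma hasDerivAt_smoothPos {d : ℝ} (hd : 0 < d) (s : ℝ) :
    HasDerivAt (smoothPos d) ((1 + (s - d) / √((s - d) ^ 2 + d ^ 4)) / 2) s := by
  have h0 : 0 < (s - d) ^ 2 + d ^ 4 := by positivity
  have h1 : HasDerivAt (fun s : ℝ => (s - d) ^ 2 + d ^ 4) (2 * (s - d)) s := by
    have := (((hasDerivAt_id' s).sub_const d).fun_pow 2).add_const (d ^ 4)
    simpa using this
  have h2 := (((hasDerivAt_id' s).sub_const d).fun_add (h1.sqrt h0.ne')).div_const 2
  refine h2.congr_deriv ?_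
  rw [mul_div_mul_left _ _ two_ne_zero]

lemma abs_div_sqrt_le {x y : ℝ} (hy : 0 < y) : |x / √(x ^ 2 + y)| ≤ 1 := by
  have h0 : 0 < √(x ^ 2 + y) := Real.sqrt_pos.2 (by positivity)
  rw [abs_div, abs_of_pos h0, div_le_one h0]
  exact Real.abs_le_sqrt (by linarith)

lemma deriv_smoothPos_mem {d : ℝ} (hd : 0 < d) (s : ℝ) : |deriv (smoothPos d) s| ≤ 1 := by
  rw [(hasDerivAt_smoothPos hd s).deriv]
  have := abs_le.1 (abs_div_sqrt_le (x := s - d) (pow_pos hd 4))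
  rw [abs_le]; constructor <;> linarith [this.1, this.2]

lemma lipschitz_smoothPos {d : ℝ} (hd : 0 < d) : LipschitzWith 1 (smoothPos d) :=
  lipschitzWith_of_nnnorm_deriv_le (fun s => (hasDerivAt_smoothPos hd s).differentiableAt)
    (fun s => deriv_smoothPos_mem hd s)

lemma abs_smoothPos_le {d : ℝ} (hd : 0 < d) (hd1 : d ≤ 1) (s : ℝ) : |smoothPos d s| ≤ |s| + 2 := by
  have h1 : |s - d| ≤ |s| + 1 := by
    calc |s - d| ≤ |s| + |d| := abs_sub _ _
      _ ≤ _ := by rw [abs_of_pos hd]; linarith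
  have h2 : √((s - d) ^ 2 + d ^ 4) ≤ |s - d| + 1 := by
    rw [Real.sqrt_le_left (by positivity)]
    have : d ^ 4 ≤ 1 := pow_le_one₀ hd.le hd1
    nlinarith [abs_nonneg (s - d), sq_abs (s - d)]
  have h3 := Real.sqrt_nonneg ((s - d) ^ 2 + d ^ 4)
  rw [smoothPos, abs_le]
  have := abs_le.1 h1
  constructor <;> linarith [this.1, this.2, abs_nonneg (s - d)]

lemma tendsto_smoothPos (s : ℝ) : Tendsto (fun d => smoothPos d s) (𝓝 0) (𝓝 (max s 0)) := by
  have h : Continuous fun d => smoothPos d s := by unfold smoothPos; fun_prop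
  have h1 : smoothPos 0 s = max s 0 := by
    simp only [smoothPos, sub_zero, Real.sqrt_sq_eq_abs, zero_pow four_ne_zero, add_zero]
    rcases le_total 0 s with hs | hs
    · rw [abs_of_nonneg hs, max_eq_left hs]; ring
    · rw [abs_of_nonpos hs, max_eq_right hs]; ring
  rw [← h1]
  exact h.tendsto 0

/-- The corner is moved to d > 0 and smoothed at the much smaller width d². Hence at s = 0 the limit
is 0, not the symmetric value 1/2, and no separate argument on the zero set of f is needed. -/
lemma tendsto_deriv_smoothPos (s : ℝ) : Tendsto (fun d => deriv (smoothPos d) s) (𝓝[>] 0)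
    (𝓝 (if 0 < s then 1 else 0)) := by
  have h0 : ∀ᶠ d : ℝ in 𝓝[>] 0, (1 + (s - d) / √((s - d) ^ 2 + d ^ 4)) / 2 =
      deriv (smoothPos d) s := by
    filter_upwards [self_mem_nhdsWithin] with d hd
    exact (hasDerivAt_smoothPos hd s).deriv.symm
  refine Tendsto.congr' h0 ?_
  split_ifs with hs
  · have hc : ContinuousAt (fun d : ℝ => (1 + (s - d) / √((s - d) ^ 2 + d ^ 4)) / 2) 0 := by
      have : √((s - 0) ^ 2 + (0:ℝ) ^ 4) ≠ 0 := by
        simpa using (Real.sqrt_pos.2 (pow_pos hs 2)).ne'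
      fun_prop (disch := assumption)
    have h1 := hc.tendsto.mono_left (nhdsWithin_le_nhds (s := Ioi (0:ℝ)))
    convert h1 using 2
    simp only [sub_zero, zero_pow four_ne_zero, add_zero, Real.sqrt_sq hs.le, div_self hs.ne']
    norm_num
  · push Not at hs
    have h2 : Tendsto (fun d : ℝ => d ^ 2) (𝓝[>] 0) (𝓝 0) := by
      have : Continuous fun d : ℝ => d ^ 2 := by fun_prop
      simpa using (this.tendsto 0).mono_left nhdsWithin_le_nhds
    refine squeeze_zero' ?_ ?_ h2
    · filter_upwards [self_mem_nhdsWithin] with d hd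
      have hd : 0 < d := hd
      have := abs_le.1 (abs_div_sqrt_le (x := s - d) (pow_pos hd 4))
      linarith [this.1]
    · filter_upwards [self_mem_nhdsWithin] with d hd
      have hd : 0 < d := hd
      have hx : s - d ≤ -d := by linarith
      set x := s - d
      have hp : 0 < x ^ 2 + d ^ 4 := by positivity
      have hsq : 0 < √(x ^ 2 + d ^ 4) := Real.sqrt_pos.2 hp
      have h3 : √(x ^ 2 + d ^ 4) ^ 2 = x ^ 2 + d ^ 4 := Real.sq_sqrt hp.le
      have h4 : -x ≤ √(x ^ 2 + d ^ 4) := Real.le_sqrt_of_sq_le (by nlinarith [pow_pos hd 4])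
      set r := √(x ^ 2 + d ^ 4)
      -- Rationalising: (r + x)(r - x) = d⁴ with r - x ≥ d gives r + x ≤ d³, while r ≥ d.
      have h5 : r + x ≤ d ^ 2 * r := by
        have h6 : (r + x) * (r - x) = d ^ 4 := by nlinarith
        have h7 : d ≤ r - x := by linarith
        have h8 : (r + x) * d ≤ d ^ 4 := by nlinarith
        have h9 : r + x ≤ d ^ 3 := by
          have : (r + x) * d ≤ d ^ 3 * d := by nlinarith
          exact le_of_mul_le_mul_right this hd
        have : d ≤ r := by linarith
        calc r + x ≤ d ^ 2 * d := by linarith [pow_succ d 2]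
          _ ≤ _ := mul_le_mul_of_nonneg_left this (by positivity)
      have h10 : 1 + x / r ≤ d ^ 2 := by
        rw [show 1 + x / r = (r + x) / r by field_simp, div_le_iff₀ hsq]; exact h5
      have : 0 ≤ 1 + x / r := by
        rw [show 1 + x / r = (r + x) / r by field_simp]; exact div_nonneg (by linarith) hsq.le
      linarith

open Classical in
/-- Stampacchia's theorem: the weak derivative of the positive part. -/
lemma IsWeakDir.posPart {f g : SpaceTime n β → ℝ} {v : Space n × ℝ} (hf : MemL2Loc f)
    (hg : MemL2Loc g) (h : IsWeakDir v f g) :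
    IsWeakDir v (fun z => max (f z) 0) (fun z => if 0 < f z then g z else 0) := by
  intro η hη
  set d : ℕ → ℝ := fun k => 1 / ((k : ℝ) + 1) with hd
  have hd0 : ∀ k, 0 < d k := fun k => by positivity
  have hd1 : ∀ k, d k ≤ 1 := fun k => by
    rw [hd]; simp only
    rw [div_le_one (by positivity)]
    linarith [(Nat.cast_nonneg k : (0:ℝ) ≤ k)]
  have hdl : Tendsto d atTop (𝓝 0) := tendsto_one_div_add_atTop_nhds_zero_nat
  have hdl' : Tendsto d atTop (𝓝[>] 0) :=
    tendsto_nhdsWithin_iff.2 ⟨hdl, Eventually.of_forall hd0⟩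
  have hk : ∀ k, ∫ z, smoothPos (d k) (f z) * dirDeriv v η z =
      - ∫ z, η z * (deriv (smoothPos (d k)) (f z) * g z) := fun k =>
    h.comp hf hg (fun s => (hasDerivAt_smoothPos (hd0 k) s).differentiableAt)
      (lipschitz_smoothPos (hd0 k)) η hη
  have hfm := hf.aestronglyMeasurable
  have hgm := hg.aestronglyMeasurable
  have l1 : Tendsto (fun k => ∫ z, smoothPos (d k) (f z) * dirDeriv v η z) atTop
      (𝓝 (∫ z, max (f z) 0 * dirDeriv v η z)) := by
    have hi : Integrable (fun z => (|f z| + 2) * |dirDeriv v η z|) := by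
      have h1 := (hη.dirDeriv v).integrable_mul hf.locallyIntegrable
      have h2 := ((hη.dirDeriv v).integrable.norm).const_mul 2
      refine (h1.norm.add h2).congr (ae_of_all _ fun z => ?_)
      simp only [Pi.add_apply, norm_mul, Real.norm_eq_abs]; ring
    refine tendsto_integral_of_dominated_convergence _ (fun k => ?_) hi
      (fun k => ae_of_all _ fun z => ?_) (ae_of_all _ fun z => ?_)
    · exact ((lipschitz_smoothPos (hd0 k)).continuous.comp_aestronglyMeasurable hfm).mul
        (hη.dirDeriv v).continuous.aestronglyMeasurable
    · rw [norm_mul]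
      exact mul_le_mul_of_nonneg_right (abs_smoothPos_le (hd0 k) (hd1 k) _) (norm_nonneg _)
    · exact ((tendsto_smoothPos _).comp hdl).mul_const _
  have l2 : Tendsto (fun k => ∫ z, η z * (deriv (smoothPos (d k)) (f z) * g z)) atTop
      (𝓝 (∫ z, η z * (if 0 < f z then g z else 0))) := by
    refine tendsto_integral_of_dominated_convergence (fun z => ‖η z * g z‖) (fun k => ?_)
      (hη.integrable_test_mul hg.locallyIntegrable).norm
      (fun k => ae_of_all _ fun z => ?_) (ae_of_all _ fun z => ?_)
    · exact hη.continuous.aestronglyMeasurable.mul (((measurable_deriv _).comp_aemeasurable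
        hfm.aemeasurable).aestronglyMeasurable.mul hgm)
    · rw [norm_mul, norm_mul, norm_mul]
      refine mul_le_mul_of_nonneg_left ?_ (norm_nonneg _)
      exact mul_le_of_le_one_left (norm_nonneg _) (deriv_smoothPos_mem (hd0 k) _)
    · refine Tendsto.const_mul _ ?_
      have := ((tendsto_deriv_smoothPos (f z)).comp hdl').mul_const (g z)
      refine this.trans (le_of_eq ?_)
      congr 1; split_ifs <;> simp
  simp only [hk] at l1
  exact tendsto_nhds_unique l1 l2.neg

end truncation

/-! ### Functions with locally square integrable weak gradient -/

section HasWGrad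

/-- The component in direction `v` of the gradient with spatial part `g` and `τ`-part `h`. -/
noncomputable def dirOf (g : SpaceTime n β → Space n) (h : SpaceTime n β → ℝ) (v : Space n × ℝ)
    (z : SpaceTime n β) : ℝ := inner ℝ (g z) v.1 + h z * v.2

/-- `φ` is locally in `W^{1,2}` with weak spatial gradient `g` and weak `τ`-derivative `h`. -/
structure HasWGrad (φ : SpaceTime n β → ℝ) (g : SpaceTime n β → Space n) (h : SpaceTime n β → ℝ) :
    Prop where
  memφ : MemL2Loc φ
  memg : MemL2Loc g
  memh : MemL2Loc h
  weak : ∀ v, IsWeakDir v φ (dirOf g h v)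

variable {φ ψ : SpaceTime n β → ℝ} {g g' : SpaceTime n β → Space n} {h h' : SpaceTime n β → ℝ}

lemma MemL2Loc.inner_const (hg : MemL2Loc g) (e : Space n) :
    MemL2Loc (fun z => Inner.inner ℝ (g z) e) :=
  hg.of_le_mul (C := ‖e‖) (hg.aestronglyMeasurable.inner aestronglyMeasurable_const)
    (ae_of_all _ fun _ => (norm_inner_le_norm _ _).trans (mul_comm _ _).le)

lemma MemL2Loc.dirOf (hg : MemL2Loc g) (hh : MemL2Loc h) (v : Space n × ℝ) :
    MemL2Loc (dirOf g h v) := by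
  refine (hg.inner_const v.1).add (hh.of_le_mul (C := |v.2|)
    (hh.aestronglyMeasurable.mul_const _) (ae_of_all _ fun z => ?_))
  rw [norm_mul, mul_comm, Real.norm_eq_abs v.2]

lemma HasWGrad.memDir (H : HasWGrad φ g h) (v : Space n × ℝ) : MemL2Loc (dirOf g h v) :=
  H.memg.dirOf H.memh v

/-- Pairing the vector identity with each fixed e reduces it to scalar ones, as a vector is
determined by its inner products. -/
lemma isWeakGradX_iff (hφ : MemL2Loc φ) : IsWeakGradX φ g ↔
    LocallyIntegrable g ∧ ∀ e : Space n, IsWeakDir (e, 0) φ (fun z => inner ℝ (g z) e) := by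
  refine and_congr_right fun hg => ?_
  have hi1 : ∀ η : SpaceTime n β → ℝ, IsTest η → Integrable (fun z => φ z • gradX η z) := fun η hη =>
    hφ.locallyIntegrable.integrable_smul_right_of_hasCompactSupport hη.continuous_gradX
      hη.hasCompactSupport_gradX
  have hi2 : ∀ η : SpaceTime n β → ℝ, IsTest η → Integrable (fun z => η z • g z) := fun η hη =>
    hg.integrable_smul_left_of_hasCompactSupport hη.continuous hη.2
  have key : ∀ η : SpaceTime n β → ℝ, IsTest η → ∀ e : Space n,
      (inner ℝ e (∫ z, φ z • gradX η z) = ∫ z, φ z * dirDeriv (e, 0) η z ∧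
      inner ℝ e (- ∫ z, η z • g z) = - ∫ z, η z * inner ℝ (g z) e) := by
    intro η hη e
    rw [inner_neg_right, ← integral_inner (hi1 η hη), ← integral_inner (hi2 η hη)]
    simp only [inner_smul_right, ← real_inner_comm _ e, ← inner_gradX hη]
    exact ⟨trivial, trivial⟩
  constructor
  · intro H e η hη
    rw [← (key η hη e).1, ← (key η hη e).2, H η hη]
  · intro H η hη
    refine ext_inner_left ℝ fun e => ?_
    rw [(key η hη e).1, (key η hη e).2, H e η hη]

lemma isWeakDTau_iff : IsWeakDTau φ h ↔ LocallyIntegrable h ∧ IsWeakDir (0, 1) φ h := by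
  refine and_congr_right fun _ => ?_
  simp only [IsWeakDir, dTau_eq]

lemma HasWGrad.isWeakGradX (H : HasWGrad φ g h) : IsWeakGradX φ g :=
  (isWeakGradX_iff H.memφ).2 ⟨H.memg.locallyIntegrable, fun e => by
    exact (H.weak (e, 0)).congr (EventuallyEq.refl _ _)
      (g' := fun z => inner ℝ (g z) e) (ae_of_all _ fun z => by simp [Bounce.dirOf])⟩

lemma HasWGrad.isWeakDTau (H : HasWGrad φ g h) : IsWeakDTau φ h :=
  isWeakDTau_iff.2 ⟨H.memh.locallyIntegrable, (H.weak (0, 1)).congr (EventuallyEq.refl _ _)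
    (ae_of_all _ fun z => by simp [Bounce.dirOf])⟩

lemma HasWGrad.of_isWeak (hφ : MemL2Loc φ) (hg : MemL2Loc g) (hh : MemL2Loc h)
    (h1 : IsWeakGradX φ g) (h2 : IsWeakDTau φ h) : HasWGrad φ g h := by
  refine ⟨hφ, hg, hh, fun v => ?_⟩
  have h3 := ((isWeakGradX_iff hφ).1 h1).2 v.1
  have h4 := ((isWeakDTau_iff.1 h2).2).smul_dir v.2
  have h5 := h3.comb hφ.locallyIntegrable (hg.inner_const v.1).locallyIntegrable
    (hh.locallyIntegrable.smul v.2) h4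
  have h6 : ((v.1, 0) : Space n × ℝ) + v.2 • (0, 1) = v := by ext <;> simp
  rw [h6] at h5
  refine h5.congr (EventuallyEq.refl _ _) (ae_of_all _ fun z => ?_)
  simp [Bounce.dirOf, mul_comm]

lemma isWeakGradX_ae_unique (hφ : MemL2Loc φ) (h1 : IsWeakGradX φ g) (h2 : IsWeakGradX φ g') :
    g =ᵐ[volume] g' := by
  rw [isWeakGradX_iff hφ] at h1 h2
  have hl : ∀ {k : SpaceTime n β → Space n}, LocallyIntegrable k → ∀ e : Space n,
      LocallyIntegrable (fun z => inner ℝ (k z) e) := fun {k} hk e => by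
    rw [locallyIntegrable_iff] at hk ⊢
    exact fun K hK => (hk K hK).inner_const e
  have h3 : ∀ i : Fin n, ∀ᵐ z, g z i = g' z i := fun i => by
    have := (h1.2 (EuclideanSpace.single i 1)).ae_unique (hl h1.1 _) (hl h2.1 _) (h2.2 _)
    filter_upwards [this] with z hz
    simpa [EuclideanSpace.inner_single_right] using hz
  filter_upwards [ae_all_iff.2 h3] with z hz
  ext i; exact hz i

lemma HasWGrad.isW12Loc (H : HasWGrad φ g h) : IsW12Loc φ :=
  ⟨H.memφ, ⟨g, H.isWeakGradX, H.memg⟩, ⟨h, H.isWeakDTau, H.memh⟩⟩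

lemma HasWGrad.weakGradX_ae (H : HasWGrad φ g h) : weakGradX φ =ᵐ[volume] g := by
  have hex : ∃ g, IsWeakGradX φ g := ⟨g, H.isWeakGradX⟩
  rw [weakGradX, dif_pos hex]
  exact isWeakGradX_ae_unique H.memφ hex.choose_spec H.isWeakGradX

lemma HasWGrad.weakDTau_ae (H : HasWGrad φ g h) : weakDTau φ =ᵐ[volume] h := by
  have hex : ∃ h, IsWeakDTau φ h := ⟨h, H.isWeakDTau⟩
  rw [weakDTau, dif_pos hex]
  have h1 := isWeakDTau_iff.1 hex.choose_spec
  have h2 := isWeakDTau_iff.1 H.isWeakDTau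
  exact h1.2.ae_unique h1.1 h2.1 h2.2

lemma HasWGrad.congr (H : HasWGrad φ g h) (hφ : φ =ᵐ[volume] ψ) (hg : g =ᵐ[volume] g')
    (hh : h =ᵐ[volume] h') : HasWGrad ψ g' h' := by
  refine ⟨H.memφ.congr hφ, H.memg.congr hg, H.memh.congr hh, fun v => (H.weak v).congr hφ ?_⟩
  filter_upwards [hg, hh] with z h1 h2
  simp [Bounce.dirOf, h1, h2]

/-- The derivatives picked by choice agree a.e. with any other weak derivatives, hence inherit the
local square integrability of the given ones. -/
lemma IsW12Loc.hasWGrad (H : IsW12Loc φ) : HasWGrad φ (weakGradX φ) (weakDTau φ) := by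
  obtain ⟨hφ, ⟨g, hg, hg2⟩, ⟨h, hh, hh2⟩⟩ := H
  have h1 := HasWGrad.of_isWeak hφ hg2 hh2 hg hh
  exact h1.congr (EventuallyEq.refl _ _) h1.weakGradX_ae.symm h1.weakDTau_ae.symm

lemma HasWGrad.add (H : HasWGrad φ g h) (H' : HasWGrad ψ g' h') :
    HasWGrad (fun z => φ z + ψ z) (fun z => g z + g' z) (fun z => h z + h' z) := by
  refine ⟨H.memφ.add H'.memφ, H.memg.add H'.memg, H.memh.add H'.memh, fun v => ?_⟩
  refine ((H.weak v).add H.memφ.locallyIntegrable H'.memφ.locallyIntegrable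
    (H.memDir v).locallyIntegrable (H'.memDir v).locallyIntegrable (H'.weak v)).congr
    (EventuallyEq.refl _ _) (ae_of_all _ fun z => ?_)
  simp only [Bounce.dirOf, inner_add_left]; ring

lemma HasWGrad.const_mul (c : ℝ) (H : HasWGrad φ g h) :
    HasWGrad (fun z => c * φ z) (fun z => c • g z) (fun z => c * h z) := by
  refine ⟨H.memφ.bdd_mul (m := fun _ => c) aestronglyMeasurable_const (fun _ => le_rfl),
    H.memg.bdd_mul (m := fun _ => c) aestronglyMeasurable_const (fun _ => le_rfl),
    H.memh.bdd_mul (m := fun _ => c) aestronglyMeasurable_const (fun _ => le_rfl), fun v => ?_⟩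
  refine ((H.weak v).const_mul c).congr (EventuallyEq.refl _ _) (ae_of_all _ fun z => ?_)
  simp only [Bounce.dirOf, inner_smul_left]; simp; ring

lemma HasWGrad.comp_add (H : HasWGrad φ g h) (a : SpaceTime n β) :
    HasWGrad (fun z => φ (z + a)) (fun z => g (z + a)) (fun z => h (z + a)) :=
  ⟨H.memφ.comp_add a, H.memg.comp_add a, H.memh.comp_add a, fun v => (H.weak v).comp_add a⟩

lemma IsTest.hasWGrad {η : SpaceTime n β → ℝ} (hη : IsTest η) :
    HasWGrad η (gradX η) (Bounce.dTau η) :=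
  ⟨hη.memL2Loc, hη.memL2Loc_gradX, hη.dTau.memL2Loc, fun v =>
    (hη.isWeakDir v).congr (EventuallyEq.refl _ _)
      (ae_of_all _ fun z => by simp [Bounce.dirOf, dirDeriv_eq hη])⟩

lemma HasWGrad.test_mul {η : SpaceTime n β → ℝ} (hη : IsTest η) (H : HasWGrad φ g h) :
    HasWGrad (fun z => η z * φ z) (fun z => η z • g z + φ z • gradX η z)
      (fun z => η z * h z + φ z * Bounce.dTau η z) := by
  obtain ⟨C, hC0, hC⟩ := hη.exists_bound
  obtain ⟨C', hC'⟩ := hη.hasCompactSupport_gradX.exists_bound_of_continuous hη.continuous_gradX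
  have m1 : MemL2Loc (fun z => φ z • gradX η z) := by
    refine H.memφ.of_le_mul (C := C') (H.memφ.aestronglyMeasurable.smul
      hη.continuous_gradX.aestronglyMeasurable) (ae_of_all _ fun z => ?_)
    rw [norm_smul, mul_comm]
    exact mul_le_mul_of_nonneg_right (hC' z) (norm_nonneg _)
  have m2 : MemL2Loc (fun z => φ z * Bounce.dTau η z) := by
    simpa only [mul_comm] using (H.memφ.test_mul hη.dTau).memL2Loc
  refine ⟨(H.memφ.test_mul hη).memL2Loc, (H.memg.test_smul hη).memL2Loc.add m1,
    (H.memh.test_mul hη).memL2Loc.add m2, fun v => ?_⟩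
  refine ((H.weak v).test_mul H.memφ.locallyIntegrable (H.memDir v).locallyIntegrable hη).congr
    (EventuallyEq.refl _ _) (ae_of_all _ fun z => ?_)
  simp only [Bounce.dirOf, dirDeriv_eq hη, inner_add_left, inner_smul_left]
  simp; ring

open Classical in
lemma HasWGrad.posPart (H : HasWGrad φ g h) : HasWGrad (fun z => max (φ z) 0)
    (fun z => if 0 < φ z then g z else 0) (fun z => if 0 < φ z then h z else 0) := by
  have hmφ := H.memφ.aestronglyMeasurable
  have hs : NullMeasurableSet {z | 0 < φ z} := nullMeasurableSet_lt aemeasurable_const hmφ.aemeasurable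
  have hite : ∀ {F : Type} [NormedAddCommGroup F] {k : SpaceTime n β → F}, MemL2Loc k →
      MemL2Loc (fun z => if 0 < φ z then k z else 0) := fun {F} _ {k} hk => by
    refine hk.of_le_mul (C := 1) ?_ (ae_of_all _ fun z => ?_)
    · exact hk.aestronglyMeasurable.indicator₀ hs
    · split_ifs <;> simp
  refine ⟨?_, hite H.memg, hite H.memh, fun v => ?_⟩
  · refine H.memφ.of_le_mul (C := 1) ((continuous_id.max continuous_const).comp_aestronglyMeasurable
      hmφ) (ae_of_all _ fun z => ?_)
    simp only [one_mul, Real.norm_eq_abs]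
    rw [abs_of_nonneg (le_max_right _ _)]
    exact max_le (le_abs_self _) (abs_nonneg _)
  · refine ((H.weak v).posPart H.memφ (H.memDir v)).congr (EventuallyEq.refl _ _)
      (ae_of_all _ fun z => ?_)
    simp only [Bounce.dirOf]
    split_ifs <;> simp

end HasWGrad

lemma MemL2Loc.memLp_of_hasCompactSupport {f : SpaceTime n β → ℝ} (hf : MemL2Loc f)
    (hfc : HasCompactSupport f) : MemLp f 2 := by
  obtain ⟨χ, hχ, -, -, hχ1⟩ := exists_cutoff hfc
  have h1 : (fun z => χ z * f z) = f := by
    funext z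
    by_cases hz : z ∈ tsupport f
    · rw [hχ1 z hz, one_mul]
    · rw [image_eq_zero_of_notMem_tsupport hz, mul_zero]
  rw [← h1]
  exact hf.test_mul hχ

/-! ### Mollifying sequences -/

section mollification

/-- A sequence of mollifiers with supports shrinking to the origin. -/
structure IsMollifierSeq (ρ : ℕ → SpaceTime n β → ℝ) : Prop where
  isTest : ∀ k, IsTest (ρ k)
  nonneg : ∀ k z, 0 ≤ ρ k z
  integral_eq : ∀ k, ∫ z, ρ k z = 1
  small : ∀ (k : ℕ) z, ρ k z ≠ 0 → ‖z‖ < 1 / ((k : ℝ) + 1)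

lemma exists_mollifierSeq : ∃ ρ : ℕ → SpaceTime n β → ℝ, IsMollifierSeq ρ := by
  choose ρ h1 h2 h3 h4 using fun k : ℕ =>
    exists_mollifier (n := n) (β := β) (ε := 1 / ((k : ℝ) + 1)) (by positivity)
  exact ⟨ρ, h1, h2, h3, h4⟩

variable {ρ : ℕ → SpaceTime n β → ℝ} {f : SpaceTime n β → ℝ}

lemma IsMollifierSeq.tendsto_l2 (hρ : IsMollifierSeq ρ) (hf : MemLp f 2)
    (hc : HasCompactSupport f) :
    Tendsto (fun k => l2 (fun z => conv (ρ k) f z - f z)) atTop (𝓝 0) := by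
  rw [Metric.tendsto_atTop]
  intro ε hε
  obtain ⟨δ, hδ, h⟩ := l2_conv_sub_le hf hc (half_pos hε)
  obtain ⟨N, hN⟩ := eventually_atTop.1
    (tendsto_one_div_add_atTop_nhds_zero_nat (𝕜 := ℝ) |>.eventually_lt_const hδ)
  refine ⟨N, fun k hk => ?_⟩
  rw [Real.dist_eq, sub_zero, abs_of_nonneg (l2_nonneg _)]
  refine (h (ρ k) (hρ.isTest k) (hρ.nonneg k) (hρ.integral_eq k) fun z hz => ?_).trans_lt
    (half_lt_self hε)
  exact (hρ.small k z hz).trans (hN k hk)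

lemma IsMollifierSeq.isTest_conv (hρ : IsMollifierSeq ρ) (hf : MemLp f 2)
    (hc : HasCompactSupport f) (k : ℕ) : IsTest (conv (ρ k) f) :=
  Bounce.isTest_conv (hρ.isTest k) (hf.locallyIntegrable (by norm_num)) hc

lemma IsMollifierSeq.conv_eq_zero (hρ : IsMollifierSeq ρ) (k : ℕ) {z : SpaceTime n β}
    (hz : z ∉ Metric.cthickening 1 (tsupport f)) : conv (ρ k) f z = 0 := by
  refine integral_eq_zero_of_ae (ae_of_all _ fun w => ?_)
  by_contra hw
  have h1 := hρ.small k _ (right_ne_zero_of_mul hw)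
  have h2 : w ∈ tsupport f := subset_tsupport _ (left_ne_zero_of_mul hw)
  refine hz (Metric.mem_cthickening_of_dist_le z w _ _ h2 ?_)
  rw [dist_eq_norm]
  refine h1.le.trans ?_
  rw [div_le_one (by positivity)]
  linarith [(Nat.cast_nonneg k : (0:ℝ) ≤ k)]

lemma IsMollifierSeq.tendsto_l2_norm (hρ : IsMollifierSeq ρ) (hf : MemLp f 2)
    (hc : HasCompactSupport f) : Tendsto (fun k => l2 (conv (ρ k) f)) atTop (𝓝 (l2 f)) := by
  rw [tendsto_iff_norm_sub_tendsto_zero]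
  refine squeeze_zero (fun k => norm_nonneg _) (fun k => ?_) (hρ.tendsto_l2 hf hc)
  have hm := (hρ.isTest_conv hf hc k).memLp 2
  have h1 := l2_add_le (hm.sub hf) hf
  have h2 := l2_add_le (hm.sub hf).neg hm
  simp only [Pi.sub_apply, sub_add_cancel] at h1
  have h3 : (fun z => (-(conv (ρ k) f - f)) z + conv (ρ k) f z) = f := by
    ext z; simp
  rw [h3] at h2
  have h4 : l2 (-(conv (ρ k) f - f)) = l2 (conv (ρ k) f - f) := by
    have := l2_const_mul (-1) (conv (ρ k) f - f)
    rw [abs_neg, abs_one, one_mul] at this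
    rw [← this]; congr 1; ext z; simp
  rw [h4] at h2
  change |l2 (conv (ρ k) f) - l2 f| ≤ l2 (conv (ρ k) f - f)
  rw [abs_le]
  constructor
  · linarith
  · have h1 : l2 (conv (ρ k) f) ≤ l2 (conv (ρ k) f - f) + l2 f := h1
    linarith

/-- All mollifications live in the 1-thickening of the support of f, so b may be cut off to an L²
function; then strong convergence suffices. -/
lemma IsMollifierSeq.tendsto_integral (hρ : IsMollifierSeq ρ) (hf : MemLp f 2)
    (hc : HasCompactSupport f) {b : SpaceTime n β → ℝ} (hb : MemL2Loc b) :
    Tendsto (fun k => ∫ z, conv (ρ k) f z * b z) atTop (𝓝 (∫ z, f z * b z)) := by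
  obtain ⟨χ, hχ, -, -, hχ1⟩ := exists_cutoff (IsCompact.cthickening hc (r := 1))
  have hbm := hb.test_mul hχ
  have e1 : ∀ k, ∫ z, conv (ρ k) f z * b z = ∫ z, conv (ρ k) f z * (χ z * b z) := fun k => by
    congr 1; ext z
    by_cases hz : z ∈ Metric.cthickening 1 (tsupport f)
    · rw [hχ1 z hz, one_mul]
    · rw [hρ.conv_eq_zero k hz, zero_mul, zero_mul]
  have e2 : ∫ z, f z * b z = ∫ z, f z * (χ z * b z) := by
    congr 1; ext z
    by_cases hz : z ∈ tsupport f
    · rw [hχ1 z (Metric.self_subset_cthickening _ hz), one_mul]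
    · rw [image_eq_zero_of_notMem_tsupport hz, zero_mul, zero_mul]
  simp only [e1, e2]
  rw [tendsto_iff_norm_sub_tendsto_zero]
  have h1 := (hρ.tendsto_l2 hf hc).mul_const (l2 (fun z => χ z * b z))
  rw [zero_mul] at h1
  refine squeeze_zero (fun k => norm_nonneg _) (fun k => ?_) h1
  have hm := (hρ.isTest_conv hf hc k).memLp 2
  have i1 : Integrable (fun z => conv (ρ k) f z * (χ z * b z)) := hm.integrable_mul hbm
  have i2 : Integrable (fun z => f z * (χ z * b z)) := hf.integrable_mul hbm
  rw [← integral_sub i1 i2]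
  simp only [← sub_mul]
  exact abs_integral_mul_le (hm.sub hf) hbm

end mollification

/-! ### Enlarging the class of test functions -/

section weakEquation
variable {θ : SpaceTime n β → ℝ} {g : SpaceTime n β → Space n} {h : SpaceTime n β → ℝ}

/-- A weak equation tested with smooth functions may be tested with compactly supported functions in
`W^{1,2}`. -/
lemma weakEquation_extend {a : SpaceTime n β → Space n} {b c : SpaceTime n β → ℝ}
    (ha : MemL2Loc a) (hb : MemL2Loc b) (hc : MemL2Loc c)
    (hE : ∀ η, IsTest η → ∫ z, (dTau η z * b z + inner ℝ (gradX η z) (a z) + η z * c z) = 0)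
    (H : HasWGrad θ g h) (hθ : HasCompactSupport θ) (hgc : HasCompactSupport g)
    (hhc : HasCompactSupport h) :
    ∫ z, (h z * b z + inner ℝ (g z) (a z) + θ z * c z) = 0 := by
  obtain ⟨ρ, hρ⟩ := exists_mollifierSeq (n := n) (β := β)
  have hθm := H.memφ.memLp_of_hasCompactSupport hθ
  have hhm := H.memh.memLp_of_hasCompactSupport hhc
  let e : Fin n → Space n := fun i => EuclideanSpace.single i 1
  have hgi : ∀ (k : SpaceTime n β → Space n) i z, inner ℝ (k z) (e i) = k z i := fun k i z => by
    simp [e, EuclideanSpace.inner_single_right]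
  have hgim : ∀ {k : SpaceTime n β → Space n}, MemL2Loc k → ∀ i, MemL2Loc (fun z => k z i) :=
    fun {k} hk i => by simpa only [hgi] using hk.inner_const (e i)
  have hgic : ∀ i, HasCompactSupport (fun z => g z i) := fun i =>
    hgc.comp_left (g := fun x : Space n => x i) rfl
  have hgil : ∀ i, MemLp (fun z => g z i) 2 := fun i => (hgim H.memg i).memLp_of_hasCompactSupport (hgic i)
  have hθl := H.memφ.locallyIntegrable
  -- Mollifications of θ are admissible test functions, and their classical derivatives are the
  -- mollified weak derivatives; each term of the equation then converges, coordinate by coordinate.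
  have hT : ∀ k, IsTest (conv (ρ k) θ) := hρ.isTest_conv hθm hθ
  have hd1 : ∀ k z, dTau (conv (ρ k) θ) z = conv (ρ k) h z := fun k z => by
    rw [dTau_eq]
    exact dirDeriv_conv_of_isWeakDir (hρ.isTest k) hθl (isWeakDTau_iff.1 H.isWeakDTau).2 z
  have hd2 : ∀ k i z, gradX (conv (ρ k) θ) z i = conv (ρ k) (fun z => g z i) z := fun k i z => by
    rw [gradX_apply (hT k)]
    refine dirDeriv_conv_of_isWeakDir (hρ.isTest k) hθl ?_ z
    have := ((isWeakGradX_iff H.memφ).1 H.isWeakGradX).2 (e i)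
    simpa only [hgi] using this
  have hin : ∀ x y : Space n, inner ℝ x y = ∑ i, x i * y i := fun x y => by
    rw [PiLp.inner_apply]; simp [mul_comm]
  have split : ∀ {u₁ u₃ : SpaceTime n β → ℝ} {u₂ : SpaceTime n β → Space n}, MemLp u₁ 2 →
      HasCompactSupport u₁ → (∀ i, MemLp (fun z => u₂ z i) 2) →
      (∀ i, HasCompactSupport (fun z => u₂ z i)) → MemLp u₃ 2 → HasCompactSupport u₃ →
      ∫ z, (u₁ z * b z + inner ℝ (u₂ z) (a z) + u₃ z * c z) =
      (∫ z, u₁ z * b z) + ∑ i, (∫ z, u₂ z i * a z i) + ∫ z, u₃ z * c z := by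
    intro u₁ u₃ u₂ h1 h1c h2 h2c h3 h3c
    have li : ∀ {u b : SpaceTime n β → ℝ}, MemLp u 2 → HasCompactSupport u → MemL2Loc b →
        Integrable (fun z => u z * b z) := by
      intro u b hu huc hb
      obtain ⟨χ, hχ, -, -, hχ1⟩ := exists_cutoff huc
      refine (hu.integrable_mul (hb.test_mul hχ)).congr (ae_of_all _ fun z => ?_)
      by_cases hz : z ∈ tsupport u
      · simp [hχ1 z hz]
      · simp [image_eq_zero_of_notMem_tsupport hz]
    have i2 : ∀ i, Integrable (fun z => u₂ z i * a z i) := fun i => li (h2 i) (h2c i) (hgim ha i)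
    simp only [hin]
    rw [integral_add, integral_add (li h1 h1c hb), integral_finsetSum _ fun i _ => i2 i]
    · exact integrable_finsetSum _ fun i _ => i2 i
    · exact (li h1 h1c hb).add (integrable_finsetSum _ fun i _ => i2 i)
    · exact li h3 h3c hc
  have hk : ∀ k, (∫ z, conv (ρ k) h z * b z) + ∑ i, (∫ z, conv (ρ k) (fun z => g z i) z * a z i)
      + ∫ z, conv (ρ k) θ z * c z = 0 := fun k => by
    rw [← hE _ (hT k)]
    symm
    simp only [← hd2, ← hd1]
    refine split ((hT k).dTau.memLp 2) (hT k).dTau.2 (fun i => ?_) (fun i => ?_) ((hT k).memLp 2)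
      (hT k).2
    · simp only [gradX_apply (hT k)]; exact ((hT k).dirDeriv _).memLp 2
    · simp only [gradX_apply (hT k)]; exact ((hT k).dirDeriv _).2
  rw [split hhm hhc hgil hgic hθm hθ]
  have hl := ((hρ.tendsto_integral hhm hhc hb).add (tendsto_finsetSum Finset.univ fun i _ =>
    hρ.tendsto_integral (hgil i) (hgic i) (hgim ha i))).add (hρ.tendsto_integral hθm hθ hc)
  simp only [hk] at hl
  exact (tendsto_nhds_unique hl tendsto_const_nhds)

end weakEquation

/-! ### The Sobolev inequality on the cylinder -/

section sobolev

/-- A strip of m periods is a union of m fundamental domains, each mapped to the cylinder preserving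
measure. -/
lemma map_proj_strip_le (m : ℕ) (a : ℝ) :
    ((volume : Measure (Space n × ℝ)).restrict (univ ×ˢ Ioc a (a + m * β))).map
      (proj : Space n × ℝ → SpaceTime n β) ≤ (m : ℝ≥0∞) • volume := by
  have hβ : 0 < β := Fact.out
  have hm : Measurable (proj : Space n × ℝ → SpaceTime n β) := continuous_proj.measurable
  rw [Measure.le_iff]
  intro s hs
  rw [Measure.map_apply hm hs, Measure.restrict_apply (hm hs)]
  have hsub : proj ⁻¹' s ∩ univ ×ˢ Ioc a (a + m * β) ⊆ ⋃ j ∈ Finset.range m,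
      (proj ⁻¹' s ∩ univ ×ˢ Ioc (a + j * β) (a + j * β + β) : Set (Space n × ℝ)) := by
    rintro p ⟨hp, -, hp2⟩
    simp only [mem_iUnion, Finset.mem_range, exists_prop]
    obtain ⟨h1, h2⟩ := hp2
    have h3 : 0 < (p.2 - a) / β := div_pos (by linarith) hβ
    have h4 : (p.2 - a) / β ≤ m := by rw [div_le_iff₀ hβ]; linarith
    set j := ⌈(p.2 - a) / β⌉₊ with hj
    have hj1 : 0 < j := Nat.ceil_pos.2 h3
    have hj2 : j ≤ m := Nat.ceil_le.2 h4
    have hj3 : (p.2 - a) / β ≤ j := Nat.le_ceil _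
    have hj4 : (j : ℝ) < (p.2 - a) / β + 1 := Nat.ceil_lt_add_one h3.le
    have e : ((j - 1 : ℕ) : ℝ) = j - 1 := by rw [Nat.cast_sub hj1]; simp
    -- The periods are open on the left and closed on the right, so the index is the ceiling minus
    -- one.
    refine ⟨j - 1, by omega, hp, trivial, ?_, ?_⟩
    · rw [e]
      have : (j - 1 : ℝ) < (p.2 - a) / β := by linarith
      rw [lt_div_iff₀ hβ] at this
      linarith
    · rw [e]
      rw [div_le_iff₀ hβ] at hj3
      linarith
  refine (measure_mono hsub).trans ((measure_biUnion_finset_le _ _).trans ?_)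
  have hj : ∀ j ∈ Finset.range m, volume
      (proj ⁻¹' s ∩ univ ×ˢ Ioc (a + j * β) (a + j * β + β) : Set (Space n × ℝ)) ≤
        (volume : Measure (SpaceTime n β)) s := by
    intro j _
    have hmp : MeasurePreserving (proj : Space n × ℝ → SpaceTime n β)
        ((volume : Measure (Space n)).prod
          ((volume : Measure ℝ).restrict (Ioc (a + j * β) (a + j * β + β)))) volume :=
      (MeasurePreserving.id volume).prod (AddCircle.measurePreserving_mk β (a + j * β))
    have := hmp.measure_preimage hs.nullMeasurableSet
    rw [← this, ← Measure.restrict_apply (hm hs), Measure.volume_eq_prod, ← Measure.prod_restrict,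
      Measure.restrict_univ]
  refine (Finset.sum_le_sum hj).trans ?_
  simp

/-- The sum of the `L²` norms of a function and its first derivatives. -/
noncomputable def h1norm (f : SpaceTime n β → ℝ) (g : SpaceTime n β → Space n)
    (h : SpaceTime n β → ℝ) : ℝ := l2 f + (∑ i, l2 (fun z => g z i)) + l2 h

lemma norm_le_sum_abs (x : Space n) : ‖x‖ ≤ ∑ i, |x i| := by
  have h1 : x = ∑ i, EuclideanSpace.single i (x i) := by
    ext j
    simp [Finset.sum_apply, Pi.single_apply]
  calc ‖x‖ = ‖∑ i, EuclideanSpace.single i (x i)‖ := by rw [← h1]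
    _ ≤ ∑ i, ‖EuclideanSpace.single i (x i)‖ := norm_sum_le _ _
    _ = _ := by simp

/-- The pointwise majorant of the gradient of a test function multiplied by a cutoff. -/
noncomputable def majorant (M : ℝ) (η : SpaceTime n β → ℝ) (z : SpaceTime n β) : ℝ :=
  M * |η z| + ∑ i, |gradX η z i| + |dTau η z|

lemma l2_majorant_le {η : SpaceTime n β → ℝ} (hη : IsTest η) {M : ℝ} (hM0 : 0 ≤ M) :
    MemLp (majorant M η) 2 ∧ l2 (majorant M η) ≤ (M + 1) * h1norm η (gradX η) (dTau η) := by
  classical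
  have hg : ∀ i, MemLp (fun z => |gradX η z i|) 2 := fun i => by
    simp only [gradX_apply hη]; exact ((hη.dirDeriv _).memLp 2).abs
  have habs : ∀ f : SpaceTime n β → ℝ, l2 (fun z => |f z|) = l2 f := fun f => by
    simp only [l2, ← Real.norm_eq_abs, eLpNorm_norm]
  have hs : ∀ s : Finset (Fin n), MemLp (fun z => ∑ i ∈ s, |gradX η z i|) 2 ∧
      l2 (fun z => ∑ i ∈ s, |gradX η z i|) ≤ ∑ i ∈ s, l2 (fun z => gradX η z i) := by
    intro s
    induction s using Finset.induction_on with
    | empty => simp [l2]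
    | insert i s hi ih =>
      simp only [Finset.sum_insert hi]
      refine ⟨(hg i).add ih.1, (l2_add_le (hg i) ih.1).trans ?_⟩
      exact add_le_add (habs _).le ih.2
  obtain ⟨hs1, hs2⟩ := hs Finset.univ
  have h1 : MemLp (fun z => M * |η z|) 2 := (hη.memLp 2).abs.const_mul M
  have h2 : MemLp (fun z => |dTau η z|) 2 := (hη.dTau.memLp 2).abs
  have h12 : MemLp (fun z => M * |η z| + ∑ i, |gradX η z i|) 2 := h1.add hs1
  refine ⟨h12.add h2, ?_⟩
  have h3 : l2 (majorant M η) ≤ _ := l2_add_le h12 h2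
  have h4 := l2_add_le h1 hs1
  have h5 : l2 (fun z => M * |η z|) = M * l2 η := by
    rw [l2_const_mul, habs, abs_of_nonneg hM0]
  rw [habs (dTau η)] at h3
  rw [h5] at h4
  refine h3.trans ((add_le_add (h4.trans (add_le_add le_rfl hs2)) le_rfl).trans ?_)
  have p1 := l2_nonneg η
  have p2 : 0 ≤ ∑ i, l2 (fun z => gradX η z i) := Finset.sum_nonneg fun _ _ => l2_nonneg _
  have p3 := l2_nonneg (dTau η)
  simp only [h1norm]
  nlinarith [mul_nonneg hM0 p2, mul_nonneg hM0 p3]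

-- The product rule: |χ| ≤ 1 leaves the derivatives of η, and |χ'| ≤ M contributes M |η|. Outside
-- the strip both χ and χ' vanish.
omit [Fact (0 < β)] in
lemma norm_fderiv_cutoff_le {η : SpaceTime n β → ℝ} (hη : IsTest η) (χ : ContDiffBump (0 : ℝ))
    {M : ℝ} (hM : ∀ t, ‖fderiv ℝ χ t‖ ≤ M) (hM0 : 0 ≤ M) {strip : Set (Space n × ℝ)}
    (hχs : ∀ p : Space n × ℝ, p ∉ strip → p.2 ∉ tsupport χ) (p : Space n × ℝ) :
    ‖fderiv ℝ (fun p : Space n × ℝ => χ p.2 * η (proj p)) p‖ ≤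
      ‖strip.indicator (fun p => majorant M η (proj p)) p‖ := by
  have hF0 : ∀ z, 0 ≤ majorant M η z := fun z => by
    have : 0 ≤ ∑ i, |gradX η z i| := Finset.sum_nonneg fun _ _ => abs_nonneg _
    unfold majorant
    positivity
  have d1 : HasFDerivAt (fun p : Space n × ℝ => χ p.2)
      ((fderiv ℝ χ p.2).comp (ContinuousLinearMap.snd ℝ (Space n) ℝ)) p :=
    ((χ.contDiff (n := 1)).differentiable one_ne_zero p.2).hasFDerivAt.comp p hasFDerivAt_snd
  have d2 := (hη.contDiff.differentiable (by simp) p).hasFDerivAt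
  have d3 := d1.mul d2
  have d4 : fderiv ℝ (fun p : Space n × ℝ => χ p.2 * η (proj p)) p = _ := d3.fderiv
  by_cases hp : p ∈ strip
  · rw [indicator_of_mem hp, Real.norm_of_nonneg (hF0 _)]
    refine ContinuousLinearMap.opNorm_le_bound _ (hF0 _) fun v => ?_
    rw [d4]
    simp only [add_apply, smul_apply, smul_eq_mul,
      ContinuousLinearMap.comp_apply, ContinuousLinearMap.coe_snd', Function.comp_apply]
    rw [← hη.dirDeriv_proj, dirDeriv_eq hη]
    have hv1 : ‖v.1‖ ≤ ‖v‖ := norm_fst_le v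
    have hv2 : |v.2| ≤ ‖v‖ := norm_snd_le v
    have b1 : |fderiv ℝ χ p.2 v.2| ≤ M * ‖v‖ :=
      ((fderiv ℝ χ p.2).le_opNorm v.2).trans
        (mul_le_mul (hM _) hv2 (norm_nonneg _) hM0)
    have b2 : |inner ℝ (gradX η (proj p)) v.1| ≤ (∑ i, |gradX η (proj p) i|) * ‖v‖ :=
      (abs_real_inner_le_norm _ _).trans (mul_le_mul (norm_le_sum_abs _) hv1 (norm_nonneg _)
        (Finset.sum_nonneg fun _ _ => abs_nonneg _))
    have b3 : |dTau η (proj p) * v.2| ≤ |dTau η (proj p)| * ‖v‖ := by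
      rw [abs_mul]; exact mul_le_mul_of_nonneg_left hv2 (abs_nonneg _)
    have b4 : |χ p.2| ≤ 1 := by rw [abs_of_nonneg χ.nonneg]; exact χ.le_one
    calc ‖χ p.2 * (inner ℝ (gradX η (proj p)) v.1 + dTau η (proj p) * v.2)
          + η (proj p) * fderiv ℝ χ p.2 v.2‖
        ≤ |χ p.2| * (|inner ℝ (gradX η (proj p)) v.1| + |dTau η (proj p) * v.2|)
          + |η (proj p)| * |fderiv ℝ χ p.2 v.2| := by
          refine (norm_add_le _ _).trans ?_
          rw [norm_mul, norm_mul]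
          exact add_le_add (mul_le_mul_of_nonneg_left (norm_add_le _ _) (abs_nonneg _)) le_rfl
      _ ≤ 1 * ((∑ i, |gradX η (proj p) i|) * ‖v‖ + |dTau η (proj p)| * ‖v‖)
          + |η (proj p)| * (M * ‖v‖) := by gcongr
      _ = majorant M η (proj p) * ‖v‖ := by simp only [majorant]; ring
  · have h1 := hχs p hp
    rw [indicator_of_notMem hp, norm_zero, norm_le_zero_iff, d4]
    have e1 : χ p.2 = 0 := image_eq_zero_of_notMem_tsupport h1
    have e2 : fderiv ℝ χ p.2 = 0 := by
      refine image_eq_zero_of_notMem_tsupport fun h => h1 ?_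
      exact tsupport_fderiv_subset ℝ h
    rw [e1, e2]; simp

variable (n β) in
/-- The Sobolev inequality for test functions. -/
lemma exists_sobolev_test {N : ℝ≥0} (hN : (N : ℝ)⁻¹ = 2⁻¹ - ((n : ℝ) + 1)⁻¹) :
    ∃ C : ℝ, 0 ≤ C ∧ ∀ η : SpaceTime n β → ℝ, IsTest η →
      eLpNorm η N volume ≤ ENNReal.ofReal (C * h1norm η (gradX η) (dTau η)) := by
  have hβ : 0 < β := Fact.out
  -- Equal to 1 on [-β, β], which contains the period (0, β], and supported in [-2β, 2β], which lies
  -- in the five-period strip (-3β, 2β]; the left end is pushed to -3β because the strip is open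
  -- there.
  let χ : ContDiffBump (0 : ℝ) := ⟨β, 2 * β, hβ, by linarith⟩
  obtain ⟨M, hM⟩ := (χ.hasCompactSupport.fderiv (𝕜 := ℝ)).exists_bound_of_continuous
    ((χ.contDiff (n := 1)).continuous_fderiv one_ne_zero)
  have hM0 : 0 ≤ M := (norm_nonneg _).trans (hM 0)
  set S : ℝ≥0 := SNormLESNormFDerivOfEqConst ℝ (volume : Measure (Space n × ℝ)) 2 with hS
  set C : ℝ := S * (5 ^ (1 / 2 : ℝ)) * (M + 1) with hC
  refine ⟨C, by positivity, fun η hη => ?_⟩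
  let u : Space n × ℝ → ℝ := fun p => χ p.2 * η (proj p)
  have hu : ContDiff ℝ 1 u := ((χ.contDiff (n := 1)).comp contDiff_snd).mul
    (hη.contDiff.of_le (by exact_mod_cast le_top))
  have hK : IsCompact ((Prod.fst '' tsupport η) ×ˢ tsupport χ) :=
    (IsCompact.image hη.2 continuous_fst).prod χ.hasCompactSupport
  have huc : HasCompactSupport u := HasCompactSupport.of_support_subset_isCompact hK fun q hq =>
    ⟨⟨proj q, subset_tsupport _ (right_ne_zero_of_mul hq), rfl⟩,
      subset_tsupport _ (left_ne_zero_of_mul hq)⟩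
  set F : SpaceTime n β → ℝ := majorant M η with hF
  let strip : Set (Space n × ℝ) := univ ×ˢ Ioc (-3 * β) (-3 * β + (5 : ℕ) * β)
  have hstrip : MeasurableSet strip := MeasurableSet.univ.prod measurableSet_Ioc
  have hχs : ∀ p : Space n × ℝ, p ∉ strip → p.2 ∉ tsupport χ := by
    intro p hp hps
    rw [χ.tsupport_eq] at hps
    apply hp
    simp only [Metric.mem_closedBall, Real.dist_eq, sub_zero, χ] at hps
    rw [abs_le] at hps
    refine ⟨trivial, ?_, ?_⟩ <;> push_cast <;> linarith [hps.1, hps.2]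
  have hfd := norm_fderiv_cutoff_le hη χ hM hM0 (strip := strip) hχs
  have hdim : Module.finrank ℝ (Space n × ℝ) = n + 1 := by simp
  -- The Gagliardo–Nirenberg–Sobolev inequality in ℝⁿ × ℝ, of dimension n + 1, applied to the
  -- cut-off lift. The lift costs at most five copies of the norm on the cylinder, and restricting
  -- it to one period recovers the norm of η.
  have gn := eLpNorm_le_eLpNorm_fderiv_of_eq (volume : Measure (Space n × ℝ)) hu huc
    (p := 2) (p' := N) (by norm_num) (by rw [hdim]; omega) (by rw [hdim, hN]; push_cast; rfl)
  obtain ⟨hFmem, hFl⟩ := l2_majorant_le hη hM0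
  have hFm : AEStronglyMeasurable F := hFmem.1
  have up : eLpNorm (fderiv ℝ u) ((2 : ℝ≥0) : ℝ≥0∞) volume ≤
      (5 : ℝ≥0∞) ^ (1 / 2 : ℝ) * eLpNorm F 2 volume := by
    have hm : Measurable (proj : Space n × ℝ → SpaceTime n β) := continuous_proj.measurable
    have hle := map_proj_strip_le (n := n) (β := β) 5 (-3 * β)
    have hFm' : AEStronglyMeasurable F ((volume.restrict strip).map proj) :=
      hFm.mono_ac ((Measure.absolutelyContinuous_of_le hle).trans
        Measure.smul_absolutelyContinuous)
    calc eLpNorm (fderiv ℝ u) ((2 : ℝ≥0) : ℝ≥0∞) volume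
        ≤ eLpNorm (strip.indicator fun p => F (proj p)) 2 volume := eLpNorm_mono hfd
      _ = eLpNorm (F ∘ proj) 2 (volume.restrict strip) :=
        eLpNorm_indicator_eq_eLpNorm_restrict hstrip
      _ = eLpNorm F 2 ((volume.restrict strip).map proj) :=
        (eLpNorm_map_measure hFm' hm.aemeasurable).symm
      _ ≤ eLpNorm F 2 (((5 : ℕ) : ℝ≥0∞) • volume) := eLpNorm_mono_measure _ hle
      _ = (5 : ℝ≥0∞) ^ (1 / 2 : ℝ) * eLpNorm F 2 volume := by
        rw [eLpNorm_smul_measure_of_ne_top (by norm_num)]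
        simp
  have down : eLpNorm η N volume ≤ eLpNorm u N volume := by
    have hmp := measurePreserving_proj (n := n) (β := β)
    have hμ' : ((volume : Measure (Space n)).prod ((volume : Measure ℝ).restrict (Ioc 0 (0 + β)))) =
        (volume : Measure (Space n × ℝ)).restrict (univ ×ˢ Ioc 0 (0 + β)) := by
      rw [Measure.volume_eq_prod, ← Measure.prod_restrict, Measure.restrict_univ]
    rw [← eLpNorm_comp_measurePreserving hη.continuous.aestronglyMeasurable hmp, hμ']
    rw [eLpNorm_congr_ae (g := u)]
    · exact eLpNorm_mono_measure _ Measure.restrict_le_self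
    · filter_upwards [ae_restrict_mem (MeasurableSet.univ.prod measurableSet_Ioc)] with p hp
      have : χ p.2 = 1 := by
        apply χ.one_of_mem_closedBall
        obtain ⟨-, h1, h2⟩ := hp
        simp only [Metric.mem_closedBall, Real.dist_eq, sub_zero, χ]
        rw [abs_le]; constructor <;> linarith
      simp [u, this]
  calc eLpNorm η N volume ≤ eLpNorm u N volume := down
    _ ≤ S * eLpNorm (fderiv ℝ u) ((2 : ℝ≥0) : ℝ≥0∞) volume := gn
    _ ≤ S * ((5 : ℝ≥0∞) ^ (1 / 2 : ℝ) * eLpNorm F 2 volume) := by gcongr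
    _ = ENNReal.ofReal (S * (5 ^ (1 / 2 : ℝ)) * l2 F) := by
      rw [eLpNorm_eq_ofReal_l2 (f := F) hFmem, ENNReal.ofReal_mul (by positivity),
        ENNReal.ofReal_mul (by positivity), ← mul_assoc,
        ← ENNReal.ofReal_rpow_of_pos (by norm_num)]
      simp
    _ ≤ _ := by
      refine ENNReal.ofReal_le_ofReal ?_
      rw [hC, mul_assoc _ (M + 1)]
      exact mul_le_mul_of_nonneg_left hFl (by positivity)

variable (n β) in
/-- The Sobolev inequality for compactly supported functions in `W^{1,2}`. -/
lemma exists_sobolev {N : ℝ≥0} (hN : (N : ℝ)⁻¹ = 2⁻¹ - ((n : ℝ) + 1)⁻¹) :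
    ∃ C : ℝ, 0 ≤ C ∧ ∀ (θ : SpaceTime n β → ℝ) (g : SpaceTime n β → Space n)
      (h : SpaceTime n β → ℝ), HasWGrad θ g h → HasCompactSupport θ → HasCompactSupport g →
      HasCompactSupport h → eLpNorm θ N volume ≤ ENNReal.ofReal (C * h1norm θ g h) := by
  obtain ⟨C, hC0, hC⟩ := exists_sobolev_test n β hN
  refine ⟨C, hC0, fun θ g h H hθ hgc hhc => ?_⟩
  obtain ⟨ρ, hρ⟩ := exists_mollifierSeq (n := n) (β := β)
  have hθm := H.memφ.memLp_of_hasCompactSupport hθ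
  have hhm := H.memh.memLp_of_hasCompactSupport hhc
  let e : Fin n → Space n := fun i => EuclideanSpace.single i 1
  have hgi : ∀ (k : SpaceTime n β → Space n) i z, inner ℝ (k z) (e i) = k z i := fun k i z => by
    simp [e, EuclideanSpace.inner_single_right]
  have hgim : ∀ {k : SpaceTime n β → Space n}, MemL2Loc k → ∀ i, MemL2Loc (fun z => k z i) :=
    fun {k} hk i => by simpa only [hgi] using hk.inner_const (e i)
  have hgic : ∀ i, HasCompactSupport (fun z => g z i) := fun i =>
    hgc.comp_left (g := fun x : Space n => x i) rfl
  have hgil : ∀ i, MemLp (fun z => g z i) 2 := fun i => (hgim H.memg i).memLp_of_hasCompactSupport (hgic i)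
  have hθl := H.memφ.locallyIntegrable
  have hT : ∀ k, IsTest (conv (ρ k) θ) := hρ.isTest_conv hθm hθ
  have hd1 : ∀ k, dTau (conv (ρ k) θ) = conv (ρ k) h := fun k => by
    ext z
    rw [dTau_eq]
    exact dirDeriv_conv_of_isWeakDir (hρ.isTest k) hθl (isWeakDTau_iff.1 H.isWeakDTau).2 z
  have hd2 : ∀ k i, (fun z => gradX (conv (ρ k) θ) z i) = conv (ρ k) (fun z => g z i) := fun k i => by
    ext z
    rw [gradX_apply (hT k)]
    refine dirDeriv_conv_of_isWeakDir (hρ.isTest k) hθl ?_ z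
    have := ((isWeakGradX_iff H.memφ).1 H.isWeakGradX).2 (e i)
    simpa only [hgi] using this
  have hl : Tendsto (fun k => h1norm (conv (ρ k) θ) (gradX (conv (ρ k) θ)) (dTau (conv (ρ k) θ)))
      atTop (𝓝 (h1norm θ g h)) := by
    simp only [h1norm, hd1, hd2]
    exact ((hρ.tendsto_l2_norm hθm hθ).add (tendsto_finsetSum _ fun i _ =>
      hρ.tendsto_l2_norm (hgil i) (hgic i))).add (hρ.tendsto_l2_norm hhm hhc)
  -- Fatou's lemma for the critical norm along an a.e. convergent subsequence of mollifications; the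
  -- right-hand sides converge.
  obtain ⟨ns, hns, hae⟩ := exists_subseq_tendsto_ae (fun k => (hT k).memLp 2) hθm
    (hρ.tendsto_l2 hθm hθ)
  have hl' := ENNReal.tendsto_ofReal ((hl.comp hns.tendsto_atTop).const_mul C)
  refine (Lp.eLpNorm_lim_le_liminf_eLpNorm (fun k => ((hT (ns k)).memLp 2).1) θ hae).trans ?_
  rw [← hl'.liminf_eq]
  exact liminf_le_liminf (Eventually.of_forall fun k => hC _ (hT (ns k)))

end sobolev

/-! ### Energies in terms of any representative of the gradient -/

section energies
variable {φ ψ : SpaceTime n β → ℝ} {g g' : SpaceTime n β → Space n} {h h' : SpaceTime n β → ℝ}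
  {V : ℝ → ℝ}

lemma HasWGrad.gradientEnergy_eq (H : HasWGrad φ g h) :
    gradientEnergy φ = ∫ z, (1 / 2) * ‖g z‖ ^ 2 := by
  refine integral_congr_ae ?_
  filter_upwards [H.weakGradX_ae] with z hz
  rw [hz]

lemma HasWGrad.kineticEnergy_eq (H : HasWGrad φ g h) :
    kineticEnergy φ = ∫ z, (1 / 2) * h z ^ 2 := by
  refine integral_congr_ae ?_
  filter_upwards [H.weakDTau_ae] with z hz
  rw [hz]

lemma HasWGrad.finiteAction_iff (H : HasWGrad φ g h) : FiniteAction V φ ↔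
    Integrable (fun z => ‖g z‖ ^ 2) ∧ Integrable (fun z => h z ^ 2) ∧
      Integrable (fun z => V (φ z)) := by
  refine and_congr (integrable_congr ?_) (and_congr (integrable_congr ?_) Iff.rfl)
  · filter_upwards [H.weakGradX_ae] with z hz
    rw [hz]
  · filter_upwards [H.weakDTau_ae] with z hz
    rw [hz]

lemma gradientEnergy_nonneg (φ : SpaceTime n β → ℝ) : 0 ≤ gradientEnergy φ :=
  integral_nonneg fun _ => by positivity

lemma kineticEnergy_nonneg (φ : SpaceTime n β → ℝ) : 0 ≤ kineticEnergy φ :=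
  integral_nonneg fun _ => by positivity

end energies

/-! ### Spatial dilations -/

section dilation

/-- The dilation `(x, τ) ↦ (x / l, τ)`. -/
noncomputable def dilate (l : ℝ) (hl : l ≠ 0) : SpaceTime n β ≃ₜ SpaceTime n β :=
  (Homeomorph.smulOfNeZero l⁻¹ (inv_ne_zero hl)).prodCongr (Homeomorph.refl _)

variable {l : ℝ}

omit [Fact (0 < β)] in
@[simp] lemma dilate_apply (hl : l ≠ 0) (z : SpaceTime n β) :
    dilate l hl z = (l⁻¹ • z.1, z.2) := rfl

omit [Fact (0 < β)] in
lemma rescale_eq (hl : l ≠ 0) (φ : SpaceTime n β → ℝ) (z : SpaceTime n β) :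
    rescale l φ z = φ (dilate l hl z) := rfl

lemma map_dilate (hl : 0 < l) : (volume : Measure (SpaceTime n β)).map (dilate l hl.ne') =
    ENNReal.ofReal (l ^ n) • volume := by
  have h1 : (dilate l hl.ne' : SpaceTime n β → SpaceTime n β) = Prod.map (fun x => l⁻¹ • x) id := rfl
  rw [h1, Measure.volume_eq_prod, ← Measure.map_prod_map _ _ (by fun_prop) measurable_id,
    Measure.map_addHaar_smul _ (inv_ne_zero hl.ne'), Measure.map_id, Measure.prod_smul_left]
  congr 2
  rw [finrank_euclideanSpace_fin, inv_pow, inv_inv, abs_of_pos (by positivity)]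

lemma integral_dilate (hl : 0 < l) {F : Type*} [NormedAddCommGroup F] [NormedSpace ℝ F]
    (f : SpaceTime n β → F) : ∫ z, f (dilate l hl.ne' z) = l ^ n • ∫ z, f z := by
  have h1 := (dilate (n := n) (β := β) l hl.ne').measurableEmbedding.integral_map (μ := volume) f
  rw [← h1, map_dilate hl, integral_smul_measure, ENNReal.toReal_ofReal (by positivity)]

lemma integrable_dilate (hl : 0 < l) {F : Type*} [NormedAddCommGroup F] {f : SpaceTime n β → F}
    (hf : Integrable f) : Integrable (fun z => f (dilate l hl.ne' z)) := by
  have h1 := hf.smul_measure (c := ENNReal.ofReal (l ^ n)) ENNReal.ofReal_ne_top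
  rw [← map_dilate hl] at h1
  exact h1.comp_measurable (dilate l hl.ne').continuous.measurable

lemma quasiMeasurePreserving_dilate (hl : 0 < l) :
    Measure.QuasiMeasurePreserving (dilate l hl.ne' : SpaceTime n β → SpaceTime n β) :=
  ⟨(dilate l hl.ne').continuous.measurable, by
    rw [map_dilate hl]; exact Measure.smul_absolutelyContinuous⟩

lemma MemL2Loc.dilate {F : Type*} [NormedAddCommGroup F] {f : SpaceTime n β → F} (hf : MemL2Loc f)
    (hl : 0 < l) : MemL2Loc (fun z => f (Bounce.dilate l hl.ne' z)) := by
  intro K hK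
  set e := (Bounce.dilate (n := n) (β := β) l hl.ne') with he
  have h1 := hf _ (hK.image e.continuous)
  have h2 : ((volume : Measure (SpaceTime n β)).restrict K).map e =
      ENNReal.ofReal (l ^ n) • volume.restrict (e '' K) := by
    rw [← Measure.restrict_smul, ← map_dilate hl, ← he, e.measurableEmbedding.restrict_map,
      e.injective.preimage_image]
  have h3 := h1.smul_measure (c := ENNReal.ofReal (l ^ n)) ENNReal.ofReal_ne_top
  rw [← h2] at h3
  exact h3.comp_of_map e.continuous.measurable.aemeasurable

omit [Fact (0 < β)] in
lemma IsTest.dilate {η : SpaceTime n β → ℝ} (hη : IsTest η) (hl : l ≠ 0) :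
    IsTest (fun z => η (Bounce.dilate l hl z)) := by
  refine ⟨?_, hη.2.comp_homeomorph _⟩
  have := hη.contDiff.comp (f := fun p : Space n × ℝ => (l⁻¹ • p.1, p.2)) (by fun_prop)
  exact this

omit [Fact (0 < β)] in
lemma dirDeriv_dilate (η : SpaceTime n β → ℝ) (hl : l ≠ 0) (v : Space n × ℝ) (z : SpaceTime n β) :
    dirDeriv v (fun z => η (dilate l hl z)) z = dirDeriv (l⁻¹ • v.1, v.2) η (dilate l hl z) := by
  simp only [dirDeriv]
  congr 1; ext t; congr 1
  ext1
  · simp [smul_comm t l⁻¹]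
  · simp

/-- Changing variables moves the dilation onto the test function as its inverse, which rescales
spatial directions by 1/l and leaves the τ-direction alone. -/
lemma HasWGrad.dilate {φ : SpaceTime n β → ℝ} {g : SpaceTime n β → Space n} {h : SpaceTime n β → ℝ}
    (H : HasWGrad φ g h) (hl : 0 < l) :
    HasWGrad (rescale l φ) (fun z => l⁻¹ • g (Bounce.dilate l hl.ne' z))
      (fun z => h (Bounce.dilate l hl.ne' z)) := by
  refine ⟨H.memφ.dilate hl, (H.memg.dilate hl).bdd_mul (m := fun _ => l⁻¹)
    aestronglyMeasurable_const (fun _ => le_rfl), H.memh.dilate hl, fun v η hη => ?_⟩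
  have hl' : l⁻¹ ≠ 0 := inv_ne_zero hl.ne'
  set η' : SpaceTime n β → ℝ := fun z => η (Bounce.dilate l⁻¹ hl' z) with hη'
  have hinv : ∀ z : SpaceTime n β, Bounce.dilate l⁻¹ hl' (Bounce.dilate l hl.ne' z) = z := fun z => by
    ext1 <;> simp [smul_smul, hl.ne']
  have h1 := H.weak (l⁻¹ • v.1, v.2) η' (hη.dilate hl')
  have e1 : ∫ z, rescale l φ z * dirDeriv v η z =
      l ^ n • ∫ z, φ z * dirDeriv (l⁻¹ • v.1, v.2) η' z := by
    rw [← integral_dilate hl]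
    refine integral_congr_ae (ae_of_all _ fun z => ?_)
    simp only [hη']
    rw [dirDeriv_dilate, hinv, rescale_eq hl.ne' φ z]
    simp [smul_smul, hl.ne']
  have e2 : ∫ z, η z * dirOf (fun z => l⁻¹ • g (Bounce.dilate l hl.ne' z))
      (fun z => h (Bounce.dilate l hl.ne' z)) v z =
      l ^ n • ∫ z, η' z * dirOf g h (l⁻¹ • v.1, v.2) z := by
    rw [← integral_dilate hl]
    refine integral_congr_ae (ae_of_all _ fun z => ?_)
    simp only [hη', hinv, dirOf, inner_smul_left, inner_smul_right]
    simp
  rw [e1, e2, h1, smul_neg]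

lemma VanishesAtInfinity.dilate {φ : SpaceTime n β → ℝ} (H : VanishesAtInfinity φ) (hl : 0 < l) :
    VanishesAtInfinity (rescale l φ) := by
  intro ε hε
  obtain ⟨K, hK, h⟩ := H ε hε
  refine ⟨(fun x => l • x) '' K, hK.image (by fun_prop), ?_⟩
  filter_upwards [(quasiMeasurePreserving_dilate (n := n) (β := β) hl).ae h] with z hz hzK
  refine hz fun hc => hzK ⟨l⁻¹ • z.1, hc, ?_⟩
  simp [smul_smul, hl.ne']

variable {φ : SpaceTime n β → ℝ} {V : ℝ → ℝ}

lemma IsConfig.dilate (H : IsConfig φ) (hl : 0 < l) : IsConfig (rescale l φ) :=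
  ⟨(H.1.hasWGrad.dilate hl).isW12Loc, H.2.dilate hl⟩

lemma FiniteAction.dilate (H : FiniteAction V φ) (hφ : IsConfig φ) (hl : 0 < l) :
    FiniteAction V (rescale l φ) := by
  rw [(hφ.1.hasWGrad.dilate hl).finiteAction_iff]
  refine ⟨?_, integrable_dilate hl H.2.1, integrable_dilate hl H.2.2⟩
  refine ((integrable_dilate hl H.1).const_mul (|l⁻¹| ^ 2)).congr (ae_of_all _ fun z => ?_)
  simp only [norm_smul, mul_pow, Real.norm_eq_abs]

lemma gradientEnergy_rescale (hφ : IsConfig φ) (hl : 0 < l) (hn : 2 ≤ n) :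
    gradientEnergy (rescale l φ) = l ^ (n - 2) * gradientEnergy φ := by
  rw [(hφ.1.hasWGrad.dilate hl).gradientEnergy_eq, gradientEnergy]
  have h1 := integral_dilate hl (fun z => (1 / 2) * ‖weakGradX φ z‖ ^ 2)
  have h2 : (l ^ n : ℝ) = l ^ (n - 2) * l ^ 2 := by rw [← pow_add, Nat.sub_add_cancel hn]
  have h3 : ∀ z, (1 / 2) * ‖l⁻¹ • weakGradX φ (Bounce.dilate l hl.ne' z)‖ ^ 2 =
      (l ^ 2)⁻¹ * ((1 / 2) * ‖weakGradX φ (Bounce.dilate l hl.ne' z)‖ ^ 2) := fun z => by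
    rw [norm_smul, mul_pow, norm_inv, inv_pow, Real.norm_of_nonneg hl.le]; ring
  simp only [h3]
  rw [integral_const_mul, h1, smul_eq_mul, h2]
  field_simp

lemma kineticEnergy_rescale (hφ : IsConfig φ) (hl : 0 < l) :
    kineticEnergy (rescale l φ) = l ^ n * kineticEnergy φ := by
  rw [(hφ.1.hasWGrad.dilate hl).kineticEnergy_eq, kineticEnergy, ← smul_eq_mul,
    ← integral_dilate hl (fun z => (1 / 2) * weakDTau φ z ^ 2)]

lemma potentialEnergy_rescale (hl : 0 < l) :
    potentialEnergy V (rescale l φ) = l ^ n * potentialEnergy V φ :=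
  integral_dilate hl (fun z => V (φ z))

end dilation

/-! ### Vanishing of configurations without gradient energy -/

section degenerate
variable {φ : SpaceTime n β → ℝ}

/-- A configuration without spatial gradient energy vanishes. -/
lemma ae_eq_zero_of_gradientEnergy_eq_zero (hn : 0 < n) (hφ : IsConfig φ)
    (hi : Integrable (fun z => ‖weakGradX φ z‖ ^ 2)) (h0 : gradientEnergy φ = 0) :
    φ =ᵐ[volume] 0 := by
  have H := hφ.1.hasWGrad
  have hg : weakGradX φ =ᵐ[volume] 0 := by
    rw [gradientEnergy, integral_eq_zero_iff_of_nonneg (fun z => by positivity)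
      (hi.const_mul _)] at h0
    filter_upwards [h0] with z hz
    simpa using hz
  have hφl := H.memφ.locallyIntegrable
  let e : Space n := EuclideanSpace.single ⟨0, hn⟩ 1
  have he : ‖e‖ = 1 := by simp [e]
  have hw : IsWeakDir (e, 0) φ (fun _ => 0) := by
    refine (H.weak (e, 0)).congr (EventuallyEq.refl _ _) ?_
    filter_upwards [hg] with z hz
    simp [dirOf, hz]
  -- With zero weak derivative along e, every pairing with a test function is constant under
  -- translation along e.
  have htr : ∀ t : ℝ, (fun z => φ (z + proj (t • (e, 0)))) =ᵐ[volume] φ := by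
    intro t
    have hl' : LocallyIntegrable (fun z => φ (z + proj (t • (e, 0)))) :=
      (H.memφ.comp_add _).locallyIntegrable
    have := ae_eq_zero_of_forall_test (hl'.sub hφl) fun η hη => ?_
    · filter_upwards [this] with z hz
      exact sub_eq_zero.1 hz
    · simp only [Pi.sub_apply, sub_mul]
      rw [integral_sub (hη.integrable_mul hl') (hη.integrable_mul hφl), sub_eq_zero]
      have hd := fun s => hasDerivAt_integral_of_isWeakDir hφl hw hη s
      simp only [zero_mul, integral_zero] at hd
      have := is_const_of_deriv_eq_zero (fun s => (hd s).differentiableAt) (fun s => (hd s).deriv) t 0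
      simpa using this
  have hsmall : ∀ ε : ℝ, 0 < ε → ∀ M : ℕ, ∀ᵐ z : SpaceTime n β, ‖z.1‖ ≤ M → |φ z| < ε := by
    intro ε hε M
    obtain ⟨K, hK, h⟩ := hφ.2 ε hε
    obtain ⟨R, hR⟩ := hK.isBounded.exists_norm_le
    -- A shift long enough to carry the ball of radius M off K, which lies in the ball of radius R.
    set t : ℝ := M + |R| + 1 with ht
    have h2 := (measurePreserving_add_right (volume : Measure (SpaceTime n β))
      (proj (t • (e, 0)))).quasiMeasurePreserving.ae h
    filter_upwards [h2, htr t] with z hz1 hz2 hzM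
    rw [← hz2]
    refine hz1 fun hc => ?_
    have h3 := hR _ hc
    simp only [Prod.fst_add, proj_fst, Prod.smul_fst] at h3
    have h4 : ‖t • e‖ ≤ ‖z.1 + t • e‖ + ‖z.1‖ := by
      calc ‖t • e‖ = ‖(z.1 + t • e) - z.1‖ := by congr 1; abel
        _ ≤ _ := norm_sub_le _ _
    have ht0 : 0 ≤ t := by positivity
    rw [norm_smul, he, mul_one, Real.norm_of_nonneg ht0] at h4
    linarith [le_abs_self R]
  have h1 : ∀ᵐ z : SpaceTime n β, ∀ k M : ℕ, ‖z.1‖ ≤ M → |φ z| < 1 / ((k : ℝ) + 1) :=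
    ae_all_iff.2 fun k => ae_all_iff.2 fun M => hsmall _ (by positivity) M
  filter_upwards [h1] with z hz
  obtain ⟨M, hM⟩ := exists_nat_ge ‖z.1‖
  have h2 : |φ z| ≤ 0 := by
    refine ge_of_tendsto' (tendsto_one_div_add_atTop_nhds_zero_nat (𝕜 := ℝ)) fun k => ?_
    exact (hz k M hM).le
  simpa using h2

end degenerate

/-! ### From the reduced problem to an unconstrained minimum -/

section groundState

/-- Minimizers of `c 𝒯 ^ p + 𝒦 + 𝒱` with minimal value zero. -/
structure IsGroundState (c p : ℝ) (V : ℝ → ℝ) (φ : SpaceTime n β → ℝ) : Prop where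
  config : IsConfig φ
  finite : FiniteAction V φ
  eq_zero : c * gradientEnergy φ ^ p + kineticEnergy φ + potentialEnergy V φ = 0
  nonneg : ∀ ψ : SpaceTime n β → ℝ, IsConfig ψ → FiniteAction V ψ →
    0 ≤ c * gradientEnergy ψ ^ p + kineticEnergy ψ + potentialEnergy V ψ

variable {c p : ℝ} {V : ℝ → ℝ} {φ : SpaceTime n β → ℝ}

/-- The exponent n/(n-2) is the one for which the power of the gradient energy scales like a volume,
as the other two energies do. -/
lemma rpow_scaling (hn : 3 ≤ n) {l T : ℝ} (hl : 0 < l) (hT : 0 ≤ T) :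
    (l ^ (n - 2) * T) ^ ((n : ℝ) / ((n : ℝ) - 2)) = l ^ n * T ^ ((n : ℝ) / ((n : ℝ) - 2)) := by
  have h3 : (3 : ℝ) ≤ n := by exact_mod_cast hn
  rw [Real.mul_rpow (by positivity) hT, ← Real.rpow_natCast l (n - 2), ← Real.rpow_mul hl.le,
    Nat.cast_sub (by omega), Nat.cast_ofNat, mul_div_cancel₀ _ (by linarith), Real.rpow_natCast]

lemma IsGroundState.rescale (hn : 3 ≤ n) (H : IsGroundState c ((n : ℝ) / ((n : ℝ) - 2)) V φ)
    {l : ℝ} (hl : 0 < l) : IsGroundState c ((n : ℝ) / ((n : ℝ) - 2)) V (rescale l φ) := by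
  refine ⟨H.config.dilate hl, H.finite.dilate H.config hl, ?_, H.nonneg⟩
  rw [gradientEnergy_rescale H.config hl (by omega), kineticEnergy_rescale H.config hl,
    potentialEnergy_rescale hl, rpow_scaling hn hl (gradientEnergy_nonneg _)]
  have := congrArg (fun x => l ^ n * x) H.eq_zero
  simp only [mul_zero] at this
  linarith

lemma gradientEnergy_pos (hn : 0 < n) (hV0 : V 0 = 0) (hφ : IsConfig φ) (hf : FiniteAction V φ)
    (hv : potentialEnergy V φ ≠ 0) : 0 < gradientEnergy φ := by
  refine lt_of_le_of_ne (gradientEnergy_nonneg _) fun h => hv ?_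
  have := ae_eq_zero_of_gradientEnergy_eq_zero hn hφ hf.1 h.symm
  rw [potentialEnergy]
  refine integral_eq_zero_of_ae ?_
  filter_upwards [this] with z hz
  simp [hz, hV0]

/-- The constant c is the reciprocal of the minimal value of ℛ, so that φ itself gives zero. Where 𝒦
+ 𝒱 ≥ 0 the inequality is trivial; elsewhere ψ can be dilated to potential energy v without changing
ℛ, and becomes a competitor. -/
lemma exists_isGroundState (hn : 3 ≤ n) (hV0 : V 0 = 0) (H : IsReducedSolution (n + 1) V φ) :
    0 < gradientEnergy φ ∧ potentialEnergy V φ + kineticEnergy φ < 0 ∧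
      ∃ c, 0 < c ∧ IsGroundState c ((n : ℝ) / ((n : ℝ) - 2)) V φ := by
  obtain ⟨v, hv, ⟨hc, hf, hpv, hk⟩, hmin⟩ := H
  have h3 : (3 : ℝ) ≤ n := by exact_mod_cast hn
  have hT : 0 < gradientEnergy φ := gradientEnergy_pos (by omega) hV0 hc hf (by rw [hpv]; exact hv.ne)
  have hW : potentialEnergy V φ + kineticEnergy φ < 0 := by linarith
  set p : ℝ := (n : ℝ) / ((n : ℝ) - 2) with hp
  have hpD : (((n + 1 : ℕ) : ℝ) - 1) / (((n + 1 : ℕ) : ℝ) - 3) = p := by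
    rw [hp]; push_cast; congr 1 <;> ring
  have hTp : 0 < gradientEnergy φ ^ p := Real.rpow_pos_of_pos hT p
  refine ⟨hT, hW, -(potentialEnergy V φ + kineticEnergy φ) / gradientEnergy φ ^ p,
    div_pos (by linarith) hTp, hc, hf, ?_, fun ψ hψ hψf => ?_⟩
  · rw [div_mul_cancel₀ _ hTp.ne']; ring
  rcases le_or_gt 0 (kineticEnergy ψ + potentialEnergy V ψ) with hWψ | hWψ
  · have h1 : 0 ≤ -(potentialEnergy V φ + kineticEnergy φ) / gradientEnergy φ ^ p *
        gradientEnergy ψ ^ p :=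
      mul_nonneg (div_nonneg (by linarith) hTp.le) (Real.rpow_nonneg (gradientEnergy_nonneg _) _)
    linarith
  · have hVψ : potentialEnergy V ψ < 0 := by linarith [kineticEnergy_nonneg ψ]
    have hr : 0 < v / potentialEnergy V ψ := div_pos_of_neg_of_neg hv hVψ
    -- Since 𝒱 scales by l^n, this dilation makes the potential energy of ψ equal to v.
    set l : ℝ := (v / potentialEnergy V ψ) ^ ((n : ℝ)⁻¹) with hl
    have hl0 : 0 < l := Real.rpow_pos_of_pos hr _
    have hln : l ^ n = v / potentialEnergy V ψ := by
      rw [hl, ← Real.rpow_natCast, ← Real.rpow_mul hr.le, inv_mul_cancel₀ (by linarith),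
        Real.rpow_one]
    have hcomp : IsCompetitor (n + 1) V v (Bounce.rescale l ψ) := by
      refine ⟨hψ.dilate hl0, hψf.dilate hψ hl0, ?_, ?_⟩
      · refine (potentialEnergy_rescale (n := n) hl0).trans ?_
        rw [hln, div_mul_cancel₀ _ hVψ.ne]
      · change kineticEnergy (n := n) _ < -potentialEnergy (n := n) V _
        rw [potentialEnergy_rescale hl0, kineticEnergy_rescale hψ hl0]
        have := pow_pos hl0 n
        nlinarith
    have h1 : gradientEnergy φ ^ p / (-potentialEnergy V φ - kineticEnergy φ) ≤
        gradientEnergy (Bounce.rescale l ψ) ^ p /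
          (-potentialEnergy V (Bounce.rescale l ψ) - kineticEnergy (Bounce.rescale l ψ)) := by
      have := hmin _ hcomp
      simp only [reducedFunctional, hpD] at this
      exact this
    rw [potentialEnergy_rescale hl0, kineticEnergy_rescale hψ hl0,
      gradientEnergy_rescale hψ hl0 (by omega), hp, rpow_scaling hn hl0 (gradientEnergy_nonneg _),
      ← hp] at h1
    have h2 : -(l ^ n * potentialEnergy V ψ) - l ^ n * kineticEnergy ψ =
        l ^ n * -(kineticEnergy ψ + potentialEnergy V ψ) := by ring
    rw [h2, mul_div_mul_left _ _ (pow_pos hl0 n).ne', div_le_div_iff₀ (by linarith) (by linarith)] at h1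
    have h4 : -(kineticEnergy ψ + potentialEnergy V ψ) ≤
        -(potentialEnergy V φ + kineticEnergy φ) / gradientEnergy φ ^ p * gradientEnergy ψ ^ p := by
      rw [div_mul_eq_mul_div, le_div_iff₀ hTp]
      linarith
    linarith

end groundState

/-! ### De Giorgi's upper bound -/

section deGiorgi

/-- The numerical iteration in De Giorgi's method. -/
lemma deGiorgi_iteration {Y : ℝ → ℝ} {C N : ℝ} (hN : 2 < N) (hC : 0 < C) (hY0 : ∀ h, 0 ≤ Y h)
    (hY : Antitone Y) (hlim : Tendsto Y atTop (𝓝 0))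
    (hstep : ∀ h k, 1 ≤ h → h < k → Y k ≤ C * (k / (k - h)) ^ N * Y h ^ (N / 2)) :
    ∃ M, 1 ≤ M ∧ Y M = 0 := by
  set α : ℝ := N / 2 - 1 with hα
  have hα0 : 0 < α := by rw [hα]; linarith
  set b : ℝ := (2 : ℝ) ^ N with hb
  have hb1 : 1 < b := Real.one_lt_rpow (by norm_num) (by linarith)
  have hb0 : 0 < b := by linarith
  -- The rate of geometric decay for which b r^α = 1: the factor b^i lost to the shrinking gaps is
  -- exactly absorbed by the superlinear gain (r^i)^α.
  set r : ℝ := b ^ (-α⁻¹) with hr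
  have hr0 : 0 < r := Real.rpow_pos_of_pos hb0 _
  have hr1 : r < 1 := Real.rpow_lt_one_of_one_lt_of_neg hb1 (by simpa using hα0)
  have hrα : b * r ^ α = 1 := by
    rw [hr, ← Real.rpow_mul hb0.le, neg_mul, inv_mul_cancel₀ hα0.ne', Real.rpow_neg_one,
      mul_inv_cancel₀ hb0.ne']
  have hsmall : Tendsto (fun h => C * b ^ 2 * Y h ^ α) atTop (𝓝 0) := by
    have := (hlim.rpow_const (p := α) (Or.inr hα0.le)).const_mul (C * b ^ 2)
    rwa [Real.zero_rpow hα0.ne', mul_zero] at this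
  -- The iteration needs a small start; Y tends to 0, so a high enough initial level provides it.
  obtain ⟨H, hH, hH1⟩ := ((hsmall.eventually_lt_const hr0).and (eventually_ge_atTop 1)).exists
  have hH0 : 0 < H := by linarith
  -- The levels increase from H to 2H with gaps halving each time, so k/(k - h) is at most 2^(i+2)
  -- at step i.
  have claim : ∀ i : ℕ, Y (H * (2 - (1 / 2) ^ i)) ≤ Y H * r ^ i := by
    intro i
    induction i with
    | zero => norm_num
    | succ i ih =>
      have hp : (0 : ℝ) < (1 / 2) ^ i := by positivity
      have hp1 : (1 / 2 : ℝ) ^ i ≤ 1 := pow_le_one₀ (by norm_num) (by norm_num)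
      have e : (1 / 2 : ℝ) ^ (i + 1) = (1 / 2) ^ i / 2 := by rw [pow_succ]; ring
      have h1 : 1 ≤ H * (2 - (1 / 2) ^ i) := by nlinarith
      have h2 : H * (2 - (1 / 2) ^ i) < H * (2 - (1 / 2) ^ (i + 1)) := by
        rw [e]; nlinarith
      refine (hstep _ _ h1 h2).trans ?_
      have h3 : H * (2 - (1 / 2) ^ (i + 1)) / (H * (2 - (1 / 2) ^ (i + 1)) - H * (2 - (1 / 2) ^ i))
          ≤ 2 ^ (i + 2) := by
        have h4 : H * (2 - (1 / 2) ^ (i + 1)) - H * (2 - (1 / 2) ^ i) = H * ((1 / 2) ^ i / 2) := by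
          rw [e]; ring
        rw [h4, div_le_iff₀ (by positivity)]
        have h5 : (2 : ℝ) ^ (i + 2) * (H * ((1 / 2) ^ i / 2)) = H * 2 := by
          rw [pow_add]
          have : (2 : ℝ) ^ i * (1 / 2) ^ i = 1 := by rw [← mul_pow]; norm_num
          linear_combination (2 * H) * this
        rw [h5]
        refine mul_le_mul_of_nonneg_left ?_ hH0.le
        have : (0 : ℝ) < (1 / 2) ^ (i + 1) := by positivity
        linarith
      have h4 : (H * (2 - (1 / 2) ^ (i + 1)) /
          (H * (2 - (1 / 2) ^ (i + 1)) - H * (2 - (1 / 2) ^ i))) ^ N ≤ b ^ 2 * b ^ i := by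
        have h5 := Real.rpow_le_rpow (div_nonneg (by linarith) (by linarith)) h3
          (by linarith : 0 ≤ N)
        refine h5.trans (le_of_eq ?_)
        rw [hb, ← Real.rpow_natCast 2 (i + 2), ← Real.rpow_mul (by norm_num), mul_comm,
          Real.rpow_mul (by norm_num), Real.rpow_natCast, pow_add, mul_comm]
      have h5 : Y (H * (2 - (1 / 2) ^ i)) ^ (N / 2) ≤ (Y H * r ^ i) * (Y H ^ α * (r ^ α) ^ i) := by
        refine (Real.rpow_le_rpow (hY0 _) ih (by linarith)).trans (le_of_eq ?_)
        have h6 : N / 2 = 1 + α := by rw [hα]; ring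
        rcases (hY0 H).eq_or_lt with h0 | h0
        · rw [← h0, zero_mul, zero_mul, Real.zero_rpow (by linarith)]
        · have : 0 < Y H * r ^ i := by positivity
          rw [h6, Real.rpow_add this, Real.rpow_one, Real.mul_rpow h0.le (by positivity),
            ← Real.rpow_natCast r i, ← Real.rpow_mul hr0.le, ← Real.rpow_natCast (r ^ α),
            ← Real.rpow_mul hr0.le, mul_comm α]
      calc _ ≤ C * (b ^ 2 * b ^ i) * ((Y H * r ^ i) * (Y H ^ α * (r ^ α) ^ i)) := by
            have h0 := hY0 (H * (2 - (1 / 2) ^ i))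
            have h0' := hY0 H
            have := Real.rpow_nonneg h0 (N / 2)
            gcongr
        _ = (Y H * r ^ i) * (C * b ^ 2 * Y H ^ α) * (b * r ^ α) ^ i := by
          rw [mul_pow]; ring
        _ = (Y H * r ^ i) * (C * b ^ 2 * Y H ^ α) := by rw [hrα, one_pow, mul_one]
        _ ≤ (Y H * r ^ i) * r :=
          mul_le_mul_of_nonneg_left hH.le (mul_nonneg (hY0 _) (by positivity))
        _ = _ := by rw [pow_succ]; ring
  refine ⟨2 * H, by linarith, le_antisymm ?_ (hY0 _)⟩
  have hl : Tendsto (fun i : ℕ => Y H * r ^ i) atTop (𝓝 (Y H * 0)) :=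
    (tendsto_pow_atTop_nhds_zero_of_lt_one hr0.le hr1).const_mul _
  rw [mul_zero] at hl
  refine ge_of_tendsto' hl fun i => (hY ?_).trans (claim i)
  have : (0 : ℝ) < (1 / 2) ^ i := by positivity
  nlinarith

/-- The Sobolev exponent in dimension `n + 1`. -/
noncomputable def sobolevExp (n : ℕ) : ℝ := 2 * ((n : ℝ) + 1) / ((n : ℝ) - 1)

lemma two_lt_sobolevExp (hn : 3 ≤ n) : 2 < sobolevExp n := by
  have h3 : (3 : ℝ) ≤ n := by exact_mod_cast hn
  rw [sobolevExp, lt_div_iff₀ (by linarith)]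
  linarith

lemma sobolevExp_inv (hn : 3 ≤ n) : (sobolevExp n)⁻¹ = 2⁻¹ - ((n : ℝ) + 1)⁻¹ := by
  have h3 : (3 : ℝ) ≤ n := by exact_mod_cast hn
  have : (n : ℝ) - 1 ≠ 0 := by linarith
  rw [sobolevExp]
  field_simp
  ring

variable {u : SpaceTime n β → ℝ} {g : SpaceTime n β → Space n} {h' : SpaceTime n β → ℝ}

lemma hasWGrad_const (c : ℝ) : HasWGrad (fun _ : SpaceTime n β => c) (fun _ => 0) (fun _ => 0) := by
  refine ⟨Continuous.memL2Loc continuous_const, Continuous.memL2Loc continuous_const,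
    Continuous.memL2Loc continuous_const, fun v η hη => ?_⟩
  rw [integral_const_mul, integral_dirDeriv hη]
  simp [dirOf]

open Classical in
/-- The part of a configuration above a positive level satisfies the Sobolev inequality. -/
lemma sobolev_superlevel {N : ℝ≥0} {C : ℝ}
    (hC : ∀ (θ : SpaceTime n β → ℝ) (g : SpaceTime n β → Space n)
      (h : SpaceTime n β → ℝ), HasWGrad θ g h → HasCompactSupport θ → HasCompactSupport g →
      HasCompactSupport h → eLpNorm θ N volume ≤ ENNReal.ofReal (C * h1norm θ g h))
    (H : HasWGrad u g h') (hv : VanishesAtInfinity u) {s : ℝ} (hs : 0 < s) :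
    MemLp (fun z => max (u z - s) 0) 2 ∧
    eLpNorm (fun z => max (u z - s) 0) N volume ≤ ENNReal.ofReal (C * h1norm
      (fun z => max (u z - s) 0) (fun z => if s < u z then g z else 0)
      (fun z => if s < u z then h' z else 0)) := by
  obtain ⟨K, hK, hKv⟩ := hv s hs
  have h1 := ((H.add (hasWGrad_const (-s))).posPart)
  simp only [← sub_eq_add_neg, sub_pos, add_zero] at h1
  set θ := fun z => max (u z - s) 0 with hθ
  set G := fun z => if s < u z then g z else 0 with hG
  set T := fun z => if s < u z then h' z else 0 with hT
  set S : Set (SpaceTime n β) := K ×ˢ univ with hS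
  have hSc : IsCompact S := hK.prod isCompact_univ
  have hle : ∀ᵐ z : SpaceTime n β, z ∉ S → u z < s := by
    filter_upwards [hKv] with z hz hzS
    refine (le_abs_self _).trans_lt (hz fun hc => hzS ⟨hc, trivial⟩)
  -- Above a positive level the function lives over a compact set only up to null sets; passing to
  -- indicators gives the genuine compact support required by the Sobolev inequality.
  have e1 : θ =ᵐ[volume] S.indicator θ := by
    filter_upwards [hle] with z hz
    by_cases hzS : z ∈ S
    · simp [hzS]
    · simp [hzS, hθ, (hz hzS).le]
  have e2 : G =ᵐ[volume] S.indicator G := by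
    filter_upwards [hle] with z hz
    by_cases hzS : z ∈ S
    · simp [hzS]
    · simp [hzS, hG, (hz hzS).le]
  have e3 : T =ᵐ[volume] S.indicator T := by
    filter_upwards [hle] with z hz
    by_cases hzS : z ∈ S
    · simp [hzS]
    · simp [hzS, hT, (hz hzS).le]
  have hcs : ∀ {F : Type} [Zero F] (f : SpaceTime n β → F), HasCompactSupport (S.indicator f) :=
    fun f => HasCompactSupport.of_support_subset_isCompact hSc support_indicator_subset
  have h2 := h1.congr e1 e2 e3
  have h3 := hC _ _ _ h2 (hcs θ) (hcs G) (hcs T)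
  refine ⟨(memLp_congr_ae e1).2 (h2.memφ.memLp_of_hasCompactSupport (hcs θ)), ?_⟩
  rw [eLpNorm_congr_ae e1]
  refine h3.trans (le_of_eq ?_)
  congr 2
  simp only [h1norm]
  rw [l2_congr e1, l2_congr e3]
  congr 2
  refine Finset.sum_congr rfl fun i _ => l2_congr ?_
  filter_upwards [e2] with z hz
  rw [hz]

lemma l2_le_sqrt {f : SpaceTime n β → ℝ} (hf : AEStronglyMeasurable f) {F : SpaceTime n β → ℝ}
    (hF : Integrable F) (hle : ∀ z, f z ^ 2 ≤ F z) {B : ℝ} (hB : ∫ z, F z ≤ B) :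
    l2 f ≤ √B := by
  have hm : MemLp f 2 := by
    rw [memLp_two_iff_integrable_sq hf]
    exact hF.mono' (hf.pow 2) (ae_of_all _ fun z => by
      rw [Real.norm_of_nonneg (sq_nonneg _)]; exact hle z)
  refine Real.le_sqrt_of_sq_le ?_
  rw [l2_sq hm]
  exact (integral_mono_of_nonneg (ae_of_all _ fun z => sq_nonneg _) hF (ae_of_all _ hle)).trans hB

open Classical in
/-- De Giorgi's theorem: a bound of the Dirichlet energy above every level by the integral of the
critical power gives an upper bound. -/
lemma exists_upper_bound (hn : 3 ≤ n) (H : HasWGrad u g h') (hv : VanishesAtInfinity u)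
    (hg : Integrable (fun z => ‖g z‖ ^ 2)) (hh : Integrable (fun z => h' z ^ 2)) {A : ℝ}
    (hA : 0 ≤ A)
    (hE : ∀ s : ℝ, 1 ≤ s → Integrable (fun z => if s < u z then u z ^ sobolevExp n else 0) →
      ∫ z, (if s < u z then ‖g z‖ ^ 2 + h' z ^ 2 else 0) ≤
        A * ∫ z, (if s < u z then u z ^ sobolevExp n else 0)) :
    ∃ M, ∀ᵐ z, u z ≤ M := by
  have hN2 := two_lt_sobolevExp hn
  set N := sobolevExp n with hN
  lift N to ℝ≥0 using (by linarith) with N'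
  have hN0 : (0 : ℝ) < N' := by linarith
  have hNe : (N' : ℝ≥0∞) ≠ 0 := by
    have : N' ≠ 0 := by rintro rfl; simp at hN0
    simpa using this
  obtain ⟨C, hC0, hC⟩ := exists_sobolev n β (N := N') (by rw [hN]; exact sobolevExp_inv hn)
  have hum := H.memφ.aestronglyMeasurable
  have hmeas : ∀ s : ℝ, NullMeasurableSet {z | s < u z} := fun s =>
    nullMeasurableSet_lt aemeasurable_const hum.aemeasurable
  let Y : ℝ → ℝ := fun s => ∫ z, (if s < u z then u z ^ (N' : ℝ) else 0)
  have hθN : ∀ s : ℝ, 0 < s → MemLp (fun z => max (u z - s) 0) N' := fun s hs => by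
    have h1 := sobolev_superlevel hC H hv hs
    exact ⟨h1.1.1, h1.2.trans_lt ENNReal.ofReal_lt_top⟩
  have hθi : ∀ s : ℝ, 0 < s → Integrable (fun z => max (u z - s) 0 ^ (N' : ℝ)) := fun s hs => by
    have := (hθN s hs).integrable_norm_rpow hNe ENNReal.coe_ne_top
    refine this.congr (ae_of_all _ fun z => ?_)
    simp [abs_of_nonneg (le_max_right (u z - s) 0)]
  have him : ∀ s : ℝ, AEStronglyMeasurable (fun z => if s < u z then u z ^ (N' : ℝ) else 0) :=
    fun s => ((hum.aemeasurable.pow_const _).aestronglyMeasurable.indicator₀ (hmeas s))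
  -- Where u > s one has u ≤ 2(u - s/2), so integrability at the lower level s/2 suffices.
  have hYi : ∀ s : ℝ, 0 < s → Integrable (fun z => if s < u z then u z ^ (N' : ℝ) else 0) := by
    intro s hs
    refine ((hθi (s / 2) (by linarith)).const_mul (2 ^ (N' : ℝ))).mono' (him s)
      (ae_of_all _ fun z => ?_)
    split_ifs with hz
    · have hu : 0 < u z := hs.trans hz
      rw [Real.norm_of_nonneg (by positivity), ← Real.mul_rpow (by norm_num) (le_max_right _ _)]
      refine Real.rpow_le_rpow hu.le ?_ hN0.le
      have : u z - s / 2 ≤ max (u z - s / 2) 0 := le_max_left _ _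
      linarith
    · rw [norm_zero]
      exact mul_nonneg (by positivity) (Real.rpow_nonneg (le_max_right _ _) _)
  have hYnn : ∀ s z, 0 ≤ s → 0 ≤ (if s < u z then u z ^ (N' : ℝ) else 0) := fun s z hs => by
    split_ifs with hz
    · exact Real.rpow_nonneg (hs.trans hz.le) _
    · exact le_rfl
  -- the energy estimate combined with the Sobolev inequality
  have hY1 : ∀ s, 1 ≤ s → ∫ z, max (u z - s) 0 ^ (N' : ℝ) ≤
      (C * (((n : ℝ) + 2) * √((1 + A) * Y s))) ^ (N' : ℝ) := by
    intro s hs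
    have hs0 : 0 < s := by linarith
    obtain ⟨h1, h2⟩ := sobolev_superlevel hC H hv hs0
    have hYs := hYi s hs0
    have hYs0 : 0 ≤ Y s := integral_nonneg fun z => hYnn s z hs0.le
    have hEs := hE s hs hYs
    have hgi : Integrable (fun z => if s < u z then ‖g z‖ ^ 2 + h' z ^ 2 else 0) :=
      (hg.add hh).indicator₀ (hmeas s)
    have hB1 : A * Y s ≤ (1 + A) * Y s := by nlinarith
    have hB2 : Y s ≤ (1 + A) * Y s := by nlinarith
    -- Levels are at least 1, so u² ≤ u^N there; the L² part of the Sobolev norm is controlled by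
    -- the same quantity Y as the energy.
    have l1 : l2 (fun z => max (u z - s) 0) ≤ √((1 + A) * Y s) := by
      refine l2_le_sqrt h1.1 hYs (fun z => ?_) hB2
      split_ifs with hz
      · have h3 : 1 ≤ u z := by linarith
        rw [max_eq_left (by linarith)]
        calc (u z - s) ^ 2 ≤ u z ^ 2 := by nlinarith
          _ = u z ^ (2 : ℝ) := by norm_cast
          _ ≤ _ := Real.rpow_le_rpow_of_exponent_le h3 hN2.le
      · rw [max_eq_right (by linarith)]; simp
    have l2' : ∀ i, l2 (fun z => (if s < u z then g z else 0) i) ≤ √((1 + A) * Y s) := fun i => by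
      refine l2_le_sqrt ?_ hgi (fun z => ?_) (hEs.trans hB1)
      · have h3 : AEStronglyMeasurable (fun z => if s < u z then g z else 0) :=
          H.memg.aestronglyMeasurable.indicator₀ (hmeas s)
        exact (PiLp.continuous_apply 2 (fun _ : Fin n => ℝ) i).comp_aestronglyMeasurable h3
      · split_ifs with hz
        · have h3 : |g z i| ≤ ‖g z‖ := PiLp.norm_apply_le (g z) i
          have h4 : g z i ^ 2 ≤ ‖g z‖ ^ 2 := by
            rw [← sq_abs (g z i)]; exact pow_le_pow_left₀ (abs_nonneg _) h3 2
          linarith [sq_nonneg (h' z)]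
        · simp
    have l3 : l2 (fun z => if s < u z then h' z else 0) ≤ √((1 + A) * Y s) := by
      have h3 : AEStronglyMeasurable (fun z => if s < u z then h' z else 0) :=
        H.memh.aestronglyMeasurable.indicator₀ (hmeas s)
      refine l2_le_sqrt h3 hgi (fun z => ?_) (hEs.trans hB1)
      split_ifs with hz
      · linarith [sq_nonneg ‖g z‖]
      · simp
    have hsum : h1norm (fun z => max (u z - s) 0) (fun z => if s < u z then g z else 0)
        (fun z => if s < u z then h' z else 0) ≤ ((n : ℝ) + 2) * √((1 + A) * Y s) := by
      have := Finset.sum_le_sum fun (i : Fin n) (_ : i ∈ Finset.univ) => l2' i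
      simp only [Finset.sum_const, Finset.card_univ, Fintype.card_fin, nsmul_eq_mul] at this
      simp only [h1norm]
      linarith
    have h3 := h2.trans (ENNReal.ofReal_le_ofReal (mul_le_mul_of_nonneg_left hsum hC0))
    have h4 : eLpNorm (fun z => max (u z - s) 0) N' volume =
        ENNReal.ofReal ((∫ z, max (u z - s) 0 ^ (N' : ℝ)) ^ (N' : ℝ)⁻¹) := by
      rw [(hθN s hs0).eLpNorm_eq_integral_rpow_norm hNe ENNReal.coe_ne_top]
      have h5 : ∀ z, |max (u z - s) 0| = max (u z - s) 0 := fun z => abs_of_nonneg (le_max_right _ _)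
      simp [h5]
    rw [h4, ENNReal.ofReal_le_ofReal_iff (by positivity)] at h3
    have hnn : 0 ≤ ∫ z, max (u z - s) 0 ^ (N' : ℝ) :=
      integral_nonneg fun z => Real.rpow_nonneg (le_max_right _ _) _
    have h5 := Real.rpow_le_rpow (Real.rpow_nonneg hnn _) h3 hN0.le
    rwa [← Real.rpow_mul hnn, inv_mul_cancel₀ hN0.ne', Real.rpow_one] at h5
  -- `Y` is made nonnegative and antitone on the whole line
  let Z : ℝ → ℝ := fun s => Y (max s 1)
  have hZ0 : ∀ s, 0 ≤ Z s := fun s =>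
    integral_nonneg fun z => hYnn _ z (zero_le_one.trans (le_max_right _ _))
  have hZa : Antitone Z := by
    intro s t hst
    have h0 : ∀ r : ℝ, 0 < max r 1 := fun r => zero_lt_one.trans_le (le_max_right _ _)
    refine integral_mono (hYi _ (h0 t)) (hYi _ (h0 s)) fun z => ?_
    by_cases hz : max t 1 < u z
    · simp only [hz, if_true, (max_le_max_right 1 hst).trans_lt hz, le_refl]
    · simp only [hz, if_false]
      exact hYnn _ z (h0 s).le
  have hZl : Tendsto Z atTop (𝓝 0) := by
    have h1 : Tendsto Z atTop (𝓝 (∫ _ : SpaceTime n β, (0 : ℝ))) := by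
      refine tendsto_integral_filter_of_dominated_convergence
        (fun z => if 1 < u z then u z ^ (N' : ℝ) else 0) (Eventually.of_forall fun s => him _)
        (Eventually.of_forall fun s => ae_of_all _ fun z => ?_) (hYi 1 one_pos)
        (ae_of_all _ fun z => ?_)
      · rw [Real.norm_of_nonneg (hYnn _ z (zero_le_one.trans (le_max_right _ _)))]
        by_cases hz : max s 1 < u z
        · simp only [hz, if_true, (le_max_right s 1).trans_lt hz, le_refl]
        · simp only [hz, if_false]
          exact hYnn _ z zero_le_one
      · refine tendsto_const_nhds.congr' ?_
        filter_upwards [eventually_ge_atTop (u z)] with s hs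
        rw [if_neg (not_lt.2 (hs.trans (le_max_left _ _)))]
    simpa using h1
  set C₁ : ℝ := (C * (((n : ℝ) + 2) * √(1 + A))) ^ (N' : ℝ) + 1 with hC₁
  have hC₁0 : 0 < C₁ := by positivity
  obtain ⟨M, hM1, hM⟩ := deGiorgi_iteration hN2 hC₁0 hZ0 hZa hZl fun s k hs hsk => by
    have hs0 : 0 < s := by linarith
    have hk0 : 0 < k := by linarith
    have hks : 0 < k - s := by linarith
    have e1 : Z k = Y k := by simp only [Z]; rw [max_eq_left (by linarith)]
    have e2 : Z s = Y s := by simp only [Z]; rw [max_eq_left hs]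
    rw [e1, e2]
    have hYs0 : 0 ≤ Y s := integral_nonneg fun z => hYnn s z hs0.le
    have hq : 0 < k / (k - s) := div_pos hk0 hks
    -- Where u > k > s, the ratio u/(u - s) is at most k/(k - s).
    have h1 : Y k ≤ (k / (k - s)) ^ (N' : ℝ) * ∫ z, max (u z - s) 0 ^ (N' : ℝ) := by
      rw [← integral_const_mul]
      refine integral_mono (hYi k hk0) ((hθi s hs0).const_mul _) fun z => ?_
      simp only
      split_ifs with hz
      · have hu : 0 < u z := hk0.trans hz
        rw [← Real.mul_rpow hq.le (le_max_right _ _), max_eq_left (by linarith)]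
        refine Real.rpow_le_rpow hu.le ?_ hN0.le
        rw [div_mul_eq_mul_div, le_div_iff₀ hks]
        nlinarith
      · exact mul_nonneg (Real.rpow_nonneg hq.le _) (Real.rpow_nonneg (le_max_right _ _) _)
    have h2 := mul_le_mul_of_nonneg_left (hY1 s hs) (Real.rpow_nonneg hq.le (N' : ℝ))
    refine (h1.trans h2).trans ?_
    have h3 : (C * (((n : ℝ) + 2) * √((1 + A) * Y s))) ^ (N' : ℝ) ≤ C₁ * Y s ^ ((N' : ℝ) / 2) := by
      have h4 : C * (((n : ℝ) + 2) * √((1 + A) * Y s)) =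
          C * (((n : ℝ) + 2) * √(1 + A)) * √(Y s) := by
        rw [Real.sqrt_mul (by linarith)]; ring
      rw [h4, Real.mul_rpow (by positivity) (Real.sqrt_nonneg _), Real.sqrt_eq_rpow (Y s),
        ← Real.rpow_mul hYs0, show (1 / 2 : ℝ) * N' = N' / 2 by ring]
      refine mul_le_mul_of_nonneg_right ?_ (Real.rpow_nonneg hYs0 _)
      rw [hC₁]; linarith
    calc _ ≤ (k / (k - s)) ^ (N' : ℝ) * (C₁ * Y s ^ ((N' : ℝ) / 2)) :=
          mul_le_mul_of_nonneg_left h3 (Real.rpow_nonneg hq.le _)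
      _ = _ := by ring
  refine ⟨M, ?_⟩
  have hM' : Y M = 0 := by
    have : Z M = Y M := by simp only [Z]; rw [max_eq_left hM1]
    rw [← this, hM]
  have hM0 : 0 < M := by linarith
  rw [integral_eq_zero_iff_of_nonneg (fun z => hYnn M z hM0.le) (hYi M hM0)] at hM'
  filter_upwards [hM'] with z hz
  by_contra hc
  push Not at hc
  simp only [hc, if_true, Pi.zero_apply] at hz
  exact (Real.rpow_pos_of_pos (hM0.trans hc) _).ne' hz

end deGiorgi

/-! ### Truncating ground states: boundedness -/

section truncation

variable {φ : SpaceTime n β → ℝ} {g : SpaceTime n β → Space n} {h : SpaceTime n β → ℝ}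
  {V : ℝ → ℝ} {c p k : ℝ}

/-- Follows from min(φ, k) = φ - (φ - k)⁺ and the formula for the positive part. -/
lemma HasWGrad.min_const (H : HasWGrad φ g h) (k : ℝ) : HasWGrad (fun z => min (φ z) k)
    (fun z => if k < φ z then 0 else g z) (fun z => if k < φ z then 0 else h z) := by
  have P := H.add (((H.add (hasWGrad_const (-k))).posPart).const_mul (-1))
  simp only [← sub_eq_add_neg, sub_pos, add_zero] at P
  refine P.congr (ae_of_all _ fun z => ?_) (ae_of_all _ fun z => ?_) (ae_of_all _ fun z => ?_)
  · rcases le_total (φ z) k with hz | hz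
    · simp [hz]
    · simp [hz]
  · by_cases hz : k < φ z <;> simp [hz]
  · by_cases hz : k < φ z <;> simp [hz]

lemma VanishesAtInfinity.min_const (H : VanishesAtInfinity φ) (hk : 0 ≤ k) :
    VanishesAtInfinity (fun z => min (φ z) k) := by
  intro ε hε
  obtain ⟨K, hK, h⟩ := H ε hε
  refine ⟨K, hK, ?_⟩
  filter_upwards [h] with z hz hzK
  have h1 := abs_lt.1 (hz hzK)
  refine abs_lt.2 ⟨lt_min h1.1 (by linarith), (min_le_left _ _).trans_lt h1.2⟩

lemma VanishesAtInfinity.measure_superlevel_lt_top (H : VanishesAtInfinity φ) (hk : 0 < k) :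
    volume {z | k < φ z} < ⊤ := by
  obtain ⟨K, hK, h⟩ := H k hk
  have hc : IsCompact (K ×ˢ (univ : Set (AddCircle β))) := hK.prod isCompact_univ
  refine (measure_mono_ae ?_).trans_lt hc.measure_lt_top
  filter_upwards [h] with z hz hzk
  by_contra hzK
  exact absurd (hz fun hc => hzK ⟨hc, trivial⟩) (not_lt.2 ((le_of_lt hzk).trans (le_abs_self _)))

/-- Since T'^(p-1) ≤ T^(p-1), the difference of p-th powers dominates T^(p-1) times the difference;
this makes the drop in 𝒯^p control the drop in 𝒯 linearly. -/
lemma rpow_sub_rpow_ge {T T' p : ℝ} (hp : 1 ≤ p) (hT' : 0 ≤ T') (h : T' ≤ T) (hT : 0 < T) :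
    T ^ (p - 1) * (T - T') ≤ T ^ p - T' ^ p := by
  have h1 : T ^ p = T ^ (p - 1) * T := by
    rw [← Real.rpow_add_one hT.ne', sub_add_cancel]
  have h2 : T' ^ p ≤ T ^ (p - 1) * T' := by
    rcases hT'.eq_or_lt with h0 | h0
    · rw [← h0, Real.zero_rpow (by linarith), mul_zero]
    · rw [← sub_add_cancel p 1, Real.rpow_add_one h0.ne', add_sub_cancel_right]
      exact mul_le_mul_of_nonneg_right (Real.rpow_le_rpow hT' h (by linarith)) hT'
  rw [h1, mul_sub]; linarith

/-- Comparison of a ground state with its truncation at a level `k` where `V` is nonpositive. -/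
lemma IsGroundState.energy_superlevel_le (H : IsGroundState c p V φ) (hc : 0 < c) (hp : 1 ≤ p)
    (hV0 : V 0 = 0) (hT : 0 < gradientEnergy φ) (hk : 0 ≤ k) {F : SpaceTime n β → ℝ}
    (hF : Integrable F) (hVF : ∀ z, k < φ z → V k - V (φ z) ≤ F z) (hF0 : ∀ z, φ z ≤ k → 0 ≤ F z) :
    ∫ z, (if k < φ z then ‖weakGradX φ z‖ ^ 2 + weakDTau φ z ^ 2 else 0) ≤
      2 / min (c * gradientEnergy φ ^ (p - 1)) 1 * ∫ z, F z := by
  have HW := H.config.1.hasWGrad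
  obtain ⟨fi1, fi2, fi3⟩ := H.finite
  set g := weakGradX φ with hg
  set h := weakDTau φ with hh
  have hs : NullMeasurableSet {z | k < φ z} :=
    nullMeasurableSet_lt aemeasurable_const HW.memφ.aestronglyMeasurable.aemeasurable
  have Hk := HW.min_const k
  have ind : ∀ {f : SpaceTime n β → ℝ}, Integrable f →
      Integrable (fun z => if k < φ z then f z else 0) := fun {f} hf => hf.indicator₀ hs
  have indc : ∀ {f : SpaceTime n β → ℝ}, Integrable f →
      Integrable (fun z => if k < φ z then 0 else f z) := fun {f} hf => by
    refine (hf.sub (ind hf)).congr (ae_of_all _ fun z => ?_)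
    by_cases hz : k < φ z <;> simp [hz]
  have hVk : Integrable (fun z => if k < φ z then V k else 0) := by
    rcases hk.eq_or_lt with h0 | h0
    · simp [← h0, hV0]
    · have : Integrable ({z | k < φ z}.indicator fun _ => V k) :=
        (integrableOn_const (H.config.2.measure_superlevel_lt_top h0).ne).integrable_indicator₀ hs
      exact this
  have sq1 : ∀ z, ‖if k < φ z then 0 else g z‖ ^ 2 = if k < φ z then 0 else ‖g z‖ ^ 2 := fun z => by
    split_ifs <;> simp
  have sq2 : ∀ z, (if k < φ z then 0 else h z) ^ 2 = if k < φ z then 0 else h z ^ 2 := fun z => by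
    split_ifs <;> simp
  have eV : ∀ z, V (min (φ z) k) = (if k < φ z then 0 else V (φ z)) + if k < φ z then V k else 0 :=
    fun z => by
      by_cases hz : k < φ z
      · simp [hz, min_eq_right hz.le]
      · simp [hz, min_eq_left (not_lt.1 hz)]
  have hfin : FiniteAction V (fun z => min (φ z) k) := by
    rw [Hk.finiteAction_iff]
    simp only [sq1, sq2, eV]
    exact ⟨indc fi1, indc fi2, (indc fi3).add hVk⟩
  -- The truncation is a competitor with nonnegative value, while φ has value 0; so the gradient and
  -- kinetic energy lost by truncating cannot exceed the potential energy gained.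
  have h1 := H.nonneg _ ⟨Hk.isW12Loc, H.config.2.min_const hk⟩ hfin
  have h0 := H.eq_zero
  set T := gradientEnergy φ with hTd
  set T' := gradientEnergy (fun z => min (φ z) k) with hTd'
  have dT : T - T' = ∫ z, (1 / 2) * (if k < φ z then ‖g z‖ ^ 2 else 0) := by
    rw [hTd, hTd', Hk.gradientEnergy_eq, gradientEnergy]
    simp only [sq1]
    rw [← integral_sub (fi1.const_mul _) ((indc fi1).const_mul _)]
    refine integral_congr_ae (ae_of_all _ fun z => ?_)
    simp only
    split_ifs <;> ring
  have dK : kineticEnergy φ - kineticEnergy (fun z => min (φ z) k) =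
      ∫ z, (1 / 2) * (if k < φ z then h z ^ 2 else 0) := by
    rw [Hk.kineticEnergy_eq, kineticEnergy]
    simp only [sq2]
    rw [← integral_sub (fi2.const_mul _) ((indc fi2).const_mul _)]
    refine integral_congr_ae (ae_of_all _ fun z => ?_)
    simp only
    split_ifs <;> ring
  have dV : potentialEnergy V (fun z => min (φ z) k) - potentialEnergy V φ ≤ ∫ z, F z := by
    simp only [potentialEnergy, eV]
    have hi : Integrable (fun z => (if k < φ z then 0 else V (φ z)) + if k < φ z then V k else 0) :=
      (indc fi3).add hVk
    rw [← integral_sub hi fi3]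
    refine integral_mono (hi.sub fi3) hF fun z => ?_
    simp only
    by_cases hz : k < φ z
    · simp only [hz, if_true, zero_add]; exact hVF z hz
    · simp only [hz, if_false, add_zero, sub_self]; exact hF0 z (not_lt.1 hz)
  have dT0 : 0 ≤ T - T' := by
    rw [dT]; exact integral_nonneg fun z => by dsimp only [Pi.zero_apply]; split_ifs <;> positivity
  have dK0 : 0 ≤ kineticEnergy φ - kineticEnergy (fun z => min (φ z) k) := by
    rw [dK]; exact integral_nonneg fun z => by dsimp only [Pi.zero_apply]; split_ifs <;> positivity
  have hsum : ∫ z, (if k < φ z then ‖g z‖ ^ 2 + h z ^ 2 else 0) =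
      2 * ((T - T') + (kineticEnergy φ - kineticEnergy (fun z => min (φ z) k))) := by
    rw [dT, dK, ← integral_add ((ind fi1).const_mul _) ((ind fi2).const_mul _),
      ← integral_const_mul]
    refine integral_congr_ae (ae_of_all _ fun z => ?_)
    simp only
    split_ifs <;> ring
  have hconv := rpow_sub_rpow_ge hp (gradientEnergy_nonneg _) (sub_nonneg.1 dT0) hT
  have hconv' := mul_le_mul_of_nonneg_left hconv hc.le
  have hm : 0 < min (c * T ^ (p - 1)) 1 :=
    lt_min (mul_pos hc (Real.rpow_pos_of_pos hT _)) one_pos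
  rw [hsum, div_mul_eq_mul_div, le_div_iff₀ hm]
  have h3 := mul_le_mul_of_nonneg_right (min_le_left (c * T ^ (p - 1)) 1) dT0
  have h4 := mul_le_mul_of_nonneg_right (min_le_right (c * T ^ (p - 1)) 1) dK0
  nlinarith

/-- Ground states are bounded from above. -/
lemma IsGroundState.exists_upper_bound (hn : 3 ≤ n) (H : IsGroundState c p V φ) (hc : 0 < c)
    (hp : 1 ≤ p) (hV0 : V 0 = 0) (hlsc : LowerSemicontinuous V) {b B : ℝ} (hb : 0 ≤ b)
    (hB : B ≤ sobolevExp n) (hVb : ∀ s, 0 ≤ s → -(b * s ^ B) ≤ V s) (hT : 0 < gradientEnergy φ) :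
    ∃ M, ∀ᵐ z, φ z ≤ M := by
  have HW := H.config.1.hasWGrad
  have hm : 0 < min (c * gradientEnergy φ ^ (p - 1)) 1 :=
    lt_min (mul_pos hc (Real.rpow_pos_of_pos hT _)) one_pos
  refine Bounce.exists_upper_bound hn HW H.config.2 H.finite.1 H.finite.2.1
    (A := 2 / min (c * gradientEnergy φ ^ (p - 1)) 1 * b) (by positivity) fun s hs hi => ?_
  -- Truncating at s itself fails if V(s) is large. The level k is the largest point of [0, s] with
  -- V ≤ 0; it exists because lower semicontinuity makes that set closed and V(0) = 0. Between k and
  -- s, V is positive, so truncation lowers the potential energy there; above s the growth bound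
  -- gives at most b φ^B, hence at most b φ^N as φ ≥ 1.
  have hcpt : IsCompact (Icc 0 s ∩ V ⁻¹' Iic 0) :=
    isCompact_Icc.inter_right (hlsc.isClosed_preimage 0)
  obtain ⟨k, ⟨⟨hk0, hks⟩, hVk⟩, hkmax⟩ := hcpt.exists_isGreatest
    ⟨0, ⟨le_rfl, by linarith⟩, by simp [hV0]⟩
  have h1 := H.energy_superlevel_le hc hp hV0 hT hk0 (hi.const_mul b) (fun z hz => ?_) (fun z hz => ?_)
  · rw [integral_const_mul, ← mul_assoc] at h1
    refine le_trans (integral_mono_of_nonneg (ae_of_all _ fun z => ?_) ?_ (ae_of_all _ fun z => ?_)) h1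
    · simp only [Pi.zero_apply]; split_ifs <;> positivity
    · exact (H.finite.1.add H.finite.2.1).indicator₀
        (nullMeasurableSet_lt aemeasurable_const HW.memφ.aestronglyMeasurable.aemeasurable)
    · by_cases hz : s < φ z
      · simp [hz, hks.trans_lt hz]
      · simp only [hz, if_false]; split_ifs <;> positivity
  · have hVk' : V k ≤ 0 := hVk
    by_cases hzs : s < φ z
    · simp only [hzs, if_true]
      have h1z : 1 ≤ φ z := hs.trans hzs.le
      have h2 := hVb (φ z) (by linarith)
      have h3 := mul_le_mul_of_nonneg_left (Real.rpow_le_rpow_of_exponent_le h1z hB) hb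
      linarith
    · simp only [hzs, if_false, mul_zero]
      have : 0 < V (φ z) := by
        by_contra hc'
        exact absurd (hkmax ⟨⟨hk0.trans hz.le, not_lt.1 hzs⟩, not_lt.1 hc'⟩) (not_le.2 hz)
      linarith
  · rw [if_neg (not_lt.2 (hz.trans hks)), mul_zero]

lemma HasWGrad.neg (H : HasWGrad φ g h) : HasWGrad (fun z => -φ z) (fun z => -g z) (fun z => -h z) := by
  simpa using H.const_mul (-1)

lemma gradientEnergy_neg (H : IsW12Loc φ) : gradientEnergy (fun z => -φ z) = gradientEnergy φ := by
  rw [H.hasWGrad.neg.gradientEnergy_eq, gradientEnergy]; simp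

lemma kineticEnergy_neg (H : IsW12Loc φ) : kineticEnergy (fun z => -φ z) = kineticEnergy φ := by
  rw [H.hasWGrad.neg.kineticEnergy_eq, kineticEnergy]; simp

lemma IsConfig.neg (H : IsConfig φ) : IsConfig (fun z => -φ z) :=
  ⟨H.1.hasWGrad.neg.isW12Loc, by simpa only [VanishesAtInfinity, abs_neg] using H.2⟩

lemma FiniteAction.neg (hφ : IsConfig φ) (H : FiniteAction V φ) :
    FiniteAction (fun s => V (-s)) (fun z => -φ z) := by
  rw [hφ.1.hasWGrad.neg.finiteAction_iff]
  simp only [norm_neg, neg_sq, neg_neg]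
  exact H

/-- Reflecting both the field and the potential turns the lower bound on φ into an upper bound. -/
lemma IsGroundState.neg (H : IsGroundState c p V φ) :
    IsGroundState c p (fun s => V (-s)) (fun z => -φ z) := by
  refine ⟨H.config.neg, H.finite.neg H.config, ?_, fun ψ hψ hf => ?_⟩
  · rw [gradientEnergy_neg H.config.1, kineticEnergy_neg H.config.1]
    simpa [potentialEnergy] using H.eq_zero
  · have h1 := H.nonneg _ hψ.neg (by simpa using hf.neg hψ)
    rwa [gradientEnergy_neg hψ.1, kineticEnergy_neg hψ.1] at h1

/-- Ground states of admissible potentials are essentially bounded. -/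
lemma IsGroundState.exists_bound (hn : 3 ≤ n) (H : IsGroundState c p V φ) (hc : 0 < c)
    (hp : 1 ≤ p) (hV : Admissible (n + 1) V) (hT : 0 < gradientEnergy φ) :
    ∃ M, ∀ᵐ z, |φ z| ≤ M := by
  have hexp : 2 * ((n + 1 : ℕ) : ℝ) / (((n + 1 : ℕ) : ℝ) - 2) = sobolevExp n := by
    rw [sobolevExp]; push_cast; congr 1; ring
  obtain ⟨A, B, a, b, hA, hAB, hB, ha, hb, hg⟩ := hV.growth_pos
  obtain ⟨A', B', a', b', hA', hAB', hB', ha', hb', hg'⟩ := hV.growth_neg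
  rw [hexp] at hB hB'
  obtain ⟨M, hM⟩ := H.exists_upper_bound hn hc hp hV.map_zero hV.lowerSemicontinuous hb.le hB.le
    (fun s hs => by
      have h1 := hg s hs
      have h2 : 0 ≤ a * |s| ^ A := mul_nonneg ha.le (Real.rpow_nonneg (abs_nonneg _) _)
      rw [abs_of_nonneg hs] at h1 h2
      linarith) hT
  obtain ⟨M', hM'⟩ := H.neg.exists_upper_bound hn hc hp (by simp [hV.map_zero])
    (hV.lowerSemicontinuous.comp continuous_neg) hb'.le hB'.le
    (fun s hs => by
      have h1 := hg' (-s) (by linarith)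
      have h2 : 0 ≤ a' * |-s| ^ A' := mul_nonneg ha'.le (Real.rpow_nonneg (abs_nonneg _) _)
      rw [abs_neg, abs_of_nonneg hs] at h1 h2
      linarith) (by rwa [gradientEnergy_neg H.config.1])
  refine ⟨max M M', ?_⟩
  filter_upwards [hM, hM'] with z h1 h2
  exact abs_le.2 ⟨by linarith [le_max_right M M'], h1.trans (le_max_left _ _)⟩

end truncation

/-! ### The Euler–Lagrange equation of a bounded ground state -/

section eulerLagrange

variable {φ : SpaceTime n β → ℝ} {g : SpaceTime n β → Space n} {h : SpaceTime n β → ℝ}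
  {V : ℝ → ℝ} {c p M : ℝ} {η : SpaceTime n β → ℝ}

lemma VanishesAtInfinity.add_test (H : VanishesAtInfinity φ) (hη : IsTest η) :
    VanishesAtInfinity (fun z => φ z + η z) := by
  intro ε hε
  obtain ⟨K, hK, h⟩ := H ε hε
  refine ⟨K ∪ Prod.fst '' tsupport η, hK.union (hη.2.isCompact.image continuous_fst), ?_⟩
  filter_upwards [h] with z hz hzK
  have h1 : η z = 0 := image_eq_zero_of_notMem_tsupport fun hc => hzK (Or.inr ⟨z, hc, rfl⟩)
  rw [h1, add_zero]
  exact hz fun hc => hzK (Or.inl hc)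

lemma exists_lipschitzOnWith_Icc (hV : LocallyLipschitz V) (R : ℝ) :
    ∃ L : ℝ≥0, LipschitzOnWith L V (Icc (-R) R) :=
  hV.locallyLipschitzOn.exists_lipschitzOnWith_of_compact isCompact_Icc

lemma integral_add_three {f₁ f₂ f₃ : SpaceTime n β → ℝ} (h₁ : Integrable f₁) (h₂ : Integrable f₂)
    (h₃ : Integrable f₃) :
    ∫ z, (f₁ z + f₂ z + f₃ z) = (∫ z, f₁ z) + (∫ z, f₂ z) + ∫ z, f₃ z := by
  have h₁₂ : Integrable (fun z => f₁ z + f₂ z) := h₁.add h₂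
  rw [integral_add h₁₂ h₃, integral_add h₁ h₂]

lemma integrable_inner_of_memLp {F : Type*} [NormedAddCommGroup F] [InnerProductSpace ℝ F]
    {u v : SpaceTime n β → F} (hu : MemLp u 2) (hv : MemLp v 2) :
    Integrable (fun z => inner ℝ (u z) (v z)) :=
  (hu.norm.integrable_mul hv.norm).mono' (hu.1.inner hv.1)
    (ae_of_all _ fun _ => norm_inner_le_norm _ _)

/-- Along a line of configurations the gradient and kinetic energies are quadratic polynomials in t,
so their derivatives at 0 can be read off. -/
lemma integral_quadratic {F : Type*} [NormedAddCommGroup F] [InnerProductSpace ℝ F]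
    {u v : SpaceTime n β → F} (hu : MemLp u 2) (hv : MemLp v 2) (t : ℝ) :
    Integrable (fun z => ‖u z + t • v z‖ ^ 2) ∧
    ∫ z, (1 / 2) * ‖u z + t • v z‖ ^ 2 = (∫ z, (1 / 2) * ‖u z‖ ^ 2) +
      t * (∫ z, inner ℝ (v z) (u z)) + t ^ 2 * ∫ z, (1 / 2) * ‖v z‖ ^ 2 := by
  have i1 := (memLp_two_iff_integrable_sq_norm hu.1).1 hu
  have i2 := (memLp_two_iff_integrable_sq_norm hv.1).1 hv
  have i3 : Integrable (fun z => inner ℝ (v z) (u z)) := integrable_inner_of_memLp hv hu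
  have e : ∀ z, ‖u z + t • v z‖ ^ 2 = ‖u z‖ ^ 2 + 2 * t * inner ℝ (v z) (u z) + t ^ 2 * ‖v z‖ ^ 2 :=
    fun z => by
      rw [norm_add_sq_real, inner_smul_right, norm_smul, mul_pow, Real.norm_eq_abs, sq_abs,
        real_inner_comm]
      ring
  refine ⟨by simp only [e]; exact (i1.add (i3.const_mul _)).add (i2.const_mul _), ?_⟩
  have e2 : ∀ z, (1 / 2) * ‖u z + t • v z‖ ^ 2 = (1 / 2) * ‖u z‖ ^ 2 + t * inner ℝ (v z) (u z) +
      t ^ 2 * ((1 / 2) * ‖v z‖ ^ 2) := fun z => by rw [e]; ring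
  simp only [e2]
  rw [integral_add_three (i1.const_mul _) (i3.const_mul _) ((i2.const_mul _).const_mul _),
    integral_const_mul t, integral_const_mul (t ^ 2)]

/-- Differentiability of the potential energy along test functions at a bounded configuration. -/
lemma hasDerivAt_potentialEnergy (hφm : AEStronglyMeasurable φ) (hM : ∀ᵐ z, |φ z| ≤ M)
    (hVd : Differentiable ℝ V) (hVl : LocallyLipschitz V) (hVi : Integrable (fun z => V (φ z)))
    (hη : IsTest η) :
    (∀ t ∈ Ioo (-1 : ℝ) 1, Integrable (fun z => V (φ z + t * η z))) ∧
    Integrable (fun z => η z * deriv V (φ z)) ∧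
    HasDerivAt (fun t : ℝ => ∫ z, V (φ z + t * η z)) (∫ z, η z * deriv V (φ z)) 0 := by
  obtain ⟨m, hm0, hm⟩ := hη.exists_bound
  -- For |t| < 1 the values φ + tη stay in this interval a.e., so the local Lipschitz constant of V
  -- dominates the difference quotients by L |η|.
  obtain ⟨L, hL⟩ := exists_lipschitzOnWith_Icc hVl (M + m)
  have hmem : ∀ t ∈ Ioo (-1 : ℝ) 1, ∀ z, |φ z| ≤ M → φ z + t * η z ∈ Icc (-(M + m)) (M + m) := by
    intro t ht z hz
    have h1 : |t * η z| ≤ m := by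
      rw [abs_mul]
      calc |t| * |η z| ≤ 1 * m := mul_le_mul (abs_lt.2 ht).le (hm z) (abs_nonneg _) zero_le_one
        _ = m := one_mul m
    exact abs_le.1 ((abs_add_le _ _).trans (add_le_add hz h1))
  have hmeas : ∀ t : ℝ, AEStronglyMeasurable (fun z => V (φ z + t * η z)) := fun t =>
    hVd.continuous.comp_aestronglyMeasurable
      (hφm.add (hη.continuous.aestronglyMeasurable.const_mul t))
  have hlip : ∀ z, |φ z| ≤ M → LipschitzOnWith (Real.nnabs (L * |η z|)) (fun t => V (φ z + t * η z))
      (Ioo (-1) 1) := by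
    intro z hz
    refine LipschitzOnWith.of_dist_le_mul fun t ht s hs => ?_
    refine (hL.dist_le_mul _ (hmem t ht z hz) _ (hmem s hs z hz)).trans (le_of_eq ?_)
    rw [Real.dist_eq, Real.dist_eq, Real.coe_nnabs, abs_mul, abs_abs, NNReal.abs_eq, mul_assoc,
      ← abs_mul]
    congr 2; ring
  have hbi : Integrable (fun z => (L : ℝ) * |η z|) := hη.integrable.abs.const_mul _
  have hd := hasDerivAt_integral_of_dominated_loc_of_lip (μ := volume)
    (F := fun (t : ℝ) z => V (φ z + t * η z)) (F' := fun z => η z * deriv V (φ z)) (x₀ := 0)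
    (s := Ioo (-1) 1) (bound := fun z => L * |η z|)
    (Ioo_mem_nhds (by norm_num) (by norm_num)) (Eventually.of_forall hmeas) (by simpa using hVi)
    (hη.continuous.aestronglyMeasurable.mul
      ((measurable_deriv V).comp_aemeasurable hφm.aemeasurable).aestronglyMeasurable)
    (hM.mono hlip) hbi (ae_of_all _ fun z => by
      have h1 : HasDerivAt V (deriv V (φ z)) (φ z + 0 * η z) := by
        simpa using (hVd (φ z)).hasDerivAt
      have h2 : HasDerivAt (fun t : ℝ => φ z + t * η z) (η z) 0 := by
        simpa using ((hasDerivAt_id (0 : ℝ)).mul_const (η z)).const_add (φ z)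
      rw [mul_comm]
      exact h1.comp (0 : ℝ) h2)
  refine ⟨fun t ht => ?_, hd.1, hd.2⟩
  have h3 : Integrable (fun z => V (φ z + t * η z) - V (φ z)) := by
    refine hbi.mono' ((hmeas t).sub hVi.1) ?_
    filter_upwards [hM] with z hz
    have h4 := (hlip z hz).dist_le_mul t ht 0 ⟨by norm_num, by norm_num⟩
    simp only [zero_mul, add_zero, Real.dist_eq, Real.coe_nnabs, sub_zero] at h4
    rw [abs_of_nonneg (by positivity : 0 ≤ (L : ℝ) * |η z|)] at h4
    refine h4.trans (mul_le_of_le_one_right (by positivity) (abs_lt.2 ht).le)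
  exact (h3.add hVi).congr (ae_of_all _ fun z => by simp)

/-- A bounded ground state with the right scale is a saddle point of the action. -/
lemma IsGroundState.isSaddlePoint (H : IsGroundState c p V φ) (hT : 0 < gradientEnergy φ)
    (hcp : c * (p * gradientEnergy φ ^ (p - 1)) = 1) (hM : ∀ᵐ z, |φ z| ≤ M)
    (hVd : Differentiable ℝ V) (hVl : LocallyLipschitz V) : IsSaddlePoint V φ := by
  have HW := H.config.1.hasWGrad
  have hφm := HW.memφ.aestronglyMeasurable
  refine ⟨H.config, ?_, fun η hη => ?_⟩
  -- The extra 1 makes the values of φ interior points, where the Lipschitz constant bounds V'.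
  · obtain ⟨L, hL⟩ := exists_lipschitzOnWith_Icc hVl (M + 1)
    refine MemL2Loc.of_le_mul (C := L)
      (Continuous.memL2Loc (continuous_const (y := (1 : ℝ)))) ?_ ?_
    · exact ((measurable_deriv V).comp_aemeasurable hφm.aemeasurable).aestronglyMeasurable
    · filter_upwards [hM] with z hz
      rw [norm_one, mul_one]
      refine norm_deriv_le_of_lipschitzOn (s := Icc (-(M + 1)) (M + 1)) ?_ hL
      exact Icc_mem_nhds (by linarith [(abs_le.1 hz).1]) (by linarith [(abs_le.1 hz).2])
  set g := weakGradX φ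
  set h := weakDTau φ
  have mg : MemLp g 2 := (memLp_two_iff_integrable_sq_norm HW.memg.aestronglyMeasurable).2 H.finite.1
  have mh : MemLp h 2 := (memLp_two_iff_integrable_sq HW.memh.aestronglyMeasurable).2 H.finite.2.1
  have mgη : MemLp (gradX η) 2 :=
    hη.continuous_gradX.memLp_of_hasCompactSupport hη.hasCompactSupport_gradX
  have mhη : MemLp (dTau η) 2 := hη.dTau.memLp 2
  obtain ⟨hV1, hV2, hV3⟩ := hasDerivAt_potentialEnergy hφm hM hVd hVl H.finite.2.2 hη
  have Ht : ∀ t : ℝ, HasWGrad (fun z => φ z + t * η z) (fun z => g z + t • gradX η z)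
      (fun z => h z + t * dTau η z) := fun t => HW.add (hη.hasWGrad.const_mul t)
  have eT : ∀ t : ℝ, gradientEnergy (fun z => φ z + t * η z) = gradientEnergy φ +
      t * (∫ z, inner ℝ (gradX η z) (g z)) + t ^ 2 * ∫ z, (1 / 2) * ‖gradX η z‖ ^ 2 := fun t => by
    rw [(Ht t).gradientEnergy_eq, (integral_quadratic mg mgη t).2]; rfl
  have eK : ∀ t : ℝ, kineticEnergy (fun z => φ z + t * η z) = kineticEnergy φ +
      t * (∫ z, dTau η z * h z) + t ^ 2 * ∫ z, (1 / 2) * dTau η z ^ 2 := fun t => by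
    have := (integral_quadratic mh mhη t).2
    simp only [Real.norm_eq_abs, sq_abs, smul_eq_mul] at this
    rw [(Ht t).kineticEnergy_eq, this]
    have e : ∀ z, inner ℝ (dTau η z) (h z) = dTau η z * h z := fun z => by simp [mul_comm]
    simp only [e]
    rfl
  set a := ∫ z, inner ℝ (gradX η z) (g z) with ha
  set b := ∫ z, dTau η z * h z with hb
  have hquad : ∀ x y q : ℝ, HasDerivAt (fun t : ℝ => q + t * x + t ^ 2 * y) x 0 := fun x y q => by
    have h1 := (((hasDerivAt_id (0 : ℝ)).mul_const x).const_add q).add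
      (((hasDerivAt_id (0 : ℝ)).pow 2).mul_const y)
    simp only [id, one_mul, Nat.cast_ofNat, mul_zero, Nat.add_one_sub_one, pow_one, mul_one, zero_mul,
      add_zero] at h1
    exact h1
  have hTd : HasDerivAt (fun t : ℝ => c * gradientEnergy (fun z => φ z + t * η z) ^ p)
      (c * (a * p * gradientEnergy φ ^ (p - 1))) 0 := by
    simp only [eT]
    have h1 := ((hquad a (∫ z, (1 / 2) * ‖gradX η z‖ ^ 2) (gradientEnergy φ)).rpow_const (p := p)
      (Or.inl (by simpa using hT.ne'))).const_mul c
    simpa using h1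
  have hKd : HasDerivAt (fun t : ℝ => kineticEnergy (fun z => φ z + t * η z)) b 0 := by
    simp only [eK]; exact hquad _ _ _
  have hF := (hTd.add hKd).add hV3
  have hmin : IsLocalMin ((fun t : ℝ => c * gradientEnergy (fun z => φ z + t * η z) ^ p) +
      (fun t : ℝ => kineticEnergy (fun z => φ z + t * η z)) +
      fun t : ℝ => ∫ z, V (φ z + t * η z)) 0 := by
    filter_upwards [Ioo_mem_nhds (by norm_num : (-1 : ℝ) < 0) (by norm_num : (0 : ℝ) < 1)] with t ht
    simp only [Pi.add_apply, zero_mul, add_zero]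
    have h0 := H.eq_zero
    rw [potentialEnergy] at h0
    rw [h0]
    refine H.nonneg _ ⟨(Ht t).isW12Loc, H.config.2.add_test (hη.const_mul t)⟩ ?_
    rw [(Ht t).finiteAction_iff]
    refine ⟨(integral_quadratic mg mgη t).1, ?_, hV1 t ht⟩
    simpa using (integral_quadratic mh mhη t).1
  have h0 := hmin.hasDerivAt_eq_zero hF
  have i1 : Integrable (fun z => inner ℝ (gradX η z) (g z)) := integrable_inner_of_memLp mgη mg
  have i2 : Integrable (fun z => dTau η z * h z) := mhη.integrable_mul mh
  rw [integral_add_three i2 i1 hV2, ← ha, ← hb]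
  -- At the right scale the outer derivative c p 𝒯^(p-1) equals 1, so the stationarity of F is the
  -- weak equation.
  have : c * (a * p * gradientEnergy φ ^ (p - 1)) = a := by linear_combination a * hcp
  rw [this] at h0
  linarith

end eulerLagrange

/-! ### The chain rule for a locally Lipschitz potential -/

section chainRule

lemma tendsto_mul_sin_div (x : ℝ) :
    Tendsto (fun k : ℕ => ((k : ℝ) + 1) * Real.sin (x / ((k : ℝ) + 1))) atTop (𝓝 x) := by
  have h1 : HasDerivAt (fun t : ℝ => Real.sin (x * t)) x 0 := by
    have := ((hasDerivAt_id (0 : ℝ)).const_mul x).sin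
    simpa using this
  have h2 : Tendsto (fun k : ℕ => 1 / ((k : ℝ) + 1)) atTop (𝓝[≠] 0) :=
    tendsto_nhdsWithin_iff.2 ⟨tendsto_one_div_add_atTop_nhds_zero_nat,
      Eventually.of_forall fun k => by
        simp only [mem_compl_iff, mem_singleton_iff]; positivity⟩
  have h3 := h1.tendsto_slope_zero.comp h2
  refine h3.congr fun k => ?_
  simp [div_eq_mul_inv]

/-- Truncations of a locally Lipschitz function by globally Lipschitz ones, with control of the
derivatives. -/
lemma exists_truncation {V : ℝ → ℝ} (hV : Differentiable ℝ V) (hl : LocallyLipschitz V) :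
    ∃ (G : ℕ → ℝ → ℝ) (C : ℝ), (∀ k, Differentiable ℝ (G k)) ∧ (∀ k, ∃ L, LipschitzWith L (G k)) ∧
      (∀ k s, |G k s| ≤ |V s|) ∧ (∀ k s, |deriv (G k) s| ≤ |deriv V s| + C) ∧
      (∀ s, Tendsto (fun k => G k s) atTop (𝓝 (V s))) ∧
      ∀ s, Tendsto (fun k => deriv (G k) s) atTop (𝓝 (deriv V s)) := by
  let χ : ContDiffBump (0 : ℝ) := ⟨1, 2, one_pos, one_lt_two⟩
  have hχd : ContDiff ℝ 1 χ := χ.contDiff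
  have hχc : HasCompactSupport (deriv χ) := χ.hasCompactSupport.deriv
  obtain ⟨C, hC⟩ := hχc.exists_bound_of_continuous hχd.continuous_deriv_one
  have hC0 : 0 ≤ C := (norm_nonneg _).trans (hC 0)
  have hχd' : Differentiable ℝ χ := hχd.differentiable (by norm_num)
  let κ : ℕ → ℝ := fun k => (k : ℝ) + 1
  have hκ : ∀ k, 1 ≤ κ k := fun k => by simp [κ]
  have hκ0 : ∀ k, 0 < κ k := fun k => by linarith [hκ k]
  have hχ1 : ∀ s, |χ s| ≤ 1 := fun s => by rw [abs_of_nonneg χ.nonneg]; exact χ.le_one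
  -- The sine keeps |G| ≤ |V| and bounds G by κ. The cutoff, which makes G globally Lipschitz, acts
  -- at the larger scale κ², so its derivative contributes at most κ · C/κ² = C/κ, which tends to 0.
  let G : ℕ → ℝ → ℝ := fun k s => κ k * Real.sin (V s / κ k) * χ (s / κ k ^ 2)
  let D : ℕ → ℝ → ℝ := fun k s => Real.cos (V s / κ k) * deriv V s * χ (s / κ k ^ 2) +
    κ k * Real.sin (V s / κ k) * (deriv χ (s / κ k ^ 2) / κ k ^ 2)
  have hG : ∀ k s, HasDerivAt (G k) (D k s) s := fun k s => by
    have h1 := (((hV s).hasDerivAt.div_const (κ k)).sin).const_mul (κ k)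
    have h2 : HasDerivAt (fun s => χ (s / κ k ^ 2)) (deriv χ (s / κ k ^ 2) * (1 / κ k ^ 2)) s :=
      HasDerivAt.comp (h₂ := fun y => χ y) (h := fun s => s / κ k ^ 2) s
        (hχd' (s / κ k ^ 2)).hasDerivAt ((hasDerivAt_id s).div_const _)
    refine (h1.mul h2).congr_deriv ?_
    have := (hκ0 k).ne'
    simp only [D]
    field_simp
  have hGd : ∀ k s, deriv (G k) s = D k s := fun k s => (hG k s).deriv
  have hsin : ∀ k s, |κ k * Real.sin (V s / κ k) * (deriv χ (s / κ k ^ 2) / κ k ^ 2)| ≤ C / κ k := by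
    intro k s
    have := hκ0 k
    rw [abs_mul, abs_mul, abs_div, abs_of_pos this, abs_of_pos (pow_pos this 2)]
    have h1 := hC (s / κ k ^ 2)
    rw [Real.norm_eq_abs] at h1
    have h2 := Real.abs_sin_le_one (V s / κ k)
    calc _ ≤ κ k * 1 * (C / κ k ^ 2) := by gcongr
      _ = _ := by field_simp
  have hcos : ∀ k s, |Real.cos (V s / κ k) * deriv V s * χ (s / κ k ^ 2)| ≤ |deriv V s| := by
    intro k s
    rw [abs_mul, abs_mul]
    calc _ ≤ 1 * |deriv V s| * 1 := by
          gcongr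
          · exact Real.abs_cos_le_one _
          · exact hχ1 _
      _ = _ := by ring
  have hCκ : ∀ k, C / κ k ≤ C := fun k => div_le_self hC0 (hκ k)
  have hlim : ∀ x : ℝ, Tendsto (fun k => x / κ k) atTop (𝓝 0) := fun x => by
    have := (tendsto_one_div_add_atTop_nhds_zero_nat (𝕜 := ℝ)).const_mul x
    simpa [κ, div_eq_mul_inv] using this
  have hlim2 : ∀ x : ℝ, Tendsto (fun k => χ (x / κ k ^ 2)) atTop (𝓝 1) := fun x => by
    have h1 : Tendsto (fun k => x / κ k ^ 2) atTop (𝓝 0) := by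
      have := (hlim x).mul (hlim 1)
      rw [zero_mul] at this
      refine this.congr fun k => ?_
      rw [sq, div_mul_div_comm, mul_one]
    have h2 := (χ.continuous.tendsto 0).comp h1
    rwa [χ.one_of_mem_closedBall (Metric.mem_closedBall_self zero_le_one)] at h2
  refine ⟨G, C, fun k s => (hG k s).differentiableAt, fun k => ?_, fun k s => ?_, fun k s => ?_,
    fun s => ?_, fun s => ?_⟩
  · obtain ⟨L, hL⟩ := exists_lipschitzOnWith_Icc hl (2 * κ k ^ 2 + 1)
    have hk2 : 0 < κ k ^ 2 := pow_pos (hκ0 k) 2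
    have hb : ∀ s, |Real.cos (V s / κ k) * deriv V s * χ (s / κ k ^ 2)| ≤ L := by
      intro s
      by_cases hs : |s| ≤ 2 * κ k ^ 2
      · refine (hcos k s).trans (norm_deriv_le_of_lipschitzOn ?_ hL)
        exact Icc_mem_nhds (by linarith [(abs_le.1 hs).1]) (by linarith [(abs_le.1 hs).2])
      · have : χ (s / κ k ^ 2) = 0 := by
          refine χ.zero_of_le_dist ?_
          rw [dist_zero_right, Real.norm_eq_abs, abs_div, abs_of_pos hk2, le_div_iff₀ hk2]
          exact (not_le.1 hs).le
        rw [this, mul_zero, abs_zero]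
        exact L.2
    refine ⟨L + ⟨C, hC0⟩, lipschitzWith_of_nnnorm_deriv_le (fun s => (hG k s).differentiableAt)
      fun s => ?_⟩
    rw [← NNReal.coe_le_coe, coe_nnnorm, hGd]
    exact (abs_add_le _ _).trans (add_le_add (hb s) ((hsin k s).trans (hCκ k)))
  · have := hκ0 k
    simp only [G]
    rw [abs_mul, abs_mul, abs_of_pos this]
    have h1 : |Real.sin (V s / κ k)| ≤ |V s / κ k| := Real.abs_sin_le_abs
    rw [abs_div, abs_of_pos this] at h1
    calc _ ≤ κ k * (|V s| / κ k) * 1 := by gcongr; exact hχ1 _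
      _ = _ := by field_simp
  · rw [hGd]
    exact (abs_add_le _ _).trans (add_le_add (hcos k s) ((hsin k s).trans (hCκ k)))
  · simpa using (tendsto_mul_sin_div (V s)).mul (hlim2 s)
  · simp only [hGd]
    have h1 := ((((Real.continuous_cos.tendsto 0).comp (hlim (V s))).mul_const (deriv V s)).mul
      (hlim2 s)).add (squeeze_zero_norm (hsin · s) (hlim C))
    simpa using h1

variable {ψ f : SpaceTime n β → ℝ} {V : ℝ → ℝ} {v : Space n × ℝ}

/-- The chain rule for `V(ψ)` under integrability assumptions on `V(ψ)` and `V'(ψ)`. -/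
lemma IsWeakDir.comp_locallyLipschitz (hψ : MemL2Loc ψ) (hf : MemL2Loc f) (H : IsWeakDir v ψ f)
    (hV : Differentiable ℝ V) (hl : LocallyLipschitz V)
    (hVi : LocallyIntegrable (fun z => V (ψ z))) (hVd : MemL2Loc (fun z => deriv V (ψ z))) :
    IsWeakDir v (fun z => V (ψ z)) (fun z => deriv V (ψ z) * f z) := by
  intro η hη
  obtain ⟨G, C, hGd, hGl, hG1, hG2, hG3, hG4⟩ := exists_truncation hV hl
  have hψm := hψ.aestronglyMeasurable
  have h1 : ∀ k, ∫ z, G k (ψ z) * dirDeriv v η z = -∫ z, η z * (deriv (G k) (ψ z) * f z) := fun k => by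
    obtain ⟨L, hL⟩ := hGl k
    exact H.comp hψ hf (hGd k) hL η hη
  have l1 : Tendsto (fun k => ∫ z, G k (ψ z) * dirDeriv v η z) atTop
      (𝓝 (∫ z, V (ψ z) * dirDeriv v η z)) := by
    refine tendsto_integral_of_dominated_convergence (fun z => |V (ψ z) * dirDeriv v η z|)
      (fun k => ((hGd k).continuous.comp_aestronglyMeasurable hψm).mul
        (hη.dirDeriv v).continuous.aestronglyMeasurable)
      ((hη.dirDeriv v).integrable_mul hVi).abs (fun k => ae_of_all _ fun z => ?_)
      (ae_of_all _ fun z => (hG3 _).mul_const _)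
    rw [Real.norm_eq_abs, abs_mul, abs_mul]
    exact mul_le_mul_of_nonneg_right (hG1 _ _) (abs_nonneg _)
  -- The dominating function is a product of two L²_loc functions; here V'(ψ) ∈ L²_loc enters.
  have hdom : LocallyIntegrable (fun z => (|deriv V (ψ z)| + C) * |f z|) := by
    have ha : MemL2Loc (fun z => |deriv V (ψ z)|) := fun K hK => (hVd K hK).abs
    have hb : MemL2Loc (fun z => |f z|) := fun K hK => (hf K hK).abs
    exact (ha.add (Continuous.memL2Loc (continuous_const (y := C)))).mul hb
  have l2 : Tendsto (fun k => ∫ z, η z * (deriv (G k) (ψ z) * f z)) atTop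
      (𝓝 (∫ z, η z * (deriv V (ψ z) * f z))) := by
    refine tendsto_integral_of_dominated_convergence
      (fun z => |η z * ((|deriv V (ψ z)| + C) * |f z|)|)
      (fun k => hη.continuous.aestronglyMeasurable.mul
        ((((measurable_deriv (G k)).comp_aemeasurable hψm.aemeasurable).aestronglyMeasurable).mul
          hf.aestronglyMeasurable))
      (hη.integrable_test_mul hdom).abs (fun k => ae_of_all _ fun z => ?_)
      (ae_of_all _ fun z => ((hG4 _).mul_const _).const_mul _)
    rw [Real.norm_eq_abs, abs_mul, abs_mul, abs_mul]
    refine mul_le_mul_of_nonneg_left ?_ (abs_nonneg _)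
    refine (mul_le_mul_of_nonneg_right (hG2 k _) (abs_nonneg _)).trans (le_abs_self _)
  refine tendsto_nhds_unique l1 ?_
  simp only [h1]
  exact l2.neg

end chainRule

/-! ### The conservation law from translations -/

section stress

variable {ψ m : SpaceTime n β → ℝ} {g : SpaceTime n β → Space n} {h c : SpaceTime n β → ℝ}
  {V : ℝ → ℝ} {w : SpaceTime n β → ℝ}

/-- Since m has compact support, ψ may be cut off to an L² function that agrees with it on K and its
short translates; its difference quotients converge strongly. -/
lemma integral_diffQuot (H : HasWGrad ψ g h) (hm : MemLp m 2) {K : Set (SpaceTime n β)}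
    (hK : IsCompact K) (hmK : ∀ z, z ∉ K → m z = 0) (v : Space n × ℝ) :
    (∀ t ∈ Icc (-1 : ℝ) 1,
      Integrable (fun z => (t⁻¹ * (ψ (z + proj (t • v)) + -1 * ψ z)) * m z)) ∧
    Tendsto (fun t : ℝ => ∫ z, (t⁻¹ * (ψ (z + proj (t • v)) + -1 * ψ z)) * m z) (𝓝[≠] 0)
      (𝓝 (∫ z, dirOf g h v z * m z)) := by
  have hcont : Continuous fun q : SpaceTime n β × ℝ => q.1 + proj (q.2 • v) := by
    have := continuous_proj (n := n) (β := β)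
    fun_prop
  obtain ⟨χ, hχ, -, -, hχ1⟩ := exists_cutoff ((hK.prod (isCompact_Icc (a := (-1 : ℝ)) (b := 1))).image
    hcont)
  have hχK : ∀ z ∈ K, ∀ t ∈ Icc (-1 : ℝ) 1, χ (z + proj (t • v)) = 1 := fun z hz t ht =>
    hχ1 _ ⟨(z, t), ⟨hz, ht⟩, rfl⟩
  have h01 : (0 : ℝ) ∈ Icc (-1 : ℝ) 1 := ⟨by norm_num, by norm_num⟩
  have hχ0 : ∀ z ∈ K, χ z = 1 := fun z hz => by simpa using hχK z hz 0 h01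
  have hχd : ∀ z ∈ K, dirDeriv v χ z = 0 := fun z hz => by
    have : (fun t : ℝ => χ (z + proj (t • v))) =ᶠ[𝓝 0] fun _ => 1 := by
      filter_upwards [Icc_mem_nhds (by norm_num : (-1 : ℝ) < 0) (by norm_num : (0 : ℝ) < 1)] with t ht
      exact hχK z hz t ht
    rw [dirDeriv, this.deriv_eq, deriv_const]
  set F : SpaceTime n β → ℝ := fun z => χ z * ψ z with hF
  set D : SpaceTime n β → ℝ := fun z => χ z * dirOf g h v z + ψ z * dirDeriv v χ z with hD
  have mF : MemLp F 2 := H.memφ.test_mul hχ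
  have mD : MemLp D 2 := by
    refine ((H.memDir v).test_mul hχ).add ?_
    have := H.memφ.test_mul (hχ.dirDeriv v)
    simpa only [mul_comm] using this
  have hFD : IsWeakDir v F D :=
    (H.weak v).test_mul H.memφ.locallyIntegrable (H.memDir v).locallyIntegrable hχ
  have e1 : ∀ t ∈ Icc (-1 : ℝ) 1, ∀ z, (t⁻¹ * (ψ (z + proj (t • v)) + -1 * ψ z)) * m z =
      (t⁻¹ * (F (z + proj (t • v)) - F z)) * m z := fun t ht z => by
    by_cases hz : z ∈ K
    · simp only [hF, hχK z hz t ht, hχ0 z hz]; ring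
    · simp [hmK z hz]
  have e2 : ∀ z, dirOf g h v z * m z = D z * m z := fun z => by
    by_cases hz : z ∈ K
    · simp only [hD, hχd z hz, hχ0 z hz]; ring
    · simp [hmK z hz]
  have mq : ∀ t : ℝ, MemLp (fun z => F (z + proj (t • v)) - F z) 2 := fun t =>
    (memLp_comp_add mF _).sub mF
  have iq : ∀ t : ℝ, Integrable (fun z => (t⁻¹ * (F (z + proj (t • v)) - F z)) * m z) := fun t =>
    ((mq t).const_mul t⁻¹).integrable_mul hm
  refine ⟨fun t ht => by simp only [e1 t ht]; exact iq t, ?_⟩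
  simp only [e2]
  rw [Metric.tendsto_nhdsWithin_nhds]
  intro ε hε
  have hm0 := l2_nonneg m
  obtain ⟨δ, hδ, hle⟩ := l2_diffQuot_le mF mD hFD (ε := ε / (2 * (l2 m + 1))) (by positivity)
  refine ⟨min δ 1, lt_min hδ one_pos, fun {t} ht0 ht => ?_⟩
  rw [Real.dist_eq, sub_zero] at ht
  have ht1 : t ∈ Icc (-1 : ℝ) 1 := abs_le.1 (ht.le.trans (min_le_right _ _))
  have ht0' : t ≠ 0 := ht0
  simp only [e1 t ht1]
  have iD : Integrable (fun z => D z * m z) := mD.integrable_mul hm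
  rw [Real.dist_eq, ← integral_sub (iq t) iD]
  have e3 : ∀ z, (t⁻¹ * (F (z + proj (t • v)) - F z)) * m z - D z * m z =
      t⁻¹ * ((F (z + proj (t • v)) - F z - t * D z) * m z) := fun z => by field_simp
  simp only [e3]
  rw [integral_const_mul, abs_mul, abs_inv]
  have h2 := abs_integral_mul_le ((mq t).sub (mD.const_mul t)) hm
  have h3 := hle t (ht.trans_le (min_le_left _ _))
  have ht2 : 0 < |t| := abs_pos.2 ht0'
  calc |t|⁻¹ * _ ≤ |t|⁻¹ * (ε / (2 * (l2 m + 1)) * |t| * l2 m) :=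
        mul_le_mul_of_nonneg_left (h2.trans (mul_le_mul_of_nonneg_right h3 hm0)) (by positivity)
    _ = ε / 2 * (l2 m / (l2 m + 1)) := by field_simp
    _ ≤ ε / 2 * 1 := by
      refine mul_le_mul_of_nonneg_left ?_ (by positivity)
      rw [div_le_one (by positivity)]; linarith
    _ < ε := by linarith

/-- The local conservation law obtained from translations, for nonnegative test functions. -/
lemma stress_of_nonneg (H : HasWGrad ψ g h) (mg : MemLp g 2) (mh : MemLp h 2) (hc : MemL2Loc c)
    (hE : ∀ η, IsTest η → ∫ z, (dTau η z * h z + inner ℝ (gradX η z) (g z) + η z * c z) = 0)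
    (hw : IsTest w) (hw0 : ∀ z, 0 ≤ w z) (v : Space n × ℝ) :
    ∫ z, dirOf g h v z * (dTau w z * h z + inner ℝ (gradX w z) (g z) + w z * c z) =
      ∫ z, ((1 / 2) * ‖g z‖ ^ 2 + (1 / 2) * h z ^ 2) * dirDeriv v w z := by
  set m : SpaceTime n β → ℝ := fun z => dTau w z * h z + inner ℝ (gradX w z) (g z) + w z * c z with hm
  set E : SpaceTime n β → ℝ := fun z => (1 / 2) * ‖g z‖ ^ 2 + (1 / 2) * h z ^ 2 with hEd
  obtain ⟨C, hC⟩ := hw.hasCompactSupport_gradX.exists_bound_of_continuous hw.continuous_gradX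
  have mm : MemLp m 2 := by
    refine ((mh.memL2Loc.test_mul hw.dTau).add ?_).add (hc.test_mul hw)
    refine mg.of_le_mul (c := C) (hw.continuous_gradX.aestronglyMeasurable.inner mg.1)
      (ae_of_all _ fun z => ?_)
    exact (norm_inner_le_norm _ _).trans (mul_le_mul_of_nonneg_right (hC z) (norm_nonneg _))
  have iE : Integrable E :=
    (((memLp_two_iff_integrable_sq_norm mg.1).1 mg).const_mul _).add
      (((memLp_two_iff_integrable_sq mh.1).1 mh).const_mul _)
  set K := tsupport (dTau w) ∪ tsupport (gradX w) ∪ tsupport w with hK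
  have hKc : IsCompact K := (hw.dTau.2.isCompact.union hw.hasCompactSupport_gradX.isCompact).union
    hw.2.isCompact
  have hK0 : ∀ z, z ∉ K → dTau w z = 0 ∧ gradX w z = 0 ∧ w z = 0 := fun z hz => by
    simp only [hK, mem_union, not_or] at hz
    exact ⟨image_eq_zero_of_notMem_tsupport hz.1.1, image_eq_zero_of_notMem_tsupport hz.1.2,
      image_eq_zero_of_notMem_tsupport hz.2⟩
  have hmK : ∀ z, z ∉ K → m z = 0 := fun z hz => by
    obtain ⟨h1, h2, h3⟩ := hK0 z hz
    simp [hm, h1, h2, h3]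
  obtain ⟨hDi, hDl⟩ := integral_diffQuot H mm hKc hmK v
  set Φ : ℝ → ℝ := fun t => ∫ z, E (z + proj (t • v)) * w z with hΦ
  have hΦd : HasDerivAt Φ (-∫ z, E z * dirDeriv v w z) 0 := by
    have h1 := hasDerivAt_integral_translate hw iE.locallyIntegrable (-v) 0
    have h2 : Φ = fun t : ℝ => ∫ z, E z * w (z + proj (t • -v)) := by
      ext t
      simp only [hΦ]
      rw [integral_comp_add_mul, smul_neg, map_neg]
    rw [h2]
    refine h1.congr_deriv ?_
    rw [← integral_neg]
    refine integral_congr_ae (ae_of_all _ fun z => ?_)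
    have h3 := dirDeriv_smul hw (-1) v z
    simp only [neg_smul, one_smul] at h3
    simp [h3]
  -- The equation is tested with w times the difference quotient of ψ. By the identity (a - b)·b =
  -- |a|²/2 - |b|²/2 - |a - b|²/2, applied to the translated and original gradients, this is a
  -- difference quotient of energies minus t⁻¹ Q with Q ≥ 0.
  have key : ∀ t ∈ Icc (-1 : ℝ) 1, t ≠ 0 → ∃ Q, 0 ≤ Q ∧
      t⁻¹ * (Φ t - Φ 0) + ∫ z, (t⁻¹ * (ψ (z + proj (t • v)) + -1 * ψ z)) * m z = t⁻¹ * Q := by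
    intro t ht ht0
    set a : SpaceTime n β := proj (t • v) with ha
    have Ht := (((H.comp_add a).add (H.const_mul (-1))).const_mul t⁻¹).test_mul hw
    have h1 := weakEquation_extend mg.memL2Loc mh.memL2Loc hc hE Ht
      (HasCompactSupport.intro hKc fun z hz => by rw [(hK0 z hz).2.2, zero_mul])
      (HasCompactSupport.intro hKc fun z hz => by
        rw [(hK0 z hz).2.2, (hK0 z hz).2.1, zero_smul, smul_zero, add_zero])
      (HasCompactSupport.intro hKc fun z hz => by
        rw [(hK0 z hz).2.2, (hK0 z hz).1, zero_mul, mul_zero, add_zero])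
    set Qf : SpaceTime n β → ℝ := fun z =>
      w z * ((1 / 2) * (‖g (z + a) - g z‖ ^ 2 + (h (z + a) - h z) ^ 2)) with hQf
    have mga := (memLp_comp_add mg a).sub mg
    have mha := (memLp_comp_add mh a).sub mh
    have iQ : Integrable Qf := hw.integrable_test_mul (Integrable.locallyIntegrable
      ((((memLp_two_iff_integrable_sq_norm mga.1).1 mga).add
        ((memLp_two_iff_integrable_sq mha.1).1 mha)).const_mul _))
    have iEa : Integrable (fun z => E (z + a) * w z) :=
      hw.integrable_mul (iE.comp_add_right a).locallyIntegrable
    have iE0 : Integrable (fun z => E z * w z) := hw.integrable_mul iE.locallyIntegrable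
    refine ⟨∫ z, Qf z, integral_nonneg fun z => mul_nonneg (hw0 z) (by positivity), ?_⟩
    have e : ∀ z, (w z * (t⁻¹ * (h (z + a) + -1 * h z)) +
        t⁻¹ * (ψ (z + a) + -1 * ψ z) * dTau w z) * h z +
        inner ℝ (w z • t⁻¹ • (g (z + a) + (-1 : ℝ) • g z) +
          (t⁻¹ * (ψ (z + a) + -1 * ψ z)) • gradX w z) (g z) +
        w z * (t⁻¹ * (ψ (z + a) + -1 * ψ z)) * c z =
        (t⁻¹ * (E (z + a) * w z - E z * w z) - t⁻¹ * Qf z) +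
          (t⁻¹ * (ψ (z + a) + -1 * ψ z)) * m z := fun z => by
      simp only [hm, hEd, hQf, norm_sub_sq_real, inner_add_left, inner_smul_left, neg_smul, one_smul,
        inner_neg_left, real_inner_self_eq_norm_sq]
      simp
      ring
    simp only [e] at h1
    have i1 : Integrable (fun z => t⁻¹ * (E (z + a) * w z - E z * w z)) :=
      (iEa.sub iE0).const_mul _
    have i12 : Integrable (fun z => t⁻¹ * (E (z + a) * w z - E z * w z) - t⁻¹ * Qf z) :=
      i1.sub (iQ.const_mul _)
    rw [integral_add i12 (hDi t ht), integral_sub i1 (iQ.const_mul _), integral_const_mul,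
      integral_const_mul, integral_sub iEa iE0] at h1
    have h2 : Φ 0 = ∫ z, E z * w z := by simp [hΦ]
    rw [h2]
    linarith
  have hlim : Tendsto (fun t : ℝ => t⁻¹ * (Φ t - Φ 0) +
      ∫ z, (t⁻¹ * (ψ (z + proj (t • v)) + -1 * ψ z)) * m z) (𝓝[≠] 0)
      (𝓝 (-(∫ z, E z * dirDeriv v w z) + ∫ z, dirOf g h v z * m z)) := by
    refine Tendsto.add ?_ hDl
    simpa using hΦd.tendsto_slope_zero
  have hnear : ∀ᶠ t : ℝ in 𝓝 0, t ∈ Icc (-1 : ℝ) 1 := Icc_mem_nhds (by norm_num) (by norm_num)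
  -- The remainder t⁻¹ Q has the sign of t, so the two one-sided limits give opposite inequalities
  -- for the same quantity; no convergence of the remainder has to be known.
  have hpos : 0 ≤ -(∫ z, E z * dirDeriv v w z) + ∫ z, dirOf g h v z * m z := by
    refine ge_of_tendsto (hlim.mono_left (nhdsWithin_mono 0 (s := Ioi 0) fun t (ht : 0 < t) => ht.ne'))
      ?_
    filter_upwards [self_mem_nhdsWithin, nhdsWithin_le_nhds hnear] with t ht ht1
    obtain ⟨Q, hQ, hQe⟩ := key t ht1 (ne_of_gt ht)
    rw [hQe]
    exact mul_nonneg (inv_nonneg.2 (le_of_lt ht)) hQ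
  have hneg : -(∫ z, E z * dirDeriv v w z) + ∫ z, dirOf g h v z * m z ≤ 0 := by
    refine le_of_tendsto (hlim.mono_left (nhdsWithin_mono 0 (s := Iio 0) fun t (ht : t < 0) => ht.ne))
      ?_
    filter_upwards [self_mem_nhdsWithin, nhdsWithin_le_nhds hnear] with t ht ht1
    obtain ⟨Q, hQ, hQe⟩ := key t ht1 (ne_of_lt ht)
    rw [hQe]
    exact mul_nonpos_of_nonpos_of_nonneg (inv_nonpos.2 (le_of_lt ht)) hQ
  linarith

/-- The local conservation law obtained from translations. -/
lemma stress_identity (H : HasWGrad ψ g h) (mg : MemLp g 2) (mh : MemLp h 2)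
    (hVd : Differentiable ℝ V) (hVl : LocallyLipschitz V) (hVi : Integrable (fun z => V (ψ z)))
    (hV' : MemL2Loc (fun z => deriv V (ψ z)))
    (hE : ∀ η, IsTest η →
      ∫ z, (dTau η z * h z + inner ℝ (gradX η z) (g z) + η z * deriv V (ψ z)) = 0)
    (hw : IsTest w) (v : Space n × ℝ) :
    ∫ z, dirOf g h v z * (dTau w z * h z + inner ℝ (gradX w z) (g z)) =
      ∫ z, ((1 / 2) * ‖g z‖ ^ 2 + (1 / 2) * h z ^ 2 + V (ψ z)) * dirDeriv v w z := by
  have iE : Integrable (fun z => (1 / 2) * ‖g z‖ ^ 2 + (1 / 2) * h z ^ 2) :=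
    (((memLp_two_iff_integrable_sq_norm mg.1).1 mg).const_mul _).add
      (((memLp_two_iff_integrable_sq mh.1).1 mh).const_mul _)
  have hdir := H.memDir v
  have hwd := (H.weak v).comp_locallyLipschitz H.memφ hdir hVd hVl hVi.locallyIntegrable hV'
  have hmi : ∀ {w : SpaceTime n β → ℝ}, IsTest w →
      MemL2Loc (fun z => dTau w z * h z + inner ℝ (gradX w z) (g z)) := fun {w} hw => by
    obtain ⟨C, hC⟩ := hw.hasCompactSupport_gradX.exists_bound_of_continuous hw.continuous_gradX
    refine (mh.memL2Loc.test_mul hw.dTau).memL2Loc.add ?_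
    refine mg.memL2Loc.of_le_mul (C := C) (hw.continuous_gradX.aestronglyMeasurable.inner mg.1)
      (ae_of_all _ fun z => ?_)
    exact (norm_inner_le_norm _ _).trans (mul_le_mul_of_nonneg_right (hC z) (norm_nonneg _))
  have hi1 : ∀ {w : SpaceTime n β → ℝ}, IsTest w →
      Integrable (fun z => dirOf g h v z * (dTau w z * h z + inner ℝ (gradX w z) (g z))) := by
    intro w hw
    obtain ⟨χ, hχ, -, -, hχ1⟩ := exists_cutoff
      (hw.dTau.2.isCompact.union hw.hasCompactSupport_gradX.isCompact)
    refine (hχ.integrable_test_mul (hdir.mul (hmi hw))).congr (ae_of_all _ fun z => ?_)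
    by_cases hz : z ∈ tsupport (dTau w) ∪ tsupport (gradX w)
    · simp only [hχ1 z hz, one_mul]
    · simp only [mem_union, not_or] at hz
      simp [image_eq_zero_of_notMem_tsupport hz.1, image_eq_zero_of_notMem_tsupport hz.2]
  have hi2 : ∀ {w : SpaceTime n β → ℝ}, IsTest w → Integrable (fun z =>
      ((1 / 2) * ‖g z‖ ^ 2 + (1 / 2) * h z ^ 2 + V (ψ z)) * dirDeriv v w z) := fun {w} hw =>
    (hw.dirDeriv v).integrable_mul (iE.add hVi).locallyIntegrable
  have hpos : ∀ {w : SpaceTime n β → ℝ}, IsTest w → (∀ z, 0 ≤ w z) →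
      ∫ z, dirOf g h v z * (dTau w z * h z + inner ℝ (gradX w z) (g z)) =
      ∫ z, ((1 / 2) * ‖g z‖ ^ 2 + (1 / 2) * h z ^ 2 + V (ψ z)) * dirDeriv v w z := by
    intro w hw hw0
    have h1 := stress_of_nonneg H mg mh hV' hE hw hw0 v
    have h2 := hwd w hw
    have i3 : Integrable (fun z => w z * (deriv V (ψ z) * dirOf g h v z)) :=
      hw.integrable_test_mul (hV'.mul hdir)
    have e1 : ∀ z, dirOf g h v z *
        (dTau w z * h z + inner ℝ (gradX w z) (g z) + w z * deriv V (ψ z)) =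
        dirOf g h v z * (dTau w z * h z + inner ℝ (gradX w z) (g z)) +
          w z * (deriv V (ψ z) * dirOf g h v z) := fun z => by ring
    simp only [e1] at h1
    rw [integral_add (hi1 hw) i3] at h1
    simp only [add_mul _ (V _)]
    rw [integral_add ((hw.dirDeriv v).integrable_mul iE.locallyIntegrable)
      ((hw.dirDeriv v).integrable_mul hVi.locallyIntegrable), h2]
    linarith
  obtain ⟨M, hM0, hM⟩ := hw.exists_bound
  -- Both sides are linear in w, and w + Mχ is nonnegative with χ = 1 on the support of w; so the
  -- signed case is a difference of two nonnegative ones.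
  obtain ⟨χ, hχ, hχ0, -, hχ1⟩ := exists_cutoff hw.2.isCompact
  have hw' := hw.add (hχ.const_mul M)
  have h1 := hpos hw' fun z => by
    by_cases hz : z ∈ tsupport w
    · rw [hχ1 z hz]; linarith [(abs_le.1 (hM z)).1]
    · rw [image_eq_zero_of_notMem_tsupport hz, zero_add]; exact mul_nonneg hM0 (hχ0 z)
  have h2 := hpos hχ hχ0
  have eg : ∀ z, gradX (fun z => w z + M * χ z) z = gradX w z + M • gradX χ z := fun z => by
    refine ext_inner_right ℝ fun e => ?_
    rw [inner_gradX hw', dirDeriv_add hw (hχ.const_mul M), dirDeriv_const_mul M hχ, inner_add_left,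
      inner_smul_left, inner_gradX hw, inner_gradX hχ]
    simp
  have et : ∀ z, dTau (fun z => w z + M * χ z) z = dTau w z + M * dTau χ z := fun z => by
    simp only [dTau_eq, dirDeriv_add hw (hχ.const_mul M), dirDeriv_const_mul M hχ]
  have e1 : ∀ z, dirOf g h v z * (dTau (fun z => w z + M * χ z) z * h z +
      inner ℝ (gradX (fun z => w z + M * χ z) z) (g z)) =
      dirOf g h v z * (dTau w z * h z + inner ℝ (gradX w z) (g z)) +
      M * (dirOf g h v z * (dTau χ z * h z + inner ℝ (gradX χ z) (g z))) := fun z => by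
    rw [eg, et, inner_add_left, inner_smul_left]
    simp
    ring
  have e2 : ∀ z, ((1 / 2) * ‖g z‖ ^ 2 + (1 / 2) * h z ^ 2 + V (ψ z)) *
      dirDeriv v (fun z => w z + M * χ z) z =
      ((1 / 2) * ‖g z‖ ^ 2 + (1 / 2) * h z ^ 2 + V (ψ z)) * dirDeriv v w z +
      M * (((1 / 2) * ‖g z‖ ^ 2 + (1 / 2) * h z ^ 2 + V (ψ z)) * dirDeriv v χ z) := fun z => by
    rw [dirDeriv_add hw (hχ.const_mul M), dirDeriv_const_mul M hχ]
    ring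
  simp only [e1, e2] at h1
  rw [integral_add (hi1 hw) ((hi1 hχ).const_mul M), integral_const_mul,
    integral_add (hi2 hw) ((hi2 hχ).const_mul M), integral_const_mul, h2] at h1
  linarith

end stress

/-! ### Derrick's relation for saddle points -/

section pohozaev

variable {ψ : SpaceTime n β → ℝ} {g : SpaceTime n β → Space n} {h : SpaceTime n β → ℝ} {V : ℝ → ℝ}

/-- A test function of the space variables with prescribed gradient at the origin. -/
lemma exists_isTest_gradX_eq (e : Space n) : ∃ w : SpaceTime n β → ℝ, IsTest w ∧
    (∀ z, dTau w z = 0) ∧ ∀ τ, gradX w (0, τ) = e := by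
  let ζ : ContDiffBump (0 : Space n) := ⟨1, 2, one_pos, one_lt_two⟩
  have hw : IsTest (fun z : SpaceTime n β => ζ z.1 * inner ℝ z.1 e) :=
    isTest_of_space (a := fun x => ζ x * inner ℝ x e)
      (ζ.contDiff.mul (contDiff_id.inner ℝ contDiff_const)) ζ.hasCompactSupport.mul_right
  refine ⟨_, hw, fun z => by simp [dTau], fun τ => ext_inner_right ℝ fun e' => ?_⟩
  rw [inner_gradX hw, dirDeriv]
  have h1 : Tendsto (fun t : ℝ => t • e') (𝓝 0) (𝓝 0) := by
    have : Continuous fun t : ℝ => t • e' := by fun_prop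
    simpa using this.tendsto 0
  have h2 : (fun t : ℝ => ζ (((0, τ) : SpaceTime n β) + proj (t • (e', 0))).1 *
      inner ℝ (((0, τ) : SpaceTime n β) + proj (t • (e', 0))).1 e) =ᶠ[𝓝 0]
      fun t => t * inner ℝ e' e := by
    filter_upwards [h1.eventually ζ.eventuallyEq_one] with t ht
    simp only [Pi.one_apply] at ht
    simp [ht, inner_smul_left]
  rw [h2.deriv_eq, real_inner_comm]
  simp

-- Multiplying by R compensates the factor 1/R, so the gradient is only spread out: it stays bounded
-- uniformly in R and tends pointwise to its value over the origin.
omit [Fact (0 < β)] in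
lemma gradX_dilate {w : SpaceTime n β → ℝ} (hw : IsTest w) {R : ℝ} (hR : R ≠ 0)
    (z : SpaceTime n β) : gradX (fun z => R * w (dilate R hR z)) z = gradX w (dilate R hR z) := by
  refine ext_inner_right ℝ fun e => ?_
  rw [inner_gradX ((hw.dilate hR).const_mul R), dirDeriv_const_mul R (hw.dilate hR),
    dirDeriv_dilate, inner_gradX hw, show (R⁻¹ • ((e, 0) : Space n × ℝ).1, ((e, 0) : Space n × ℝ).2) =
      R⁻¹ • ((e, 0) : Space n × ℝ) by simp, dirDeriv_smul hw, mul_inv_cancel_left₀ hR]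

/-- The stress identity integrated against a linear vector field. -/
lemma integral_inner_sq_eq (H : HasWGrad ψ g h) (mg : MemLp g 2) (mh : MemLp h 2)
    (hVd : Differentiable ℝ V) (hVl : LocallyLipschitz V) (hVi : Integrable (fun z => V (ψ z)))
    (hV' : MemL2Loc (fun z => deriv V (ψ z)))
    (hE : ∀ η, IsTest η →
      ∫ z, (dTau η z * h z + inner ℝ (gradX η z) (g z) + η z * deriv V (ψ z)) = 0) (e : Space n) :
    ∫ z, inner ℝ (g z) e * inner ℝ e (g z) =
      ∫ z, ((1 / 2) * ‖g z‖ ^ 2 + (1 / 2) * h z ^ 2 + V (ψ z)) * inner ℝ e e := by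
  obtain ⟨w, hw, hwτ, hw0⟩ := exists_isTest_gradX_eq (β := β) e
  obtain ⟨C, hC⟩ := hw.hasCompactSupport_gradX.exists_bound_of_continuous hw.continuous_gradX
  have ig := (memLp_two_iff_integrable_sq_norm mg.1).1 mg
  have iE : Integrable (fun z => (1 / 2) * ‖g z‖ ^ 2 + (1 / 2) * h z ^ 2 + V (ψ z)) :=
    ((ig.const_mul _).add (((memLp_two_iff_integrable_sq mh.1).1 mh).const_mul _)).add hVi
  have hR : ∀ k : ℕ, (k : ℝ) + 1 ≠ 0 := fun k => by positivity
  set d : ℕ → SpaceTime n β → SpaceTime n β := fun k => dilate ((k : ℝ) + 1) (hR k) with hd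
  have hdc : ∀ k, Continuous (d k) := fun k => (dilate _ (hR k)).continuous
  have hlim : ∀ z, Tendsto (fun k => gradX w (d k z)) atTop (𝓝 e) := fun z => by
    have h1 : Tendsto (fun k => d k z) atTop (𝓝 (0, z.2)) := by
      refine Tendsto.prodMk_nhds ?_ tendsto_const_nhds
      have := (tendsto_one_div_add_atTop_nhds_zero_nat (𝕜 := ℝ)).smul_const z.1
      simpa using this
    have h2 := (hw.continuous_gradX.tendsto (0, z.2)).comp h1
    rwa [hw0] at h2
  -- The stress identity for (k+1) w(x/(k+1), τ) in the direction e. Both integrands are dominated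
  -- by multiples of integrable densities, so the limit k → ∞ leaves no boundary term.
  have key : ∀ k, ∫ z, inner ℝ (g z) e * inner ℝ (gradX w (d k z)) (g z) =
      ∫ z, ((1 / 2) * ‖g z‖ ^ 2 + (1 / 2) * h z ^ 2 + V (ψ z)) * inner ℝ (gradX w (d k z)) e := by
    intro k
    have hwk := (hw.dilate (hR k)).const_mul ((k : ℝ) + 1)
    have h1 := stress_identity H mg mh hVd hVl hVi hV' hE hwk (e, 0)
    have e1 : ∀ z, dTau (fun z => ((k : ℝ) + 1) * w (dilate ((k : ℝ) + 1) (hR k) z)) z = 0 :=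
      fun z => by
        rw [dTau_eq, dirDeriv_const_mul _ (hw.dilate (hR k)), dirDeriv_dilate]
        simp only [smul_zero]
        rw [← dTau_eq, hwτ, mul_zero]
    simp only [← inner_gradX hwk, gradX_dilate hw (hR k), e1, dirOf, zero_mul, zero_add, mul_zero,
      add_zero] at h1
    exact h1
  have hgm : ∀ k, AEStronglyMeasurable (fun z => gradX w (d k z)) := fun k =>
    (hw.continuous_gradX.comp (hdc k)).aestronglyMeasurable
  have l1 : Tendsto (fun k => ∫ z, inner ℝ (g z) e * inner ℝ (gradX w (d k z)) (g z)) atTop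
      (𝓝 (∫ z, inner ℝ (g z) e * inner ℝ e (g z))) := by
    refine tendsto_integral_of_dominated_convergence (fun z => (‖e‖ * C) * ‖g z‖ ^ 2)
      (fun k => (mg.1.inner aestronglyMeasurable_const).mul ((hgm k).inner mg.1))
      (ig.const_mul _) (fun k => ae_of_all _ fun z => ?_)
      (ae_of_all _ fun z => ((hlim z).inner tendsto_const_nhds).const_mul _)
    rw [norm_mul]
    calc _ ≤ (‖g z‖ * ‖e‖) * (‖gradX w (d k z)‖ * ‖g z‖) :=
          mul_le_mul (norm_inner_le_norm _ _) (norm_inner_le_norm _ _) (norm_nonneg _) (by positivity)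
      _ ≤ (‖g z‖ * ‖e‖) * (C * ‖g z‖) := by gcongr; exact hC _
      _ = _ := by ring
  have l2 : Tendsto (fun k => ∫ z, ((1 / 2) * ‖g z‖ ^ 2 + (1 / 2) * h z ^ 2 + V (ψ z)) *
      inner ℝ (gradX w (d k z)) e) atTop
      (𝓝 (∫ z, ((1 / 2) * ‖g z‖ ^ 2 + (1 / 2) * h z ^ 2 + V (ψ z)) * inner ℝ e e)) := by
    refine tendsto_integral_of_dominated_convergence
      (fun z => ‖(1 / 2) * ‖g z‖ ^ 2 + (1 / 2) * h z ^ 2 + V (ψ z)‖ * (C * ‖e‖))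
      (fun k => iE.1.mul ((hgm k).inner aestronglyMeasurable_const))
      (iE.norm.mul_const _) (fun k => ae_of_all _ fun z => ?_)
      (ae_of_all _ fun z => ((hlim z).inner tendsto_const_nhds).const_mul _)
    rw [norm_mul]
    refine mul_le_mul_of_nonneg_left ((norm_inner_le_norm _ _).trans ?_) (norm_nonneg _)
    exact mul_le_mul_of_nonneg_right (hC _) (norm_nonneg _)
  simp only [key] at l1
  exact tendsto_nhds_unique l1 l2

/-- Saddle points of finite action satisfy Derrick's relation. -/
lemma IsSaddlePoint.derrick (H : IsSaddlePoint V ψ) (hf : FiniteAction V ψ)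
    (hVd : Differentiable ℝ V) (hVl : LocallyLipschitz V) :
    ((n : ℝ) - 2) * gradientEnergy ψ + n * (potentialEnergy V ψ + kineticEnergy ψ) = 0 := by
  obtain ⟨⟨hW, -⟩, hV', hE⟩ := H
  have HW := hW.hasWGrad
  obtain ⟨f1, f2, f3⟩ := hf
  have mg : MemLp (weakGradX ψ) 2 := (memLp_two_iff_integrable_sq_norm HW.memg.aestronglyMeasurable).2 f1
  have mh : MemLp (weakDTau ψ) 2 := (memLp_two_iff_integrable_sq HW.memh.aestronglyMeasurable).2 f2
  -- For each axis the integral of (∂ᵢψ)² equals the whole action. Summing over the n axes gives 2𝒯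
  -- = n(𝒯 + 𝒦 + 𝒱), which is Derrick's relation.
  have h1 : ∀ i : Fin n, ∫ z, weakGradX ψ z i ^ 2 =
      gradientEnergy ψ + kineticEnergy ψ + potentialEnergy V ψ := fun i => by
    have h2 := integral_inner_sq_eq HW mg mh hVd hVl f3 hV' hE (EuclideanSpace.single i 1)
    rw [gradientEnergy, kineticEnergy, potentialEnergy,
      ← integral_add_three (f1.const_mul _) (f2.const_mul _) f3]
    refine Eq.trans (integral_congr_ae (ae_of_all _ fun z => ?_))
      (h2.trans (integral_congr_ae (ae_of_all _ fun z => ?_)))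
    · simp [EuclideanSpace.inner_single_right, EuclideanSpace.inner_single_left, sq]
    · simp
  have h2 : ∫ z, ‖weakGradX ψ z‖ ^ 2 = ∑ i : Fin n, ∫ z, weakGradX ψ z i ^ 2 := by
    rw [← integral_finsetSum]
    · refine integral_congr_ae (ae_of_all _ fun z => ?_)
      simp only [EuclideanSpace.real_norm_sq_eq]
    · intro i _
      refine f1.mono' (((PiLp.continuous_apply 2 (fun _ : Fin n => ℝ) i).comp_aestronglyMeasurable
        mg.1).pow 2) (ae_of_all _ fun z => ?_)
      rw [norm_pow]
      exact pow_le_pow_left₀ (norm_nonneg _) (PiLp.norm_apply_le _ i) 2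
  have h3 : gradientEnergy ψ = (1 / 2) * ∫ z, ‖weakGradX ψ z‖ ^ 2 := integral_const_mul _ _
  simp only [h1, Finset.sum_const, Finset.card_univ, Fintype.card_fin, nsmul_eq_mul] at h2
  rw [h2] at h3
  linarith

end pohozaev

/-! ### Scale selection and minimality -/

section main

variable {V : ℝ → ℝ} {φ ψ : SpaceTime n β → ℝ}

lemma derrick_succ_iff : Derrick (n + 1) V φ ↔
    ((n : ℝ) - 2) * gradientEnergy φ + n * (potentialEnergy V φ + kineticEnergy φ) = 0 := by
  have h1 : (((n + 1 : ℕ) : ℝ) - 3) = (n : ℝ) - 2 := by push_cast; ring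
  have h2 : (((n + 1 : ℕ) : ℝ) - 1) = (n : ℝ) := by push_cast; ring
  rw [Derrick, h1, h2]

/-- After division by l^(n-2) the relation for the rescaled function is l² = q with q > 0, which has
one positive root. -/
lemma existsUnique_derrick (hn : 3 ≤ n) (hφ : IsConfig φ) (hT : 0 < gradientEnergy φ)
    (hW : potentialEnergy V φ + kineticEnergy φ < 0) :
    ∃! l : ℝ, 0 < l ∧ Derrick (n + 1) V (rescale l φ) := by
  have h3 : (3 : ℝ) ≤ n := by exact_mod_cast hn
  set q : ℝ := ((n : ℝ) - 2) * gradientEnergy φ / (n * -(potentialEnergy V φ + kineticEnergy φ))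
    with hq
  have hden : 0 < (n : ℝ) * -(potentialEnergy V φ + kineticEnergy φ) :=
    mul_pos (by linarith) (by linarith)
  have hq0 : 0 < q := div_pos (mul_pos (by linarith) hT) hden
  have key : ∀ l : ℝ, 0 < l → (Derrick (n + 1) V (rescale l φ) ↔ l ^ 2 = q) := fun l hl => by
    have h4 : l ^ n = l ^ (n - 2) * l ^ 2 := by rw [← pow_add, Nat.sub_add_cancel (by omega)]
    rw [derrick_succ_iff, gradientEnergy_rescale hφ hl (by omega), kineticEnergy_rescale hφ hl,
      potentialEnergy_rescale hl, hq, eq_div_iff hden.ne', h4]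
    have h5 : ((n : ℝ) - 2) * (l ^ (n - 2) * gradientEnergy φ) +
        n * (l ^ (n - 2) * l ^ 2 * potentialEnergy V φ + l ^ (n - 2) * l ^ 2 * kineticEnergy φ) =
        l ^ (n - 2) * (((n : ℝ) - 2) * gradientEnergy φ -
          l ^ 2 * (n * -(potentialEnergy V φ + kineticEnergy φ))) := by ring
    rw [h5, mul_eq_zero, or_iff_right (pow_pos hl _).ne', sub_eq_zero, eq_comm]
  refine ⟨√q, ⟨Real.sqrt_pos.2 hq0, (key _ (Real.sqrt_pos.2 hq0)).2 (Real.sq_sqrt hq0.le)⟩, ?_⟩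
  rintro l ⟨hl, hd⟩
  rw [← (key l hl).1 hd, Real.sqrt_sq hl.le]

/-- Among the solutions of Derrick's relation, a ground state has the least gradient energy. -/
lemma gradientEnergy_le_of_derrick (hn : 3 ≤ n) {c T T' : ℝ} (hc : 0 < c) (hT : 0 < T) (hT' : 0 < T')
    (h1 : c * T ^ ((n : ℝ) / ((n : ℝ) - 2)) = ((n : ℝ) - 2) / n * T)
    (h2 : ((n : ℝ) - 2) / n * T' ≤ c * T' ^ ((n : ℝ) / ((n : ℝ) - 2))) : T ≤ T' := by
  have h3 : (3 : ℝ) ≤ n := by exact_mod_cast hn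
  set p : ℝ := (n : ℝ) / ((n : ℝ) - 2) with hp
  have hp1 : 0 < p - 1 := by
    rw [hp, sub_pos, one_lt_div (by linarith)]; linarith
  have e : ∀ {S : ℝ}, 0 < S → S ^ p = S ^ (p - 1) * S := fun hS => by
    rw [← Real.rpow_add_one hS.ne', sub_add_cancel]
  rw [e hT, ← mul_assoc] at h1
  rw [e hT', ← mul_assoc] at h2
  have h4 := mul_right_cancel₀ hT.ne' h1
  have h5 := le_of_mul_le_mul_right h2 hT'
  rw [← h4] at h5
  exact (Real.rpow_le_rpow_iff hT.le hT'.le hp1).1 (le_of_mul_le_mul_left h5 hc)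

/-- Derrick's relation ties 𝒦 + 𝒱 to 𝒯. For φ this normalises c so that the first variations of F
and S agree; for a competing saddle point it turns F ≥ 0 into a comparison of gradient energies. -/
lemma isSaddlePoint_of_derrick (hn : 3 ≤ n) (hV : Admissible (n + 1) V) (hVd : Differentiable ℝ V)
    (hVl : LocallyLipschitz V) {c : ℝ} (hc : 0 < c)
    (H : IsGroundState c ((n : ℝ) / ((n : ℝ) - 2)) V φ) (hT : 0 < gradientEnergy φ)
    (hd : ((n : ℝ) - 2) * gradientEnergy φ + n * (potentialEnergy V φ + kineticEnergy φ) = 0)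
    (hneg : potentialEnergy V φ < 0) :
    IsSaddlePoint V φ ∧ FiniteAction V φ ∧ ¬ (φ =ᵐ[volume] 0) ∧
      ∀ ψ : SpaceTime n β → ℝ, IsSaddlePoint V ψ → ¬ (ψ =ᵐ[volume] 0) → action V φ ≤ action V ψ := by
  have h3 : (3 : ℝ) ≤ n := by exact_mod_cast hn
  have hn0 : (n : ℝ) ≠ 0 := by linarith
  have hn2 : (n : ℝ) - 2 ≠ 0 := by linarith
  set p : ℝ := (n : ℝ) / ((n : ℝ) - 2) with hp
  have hp1 : 1 ≤ p := by rw [hp, one_le_div (by linarith)]; linarith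
  have hW : ∀ {χ : SpaceTime n β → ℝ},
      ((n : ℝ) - 2) * gradientEnergy χ + n * (potentialEnergy V χ + kineticEnergy χ) = 0 →
      kineticEnergy χ + potentialEnergy V χ = -(((n : ℝ) - 2) / n * gradientEnergy χ) := by
    intro χ h
    field_simp
    linarith
  have h1 : c * gradientEnergy φ ^ p = ((n : ℝ) - 2) / n * gradientEnergy φ := by
    have := H.eq_zero
    have := hW hd
    linarith
  have hcp : c * (p * gradientEnergy φ ^ (p - 1)) = 1 := by
    have e : gradientEnergy φ ^ p = gradientEnergy φ ^ (p - 1) * gradientEnergy φ := by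
      rw [← Real.rpow_add_one hT.ne', sub_add_cancel]
    rw [e, ← mul_assoc] at h1
    have h4 := mul_right_cancel₀ hT.ne' h1
    calc c * (p * gradientEnergy φ ^ (p - 1)) = p * (c * gradientEnergy φ ^ (p - 1)) := by ring
      _ = 1 := by rw [h4, hp]; field_simp
  obtain ⟨M, hM⟩ := H.exists_bound hn hc hp1 hV hT
  refine ⟨H.isSaddlePoint hT hcp hM hVd hVl, H.finite, fun h0 => hneg.ne ?_, fun ψ hψ hψ0 => ?_⟩
  · rw [potentialEnergy]
    refine integral_eq_zero_of_ae ?_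
    filter_upwards [h0] with z hz
    simp [hz, hV.map_zero]
  · by_cases hf : FiniteAction V ψ
    · have hdψ := hψ.derrick hf hVd hVl
      have hTψ : 0 < gradientEnergy ψ := (gradientEnergy_nonneg ψ).lt_of_ne fun h =>
        hψ0 (ae_eq_zero_of_gradientEnergy_eq_zero (by omega) hψ.1 hf.1 h.symm)
      have h4 := H.nonneg ψ hψ.1 hf
      have h5 := hW hdψ
      have h6 := gradientEnergy_le_of_derrick hn hc hT hTψ h1 (by linarith)
      rw [action, action, if_pos H.finite, if_pos hf, EReal.coe_le_coe_iff, add_assoc, add_assoc, h5,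
        hW hd]
      -- On solutions of Derrick's relation the action is (2/n) 𝒯, so ordering the actions is
      -- ordering the gradient energies.
      have h7 : ∀ T : ℝ, T + -(((n : ℝ) - 2) / n * T) = 2 / n * T := fun T => by field_simp; ring
      rw [h7, h7]
      exact mul_le_mul_of_nonneg_left h6 (by positivity)
    · rw [action, action, if_neg hf]
      exact le_top

lemma reducedSolution_saddlePoint (hn : 3 ≤ n) (hV : Admissible (n + 1) V)
    (hVd : Differentiable ℝ V) (hVl : LocallyLipschitz V) (hφ : IsReducedSolution (n + 1) V φ) :
    (∃! l : ℝ, 0 < l ∧ Derrick (n + 1) V (rescale l φ)) ∧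
      ∀ l : ℝ, 0 < l → Derrick (n + 1) V (rescale l φ) →
        IsSaddlePoint V (rescale l φ) ∧ FiniteAction V (rescale l φ) ∧
          ¬ (rescale l φ =ᵐ[volume] 0) ∧
          ∀ ψ : SpaceTime n β → ℝ, IsSaddlePoint V ψ → ¬ (ψ =ᵐ[volume] 0) →
            action V (rescale l φ) ≤ action V ψ := by
  obtain ⟨hT, hW, c, hc, H⟩ := exists_isGroundState hn hV.map_zero hφ
  refine ⟨existsUnique_derrick hn H.config hT hW, fun l hl hd => ?_⟩
  refine isSaddlePoint_of_derrick hn hV hVd hVl hc (H.rescale hn hl) ?_ (derrick_succ_iff.1 hd) ?_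
  · rw [gradientEnergy_rescale H.config hl (by omega)]
    positivity
  · rw [potentialEnergy_rescale hl]
    exact mul_neg_of_pos_of_neg (by positivity) (by linarith [kineticEnergy_nonneg φ])

end main

end Bounce

theorem mainTheorem3 (D : ℕ) (hD : 3 < D) (β : ℝ) [Fact (0 < β)] (V : ℝ → ℝ)
    (hV : Admissible D V) (hdiff : Differentiable ℝ V) (hlip : LocallyLipschitz V)
    (φ : SpaceTime (D - 1) β → ℝ) (hφ : IsReducedSolution D V φ) :
    (∃! l : ℝ, 0 < l ∧ Derrick D V (rescale l φ)) ∧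
      ∀ l : ℝ, 0 < l → Derrick D V (rescale l φ) →
        IsSaddlePoint V (rescale l φ) ∧ FiniteAction V (rescale l φ) ∧
          ¬ (rescale l φ =ᵐ[volume] 0) ∧
          ∀ ψ : SpaceTime (D - 1) β → ℝ, IsSaddlePoint V ψ → ¬ (ψ =ᵐ[volume] 0) →
            action V (rescale l φ) ≤ action V ψ := by
  -- Writing D = n + 1 makes D - 1 reduce to n by definition, so no transport between types is
  -- needed.
  obtain ⟨n, rfl⟩ : ∃ n, D = n + 1 := ⟨D - 1, by omega⟩
  exact reducedSolution_saddlePoint (n := n) (by omega) hV hdiff hlip hφ
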